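/- **Setting.** Let $\Omega\subset\mathbb R^2$ be a nonempty bounded open polygonal domain. For $\delta>0$ put $\Omega_\delta^c=\{y\notin\Omega:\operatorname{dist}(y,\partial\Omega)<\delta\}$ and $\widehat\Omega_\delta=\Omega\cup\Omega_\delta^c$. Let $u_0\in C_b^4(\Omega)$ solve $-\Delta u_0=f_0$ in $\Omega$, $u_0=g_0$ on $\partial\Omega$, and let $\widetilde u_0\in C^4_b(\widehat\Omega_{\delta_0})$, for some $\delta_0>0$, be a $C^4$ extension of $u_0$ (here $C_b^4$ means that all derivatives up to order 4 are continuous and bounded). *Kernels.* Let $\gamma$ be positive and integrable on $(0,1)$ with $2\pi\int_0^1 s^3\gamma(s)\,ds=2$, and let $\gamma_\delta(x,y)=\delta^{-4}\gamma(|y-x|/\delta)$ for $|y-x|<\delta$ and $\gamma_\delta(x,y)=0$ otherwise. Put $\Phi(t)=\pi\int_0^t\rho^3\gamma(\rho)\,d\rho$; let $\lambda=2$ if the (left) derivative $\Phi'(1)$ exists and is nonzero, and $\lambda=4$ if $\Phi'(1)=0$ and $\Phi''(1)$ exists and is nonzero. *Polygons.* Consider a family of parameters $(\delta,h)$ with $0<h<\delta$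 and $\delta\to0$ (more precisely, a family indexed by a set with a filter along which $\delta\to0$; all objects below depend on the index). For every $x\in\widehat\Omega_\delta$ let $B_{\delta,n_\delta^x}$ be a polygon with $n_\delta^x\ge3$ sides inscribed in the circle of centre $x$ and radius $\delta$, depending measurably on $x$. Let $n_\delta$, $n_{\delta,\inf}$ be the supremum (assumed finite) and the infimum of $n_\delta^x$ over $x\in\widehat\Omega_\delta$. Assume that the family is weakly quasi-uniform: there are $C_1,C_2,C_3>0$, independent of the parameters, such that for all $x\in\widehat\Omega_\delta$ the longest side $H_{n_\delta^x}$ satisfies $H_{n_\delta^x}/(2\sin(\pi/n_\delta^x))\le C_1\delta$, the largest disc centred at $x$ and contained in $B_{\delta,n_\delta^x}$ has radius at least $C_2\delta$, and $n_\delta\le C_3n_{\delta,\inf}$. Assume also $n_\delta\to\infty$ and $n_\delta\sim\delta/h$ (two-sided bounds with constants independent of the parameters). Put $$\gamma_{\delta,n_\delta}(x,y)=\tfrac12\gamma_\delta(x,y)\bigl(\chi_{B_{\delta,n_\delta^x}}(y)+\chi_{B'_{\delta,n_\delta^x}}(y)\bigr),\qquad B'_{\delta,n_\delta^x}=\{y\in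 B_\delta(x):x\in B_{\delta,n_\delta^y}\},$$ $$\mathcal L_{\delta,n_\delta}u(x)=2\int_{\mathbb R^2}(u(y)-u(x))\gamma_{\delta,n_\delta}(x,y)\,dy,\qquad \|u\|_{\delta,n_\delta}^2=\int_{\widehat\Omega_\delta}\int_{\widehat\Omega_\delta}(u(y)-u(x))^2\gamma_{\delta,n_\delta}(x,y)\,dy\,dx,$$ and assume $\int_{\widehat\Omega_\delta}(y_i-x_i)\gamma_{\delta,n_\delta}(x,y)\,dy\to0$ as $\delta\to0$ for $i=1,2$ and every $x\in\Omega$. *Data and nonlocal solution.* Let $\mu\in\{0,1\}$, $\sup_{\Omega}|f_\delta-f_0|=O(\delta^2)$ and $\sup_{\Omega_\delta^c}|g_\delta-\widetilde u_0|=O(\delta^{2+\mu})$. Let $u_{\delta,n_\delta}\in L^2(\widehat\Omega_\delta)$ satisfy $-\mathcal L_{\delta,n_\delta}u_{\delta,n_\delta}=f_\delta$ a.e. on $\Omega$ and $u_{\delta,n_\delta}=g_\delta$ a.e. on $\Omega_\delta^c$. *Linear conforming discontinuous Galerkin (CDG) method.* Let $\overline\Omega$ be triangulated by a conforming triangulation,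 and let $\Omega_\delta^c$ be covered by a conforming triangulation whose triangles lie outside $\Omega$ and meet $\overline{\Omega_\delta^c}$ (the two need not match across $\partial\Omega$). Both are quasi-uniform of mesh size $h$: every triangle has diameter at most $h$ and contains a disc of radius $\rho h$, where $\rho>0$ may depend on $\delta$. Let $V_\delta^{0,h}$ be the space of functions that are continuous piecewise linear on $\Omega$ and vanish outside $\Omega$, and $V_\delta^{c,h}$ the space of functions that are continuous piecewise linear on $\Omega_\delta^c$ and vanish outside $\Omega_\delta^c$. Let $g_\delta^h\in V_\delta^{c,h}$ approximate $g_\delta$ in the sense that, with $K$ independent of the parameters, $\sup_{\Omega_\delta^c}|g_\delta-g_\delta^h|\le K\bigl(\sup_{\Omega_\delta^c}|g_\delta-v|+h^2\bigr)$ for all $v\in V_\delta^{c,h}$. The CDG solution is $u^h_{\delta,n_\delta}=u^{0,h}_{\delta,n_\delta}+g_\delta^h$, where $u^{0,h}_{\delta,n_\delta}\in V_\delta^{0,h}$ satisfies, for all $w_h\in V_\delta^{0,h}$, $$-2\int_\Omega w_h(x)\int_\Omega\bigl(u^{0,h}_{\delta,n_\delta}(y)-u^{0,h}_{\delta,n_\delta}(x)\bigr)\gamma_{\delta,n_\delta}(x,y)\,dy\,dx=\int_\Omega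 f_\delta w_h\,dx+2\int_\Omega w_h(x)\int_{\Omega_\delta^c}\bigl(g_\delta^h(y)-u^{0,h}_{\delta,n_\delta}(x)\bigr)\gamma_{\delta,n_\delta}(x,y)\,dy\,dx.$$ **Theorem.** There is a constant $C>0$, independent of $\delta$ and $h$, such that for all sufficiently small $\delta$ (eventually along the family) $$\|u_{\delta,n_\delta}-u^h_{\delta,n_\delta}\|_{\delta,n_\delta}\le C\bigl(\delta^{(3+\mu)/2}+\delta^{-1}h^2+\delta^{-\lambda-1}h^\lambda\bigr),\qquad \|u_{\delta,n_\delta}-u^h_{\delta,n_\delta}\|_{L^2(\Omega)}\le C\bigl(\delta^{(3+\mu)/2}+\delta^{-1}h^2+\delta^{-\lambda-1}h^\lambda\bigr).$$ -/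

import Mathlib

open MeasureTheory Filter Topology Set

noncomputable section

namespace NonlocalCDG

/-- The Euclidean plane. -/
abbrev Plane := EuclideanSpace ℝ (Fin 2)

/-! ### Triangulations, polygonal domains, interaction domains -/

/-- The union of the closed triangles whose vertex sets are listed in `T`. -/
def meshDomain (T : Set (Finset Plane)) : Set Plane :=
  ⋃ t ∈ T, convexHull ℝ (t : Set Plane)

/-- `t` is the vertex set of a nondegenerate triangle. -/
def IsTriangle (t : Finset Plane) : Prop :=
  t.card = 3 ∧ AffineIndependent ℝ (fun p : t => (p : Plane))

/-- A finite conforming triangulation: two closed triangles meet in the hull of their common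
vertices (empty, a common vertex, a common edge, or the same triangle). -/
structure IsTriangulation (T : Set (Finset Plane)) : Prop where
  finite : T.Finite
  triangle : ∀ t ∈ T, IsTriangle t
  conforming : ∀ s ∈ T, ∀ t ∈ T,
    convexHull ℝ (s : Set Plane) ∩ convexHull ℝ (t : Set Plane)
      ⊆ convexHull ℝ ((s : Set Plane) ∩ (t : Set Plane))

/-- Quasi-uniformity with respect to the mesh size `h`: every triangle has diameter at most `h`
and contains a disc of radius `ρ * h`. -/
def IsQuasiUniform (T : Set (Finset Plane)) (h ρ : ℝ) : Prop :=
  ∀ t ∈ T, Metric.diam (convexHull ℝ (t : Set Plane)) ≤ h ∧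
    ∃ c : Plane, Metric.closedBall c (ρ * h) ⊆ convexHull ℝ (t : Set Plane)

/-- A nonempty bounded open polygonal domain: the interior of a finite union of closed triangles. -/
def IsPolygonalDomain (Ω : Set Plane) : Prop :=
  Ω.Nonempty ∧ ∃ T : Set (Finset Plane), T.Finite ∧ (∀ t ∈ T, IsTriangle t) ∧
    Ω = interior (meshDomain T)

/-- The interaction domain `Ω_δ^c = {y ∉ Ω : dist(y, ∂Ω) < δ}`. -/
def collar (Ω : Set Plane) (δ : ℝ) : Set Plane :=
  {y | y ∉ Ω ∧ Metric.infDist y (frontier Ω) < δ}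

/-- The extended domain `Ω ∪ Ω_δ^c`. -/
def hatDomain (Ω : Set Plane) (δ : ℝ) : Set Plane := Ω ∪ collar Ω δ

/-! ### Function classes and the local problem -/

/-- `u ∈ C_b^n(D)` for an open set `D`. -/
def IsCb (n : ℕ) (D : Set Plane) (u : Plane → ℝ) : Prop :=
  ContDiffOn ℝ n u D ∧
    ∀ j ≤ n, ∃ M : ℝ, ∀ x ∈ D, ‖iteratedFDerivWithin ℝ j u D x‖ ≤ M

/-- `u₀ ∈ C_b^4(Ω)` solves `-Δ u₀ = f₀` in `Ω`, `u₀ = g₀` on `∂Ω`. -/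
structure IsLocalSolution (Ω : Set Plane) (f₀ g₀ u₀ : Plane → ℝ) : Prop where
  regular : IsCb 4 Ω u₀
  continuousOn_closure : ContinuousOn u₀ (closure Ω)
  equation : ∀ x ∈ Ω, -(Laplacian.laplacian u₀ x) = f₀ x
  boundary : ∀ x ∈ frontier Ω, u₀ x = g₀ x

/-! ### Kernels -/

/-- The conditions on the profile `γ` on `(0,1)` of the rescaled kernel `δ⁻⁴ γ(|y - x| / δ)` in the
plane: positivity, integrability, and the normalization `w₂ ∫₀¹ s³ γ(s) ds = 2` with `w₂ = 2π`. -/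
structure IsKernelProfile (γ : ℝ → ℝ) : Prop where
  measurable : Measurable γ
  pos : ∀ s ∈ Ioo (0 : ℝ) 1, 0 < γ s
  integrable : IntegrableOn γ (Ioo (0 : ℝ) 1)
  normalized : 2 * Real.pi * (∫ s in (0 : ℝ)..1, s ^ 3 * γ s) = 2

/-- `Φ(t) = π ∫₀ᵗ ρ³ γ(ρ) dρ`. -/
def Phi (γ : ℝ → ℝ) (t : ℝ) : ℝ := Real.pi * ∫ ρ in (0 : ℝ)..t, ρ ^ 3 * γ ρ

/-- `λ = 2` if `Φ'(1) ≠ 0`, and `λ = 4` if `Φ'(1) = 0` and `Φ''(1) ≠ 0`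
(derivatives at `1` from the left, as `γ` lives on `(0,1)`). -/
def IsRateExponent (γ : ℝ → ℝ) (lam : ℕ) : Prop :=
  (lam = 2 ∧ ∃ a : ℝ, a ≠ 0 ∧ HasDerivWithinAt (Phi γ) a (Iic 1) 1) ∨
  (lam = 4 ∧ ∃ Φ' : ℝ → ℝ,
    (∀ᶠ t in 𝓝[≤] (1 : ℝ), HasDerivWithinAt (Phi γ) (Φ' t) (Iic 1) t) ∧
    Φ' 1 = 0 ∧ ∃ b : ℝ, b ≠ 0 ∧ HasDerivWithinAt Φ' b (Iic 1) 1)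

open scoped Classical in
/-- The radial kernel `γ_δ(x, y)`, equal to `δ⁻⁴ γ(|y - x| / δ)` in the disc and `0` outside. -/
def ballKernel (γ : ℝ → ℝ) (δ : ℝ) (x y : Plane) : ℝ :=
  if dist y x < δ then γ (dist y x / δ) / δ ^ 4 else 0

/-! ### Inscribed polygons -/

/-- The angular data of an inscribed polygon: `n ≥ 3` vertices on a circle, at increasing angles
within one full turn. -/
structure InscribedPolygon where
  n : ℕ
  three_le : 3 ≤ n
  angle : Fin n → ℝ
  strictMono : StrictMono angle
  lt_two_pi : ∀ j k, angle j - angle k < 2 * Real.pi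

namespace InscribedPolygon

variable (P : InscribedPolygon)

/-- The `k`-th vertex, on the circle of centre `x` and radius `δ`. -/
def vertex (x : Plane) (δ : ℝ) (k : Fin P.n) : Plane :=
  x + δ • !₂[Real.cos (P.angle k), Real.sin (P.angle k)]

/-- The polygon inscribed in the circle of centre `x` and radius `δ`. -/
def region (x : Plane) (δ : ℝ) : Set Plane := convexHull ℝ (range (P.vertex x δ))

/-- The length of the longest side (consecutive vertices in cyclic order). -/
def longestSide (x : Plane) (δ : ℝ) : ℝ :=
  ⨆ k : Fin P.n, dist (P.vertex x δ k) (P.vertex x δ (finRotate P.n k))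

/-- The radius of the largest disc centred at `x` contained in the polygon. -/
def inradius (x : Plane) (δ : ℝ) : ℝ := sSup {r : ℝ | Metric.ball x r ⊆ P.region x δ}

end InscribedPolygon

/-- The maximal number of sides `n_δ` of the polygons `P x`, `x ∈ D`. -/
def maxSides (D : Set Plane) (P : Plane → InscribedPolygon) : ℕ := sSup ((fun x => (P x).n) '' D)

/-- The minimal number of sides `n_{δ,inf}` of the polygons `P x`, `x ∈ D`. -/
def minSides (D : Set Plane) (P : Plane → InscribedPolygon) : ℕ := sInf ((fun x => (P x).n) '' D)

/-- Weak quasi-uniformity of the families `{B_{δ,n^x}}`, `x ∈ Ω ∪ Ω_δ^c`, uniformly in the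
parameter `i`, with comparable numbers of sides `n_δ ≤ C₃ n_{δ,inf}`. -/
def IsWeaklyQuasiUniform {ι : Type*} (Ω : Set Plane) (δ : ι → ℝ)
    (P : ι → Plane → InscribedPolygon) : Prop :=
  ∃ C₁ C₂ C₃ : ℝ, 0 < C₁ ∧ 0 < C₂ ∧ 0 < C₃ ∧ ∀ i,
    (∀ x ∈ hatDomain Ω (δ i),
      (P i x).longestSide x (δ i) / (2 * Real.sin (Real.pi / (P i x).n)) ≤ C₁ * δ i) ∧
    (∀ x ∈ hatDomain Ω (δ i), C₂ * δ i ≤ (P i x).inradius x (δ i)) ∧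
    BddAbove ((fun x => (P i x).n) '' hatDomain Ω (δ i)) ∧
    (maxSides (hatDomain Ω (δ i)) (P i) : ℝ) ≤ C₃ * minSides (hatDomain Ω (δ i)) (P i)

/-! ### The nonlocal problem with polygonal neighborhoods -/

/-- The set `B'_{δ,n^x} = {y ∈ B_δ(x) : x ∈ B_{δ,n^y}}`. -/
def dualRegion (δ : ℝ) (P : Plane → InscribedPolygon) (x : Plane) : Set Plane :=
  {y | y ∈ Metric.ball x δ ∧ x ∈ (P y).region y δ}

/-- The symmetrized kernel `γ_{δ,n_δ}(x,y) = ½ γ_δ(x,y) (χ_{B_{δ,n^x}}(y) + χ_{B'_{δ,n^x}}(y))`. -/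
def polyKernel (γ : ℝ → ℝ) (δ : ℝ) (P : Plane → InscribedPolygon) (x y : Plane) : ℝ :=
  1 / 2 * ballKernel γ δ x y *
    (((P x).region x δ).indicator 1 y + (dualRegion δ P x).indicator 1 y)

/-- The nonlocal operator `2 ∫ (u(y) - u(x)) k(x,y) dy`. -/
def nonlocalOp (k : Plane → Plane → ℝ) (u : Plane → ℝ) (x : Plane) : ℝ :=
  2 * ∫ y, (u y - u x) * k x y

/-- The nonlocal energy inner product on `D`. -/
def energyInner (D : Set Plane) (k : Plane → Plane → ℝ) (u v : Plane → ℝ) : ℝ :=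
  ∫ x in D, ∫ y in D, (u y - u x) * (v y - v x) * k x y

/-- The nonlocal energy norm on `D`. -/
def energyNorm (D : Set Plane) (k : Plane → Plane → ℝ) (u : Plane → ℝ) : ℝ :=
  Real.sqrt (energyInner D k u u)

/-- `u ∈ L²(Ω ∪ Ω_δ^c)` solves `-𝓛 u = f` on `Ω`, `u = g` on `Ω_δ^c`, where `𝓛` is the nonlocal
operator with kernel `k`. -/
structure IsNonlocalSolution (Ω : Set Plane) (δ : ℝ) (k : Plane → Plane → ℝ)
    (f g u : Plane → ℝ) : Prop where
  memLp : MemLp u 2 (volume.restrict (hatDomain Ω δ))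
  equation : ∀ᵐ x ∂(volume.restrict Ω), -(nonlocalOp k u x) = f x
  constraint : ∀ᵐ x ∂(volume.restrict (collar Ω δ)), u x = g x

/-- The first moment `σ^{j,1}(x) = ∫_D (y_j - x_j) k(x,y) dy`. -/
def firstMoment (D : Set Plane) (k : Plane → Plane → ℝ) (j : Fin 2) (x : Plane) : ℝ :=
  ∫ y in D, (y j - x j) * k x y

/-! ### The linear conforming discontinuous Galerkin method -/

/-- Continuous piecewise linear functions on the mesh `T` (the triangles are closed, so a function
that is affine on each of them is continuous on their union). -/
def IsP1 (T : Set (Finset Plane)) (v : Plane → ℝ) : Prop :=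
  ∀ t ∈ T, ∃ A : Plane →ᵃ[ℝ] ℝ, EqOn v A (convexHull ℝ (t : Set Plane))

/-- The functions that are continuous piecewise linear on the mesh `T` inside `D` and vanish
outside `D`. With `D = Ω` this is `V_δ^{0,h}`, with `D = Ω_δ^c` it is `V_δ^{c,h}`. -/
def cdgSpace (D : Set Plane) (T : Set (Finset Plane)) : Set (Plane → ℝ) :=
  {w | ∃ v, IsP1 T v ∧ w = D.indicator v}

/-- A triangulation of `Ω ∪ Ω_δ^c` with mesh size `h`: `T` triangulates the closure of `Ω`, and the
triangles of `Tc` lie outside `Ω`, cover `Ω_δ^c` and meet it. The two parts need not match across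
`∂Ω`. The rounded part of the outer boundary is covered by triangles that reach beyond it. -/
structure IsCdgMesh (Ω : Set Plane) (δ h ρ : ℝ) (T Tc : Set (Finset Plane)) : Prop where
  inner : IsTriangulation T
  inner_domain : meshDomain T = closure Ω
  inner_quasiUniform : IsQuasiUniform T h ρ
  outer : IsTriangulation Tc
  outer_cover : collar Ω δ ⊆ meshDomain Tc
  outer_disjoint : Disjoint (meshDomain Tc) Ω
  outer_meets : ∀ t ∈ Tc, (convexHull ℝ (t : Set Plane) ∩ closure (collar Ω δ)).Nonempty
  outer_quasiUniform : IsQuasiUniform Tc h ρ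

/-- `gh ∈ V_δ^{c,h}` approximates `g` on `Ω_δ^c` in the maximum norm as well as any element of
`V_δ^{c,h}` does, up to the factor `K` and an error `K h²`. -/
def IsBoundaryApprox (Ω : Set Plane) (δ h K : ℝ) (Tc : Set (Finset Plane))
    (g gh : Plane → ℝ) : Prop :=
  gh ∈ cdgSpace (collar Ω δ) Tc ∧
    ∀ v ∈ cdgSpace (collar Ω δ) Tc, ∀ M : ℝ, (∀ y ∈ collar Ω δ, |g y - v y| ≤ M) →
      ∀ y ∈ collar Ω δ, |g y - gh y| ≤ K * (M + h ^ 2)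

/-- `uh = u0h + gh` is the linear CDG approximation: `u0h ∈ V_δ^{0,h}` satisfies the discrete
variational equation for every test function in `V_δ^{0,h}`. -/
def IsCdgSolution (Ω : Set Plane) (δ : ℝ) (k : Plane → Plane → ℝ) (T : Set (Finset Plane))
    (f gh uh : Plane → ℝ) : Prop :=
  ∃ u0h ∈ cdgSpace Ω T, uh = u0h + gh ∧
    ∀ w ∈ cdgSpace Ω T,
      -2 * (∫ x in Ω, w x * ∫ y in Ω, (u0h y - u0h x) * k x y) =
        (∫ x in Ω, f x * w x) +
          2 * ∫ x in Ω, w x * ∫ y in collar Ω δ, (gh y - u0h x) * k x y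

end NonlocalCDG

end

/-! Write E for the energy form on Ω ∪ Ω_δ^c, U for the smooth extension, u and uh for the nonlocal
and the CDG solution. By nonlocal integration by parts both satisfy E(·, w) = ∫_Ω f w for every
discrete w vanishing outside Ω. Hence u - uh is E-orthogonal to such w, and Céa's lemma
(`energy_error_le`) gives E(u - uh) ≤ E(u - v - gh) for all v in V_δ^{0,h}. With v the interpolant
of U, the right side splits into the modelling error u - U and the approximation error U - v - gh.

Modelling error. A Poincaré inequality whose constant does not depend on δ (`poincare`) yields the
stability estimate `energy_le_of_residual`: the energy is controlled by the residual in Ω and the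
energy of the collar part. The residual is the data error O(δ²) plus the consistency error of the
operator on U. For the full radial kernel the latter is O(δ²), by averaging over quarter turns
(`radial_consistency`). The polygons contain the concentric discs of radius tδ with 1 - t = c / n_δ²
(`ball_subset_region`), so the polygonal kernel differs from the radial one only in a thin ring, at
a cost O((Φ(1) - Φ(t)) / δ). Since Φ(1) - Φ(t) = O((1 - t)^{λ/2}) and n_δ ∼ δ/h, this is O(h^λ /
δ^{λ+1}).

Approximation error. The kernel has mass O(δ⁻²), so E(w) is at most a multiple of δ⁻² ‖w‖² in L². In
Ω the interpolation error h² becomes h²/δ in the energy norm. The collar has area O(δ)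
(`exists_volume_collar_le`), so an error δ^{2+μ} + h² there contributes δ^{3+2μ} + h⁴/δ to the
squared energy. As μ ≤ 1 and δ ≤ 1, both δ⁴ and δ^{3+2μ} are at most δ^{3+μ}.

The L²(Ω) bound follows from the Poincaré inequality for the part of u - uh in Ω, the collar part
being the explicit difference of the boundary data. -/

noncomputable section
namespace NonlocalCDG

/-! ### Symmetric nonlocal energy forms -/

section EnergyForm

variable {X : Type*} [MeasurableSpace X]

/-- A nonnegative symmetric measurable kernel whose mass at every point is at most `A`. -/
structure IsEnergyKernel (ν : Measure X) (k : X → X → ℝ) (A : ℝ) : Prop where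
  measurable : Measurable (fun p : X × X => k p.1 p.2)
  nonneg : ∀ x y, 0 ≤ k x y
  symm : ∀ x y, k x y = k y x
  bound_nonneg : 0 ≤ A
  mass_le : ∀ x, ∫⁻ y, ENNReal.ofReal (k x y) ∂ν ≤ ENNReal.ofReal A

variable {ν : Measure X} [SFinite ν] {k : X → X → ℝ} {A : ℝ}

/-- The energy form as an integral over the product space. -/
def energy (ν : Measure X) (k : X → X → ℝ) (u v : X → ℝ) : ℝ :=
  ∫ p, (u p.2 - u p.1) * (v p.2 - v p.1) * k p.1 p.2 ∂(ν.prod ν)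

namespace IsEnergyKernel

lemma lintegral_sq_mul_le (hk : IsEnergyKernel ν k A) {u : X → ℝ} (hu : MemLp u 2 ν) :
    ∫⁻ p, ENNReal.ofReal (u p.1 ^ 2 * k p.1 p.2) ∂(ν.prod ν)
      ≤ ENNReal.ofReal (A * ∫ x, u x ^ 2 ∂ν) := by
  have hm : AEMeasurable (fun p : X × X => ENNReal.ofReal (u p.1 ^ 2 * k p.1 p.2)) (ν.prod ν) :=
    (((hu.1.aemeasurable.comp_quasiMeasurePreserving
      Measure.quasiMeasurePreserving_fst).pow_const 2).mul hk.measurable.aemeasurable).ennreal_ofReal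
  rw [lintegral_prod _ hm]
  calc ∫⁻ x, ∫⁻ y, ENNReal.ofReal (u x ^ 2 * k x y) ∂ν ∂ν
      = ∫⁻ x, ENNReal.ofReal (u x ^ 2) * ∫⁻ y, ENNReal.ofReal (k x y) ∂ν ∂ν := by
        refine lintegral_congr fun x => ?_
        rw [← lintegral_const_mul _ (hk.measurable.of_uncurry_left (x := x)).ennreal_ofReal]
        exact lintegral_congr fun y => ENNReal.ofReal_mul (sq_nonneg _)
    _ ≤ ∫⁻ x, ENNReal.ofReal (u x ^ 2) * ENNReal.ofReal A ∂ν :=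
        lintegral_mono fun x => mul_le_mul_right (hk.mass_le x) _
    _ = ENNReal.ofReal (A * ∫ x, u x ^ 2 ∂ν) := by
        rw [lintegral_mul_const' _ _ ENNReal.ofReal_ne_top,
          ← ofReal_integral_eq_lintegral_ofReal hu.integrable_sq (ae_of_all _ fun x => sq_nonneg _),
          ← ENNReal.ofReal_mul (integral_nonneg fun x => sq_nonneg _), mul_comm]

lemma integrable_sq_fst (hk : IsEnergyKernel ν k A) {u : X → ℝ} (hu : MemLp u 2 ν) :
    Integrable (fun p : X × X => u p.1 ^ 2 * k p.1 p.2) (ν.prod ν) := by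
  refine ⟨(((hu.1.comp_quasiMeasurePreserving Measure.quasiMeasurePreserving_fst).pow 2).mul
    hk.measurable.aestronglyMeasurable), ?_⟩
  rw [hasFiniteIntegral_iff_ofReal
    (ae_of_all _ fun p => mul_nonneg (sq_nonneg _) (hk.nonneg _ _))]
  exact (hk.lintegral_sq_mul_le hu).trans_lt ENNReal.ofReal_lt_top

lemma integral_sq_fst_le (hk : IsEnergyKernel ν k A) {u : X → ℝ} (hu : MemLp u 2 ν) :
    ∫ p, u p.1 ^ 2 * k p.1 p.2 ∂(ν.prod ν) ≤ A * ∫ x, u x ^ 2 ∂ν := by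
  rw [integral_eq_lintegral_of_nonneg_ae
    (ae_of_all _ fun p => mul_nonneg (sq_nonneg _) (hk.nonneg _ _))
    (hk.integrable_sq_fst hu).1]
  exact ENNReal.toReal_le_of_le_ofReal
    (mul_nonneg hk.bound_nonneg (integral_nonneg fun x => sq_nonneg _)) (hk.lintegral_sq_mul_le hu)

lemma integrable_sq_snd (hk : IsEnergyKernel ν k A) {u : X → ℝ} (hu : MemLp u 2 ν) :
    Integrable (fun p : X × X => u p.2 ^ 2 * k p.1 p.2) (ν.prod ν) := by
  have := (hk.integrable_sq_fst hu).swap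
  refine this.congr (ae_of_all _ fun p => ?_)
  simp [hk.symm p.2 p.1]

lemma integral_sq_snd (hk : IsEnergyKernel ν k A) (u : X → ℝ) :
    ∫ p, u p.2 ^ 2 * k p.1 p.2 ∂(ν.prod ν) = ∫ p, u p.1 ^ 2 * k p.1 p.2 ∂(ν.prod ν) := by
  rw [← integral_prod_swap]
  refine integral_congr_ae (ae_of_all _ fun p => ?_)
  simp [hk.symm p.2 p.1]

/-- Domination by |ab| ≤ a² + b² with the nonnegative weight `k`. -/
lemma integrable_mul {a b : X × X → ℝ} (hk : IsEnergyKernel ν k A)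
    (ham : AEStronglyMeasurable a (ν.prod ν)) (hbm : AEStronglyMeasurable b (ν.prod ν))
    (ha : Integrable (fun p : X × X => a p ^ 2 * k p.1 p.2) (ν.prod ν))
    (hb : Integrable (fun p : X × X => b p ^ 2 * k p.1 p.2) (ν.prod ν)) :
    Integrable (fun p : X × X => a p * b p * k p.1 p.2) (ν.prod ν) := by
  refine (ha.add hb).mono' ((ham.mul hbm).mul hk.measurable.aestronglyMeasurable)
    (ae_of_all _ fun p => ?_)
  have h := hk.nonneg p.1 p.2
  rw [Real.norm_eq_abs, abs_mul, abs_of_nonneg h, Pi.add_apply, ← add_mul]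
  refine mul_le_mul_of_nonneg_right ?_ h
  rw [abs_le]
  constructor <;> nlinarith [sq_nonneg (a p + b p), sq_nonneg (a p - b p), sq_nonneg (a p),
    sq_nonneg (b p)]

section
variable (hk : IsEnergyKernel ν k A) {u v : X → ℝ} (hu : MemLp u 2 ν) (hv : MemLp v 2 ν)
include hk hu hv

lemma integrable_fst_mul_diff :
    Integrable (fun p : X × X => v p.1 * (u p.2 - u p.1) * k p.1 p.2) (ν.prod ν) := by
  have mu1 := hu.1.comp_quasiMeasurePreserving (Measure.quasiMeasurePreserving_fst (ν := ν))
  have mu2 := hu.1.comp_quasiMeasurePreserving (Measure.quasiMeasurePreserving_snd (μ := ν))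
  have mv1 := hv.1.comp_quasiMeasurePreserving (Measure.quasiMeasurePreserving_fst (ν := ν))
  have h1 := hk.integrable_mul mv1 mu2 (hk.integrable_sq_fst hv) (hk.integrable_sq_snd hu)
  have h2 := hk.integrable_mul mv1 mu1 (hk.integrable_sq_fst hv) (hk.integrable_sq_fst hu)
  refine (h1.sub h2).congr (ae_of_all _ fun p => ?_)
  simp only [Pi.sub_apply, Function.comp]; ring

lemma integrable_snd_mul_diff :
    Integrable (fun p : X × X => v p.2 * (u p.2 - u p.1) * k p.1 p.2) (ν.prod ν) := by
  refine (hk.integrable_fst_mul_diff hu hv).swap.neg.congr (ae_of_all _ fun p => ?_)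
  simp only [Pi.neg_apply, Function.comp, Prod.fst_swap, Prod.snd_swap, hk.symm p.2 p.1]; ring

lemma integrable_energy :
    Integrable (fun p : X × X => (u p.2 - u p.1) * (v p.2 - v p.1) * k p.1 p.2) (ν.prod ν) := by
  refine ((hk.integrable_snd_mul_diff hu hv).sub (hk.integrable_fst_mul_diff hu hv)).congr
    (ae_of_all _ fun p => ?_)
  simp only [Pi.sub_apply]; ring

lemma energy_eq_iterated :
    energy ν k u v = ∫ x, ∫ y, (u y - u x) * (v y - v x) * k x y ∂ν ∂ν :=
  integral_prod _ (hk.integrable_energy hu hv)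

/-- Nonlocal integration by parts. -/
lemma energy_eq_neg_two_mul :
    energy ν k u v = -2 * ∫ x, v x * ∫ y, (u y - u x) * k x y ∂ν ∂ν := by
  have h1 : ∫ p, v p.2 * (u p.2 - u p.1) * k p.1 p.2 ∂(ν.prod ν)
      = -∫ p, v p.1 * (u p.2 - u p.1) * k p.1 p.2 ∂(ν.prod ν) := by
    rw [← integral_prod_swap, ← integral_neg]
    refine integral_congr_ae (ae_of_all _ fun p => ?_)
    simp only [Prod.fst_swap, Prod.snd_swap, hk.symm p.2 p.1]; ring
  have h2 : energy ν k u v = ∫ p, v p.2 * (u p.2 - u p.1) * k p.1 p.2 ∂(ν.prod ν)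
      - ∫ p, v p.1 * (u p.2 - u p.1) * k p.1 p.2 ∂(ν.prod ν) := by
    rw [← integral_sub (hk.integrable_snd_mul_diff hu hv) (hk.integrable_fst_mul_diff hu hv)]
    refine integral_congr_ae (ae_of_all _ fun p => ?_)
    simp only; ring
  rw [h2, h1, integral_prod _ (hk.integrable_fst_mul_diff hu hv)]
  have h3 : ∀ x, ∫ y, v x * (u y - u x) * k x y ∂ν = v x * ∫ y, (u y - u x) * k x y ∂ν := by
    intro x
    rw [← integral_const_mul]
    exact integral_congr_ae (ae_of_all _ fun y => by simp only; ring)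
  simp only [h3]; ring

lemma energy_add_le :
    energy ν k (u + v) (u + v) ≤ 2 * energy ν k u u + 2 * energy ν k v v := by
  unfold energy
  rw [← integral_const_mul, ← integral_const_mul,
    ← integral_add ((hk.integrable_energy hu hu).const_mul 2)
      ((hk.integrable_energy hv hv).const_mul 2)]
  refine integral_mono (hk.integrable_energy (hu.add hv) (hu.add hv))
    (((hk.integrable_energy hu hu).const_mul 2).add ((hk.integrable_energy hv hv).const_mul 2))
    fun p => ?_
  simp only [Pi.add_apply]
  nlinarith [mul_nonneg (sq_nonneg ((u p.2 - u p.1) - (v p.2 - v p.1))) (hk.nonneg p.1 p.2)]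

/-- Weighted Young inequality, applied to the integrand before integrating. It takes the place of
Cauchy–Schwarz for the form. -/
lemma energy_le_half_add {s : ℝ} (hs : 0 < s) :
    energy ν k u v ≤ s * energy ν k u u + 1 / (4 * s) * energy ν k v v := by
  unfold energy
  rw [← integral_const_mul, ← integral_const_mul,
    ← integral_add ((hk.integrable_energy hu hu).const_mul _)
      ((hk.integrable_energy hv hv).const_mul _)]
  refine integral_mono (hk.integrable_energy hu hv)
    (((hk.integrable_energy hu hu).const_mul _).add ((hk.integrable_energy hv hv).const_mul _))
    fun p => ?_
  simp only
  have h : (u p.2 - u p.1) * (v p.2 - v p.1)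
      ≤ s * (u p.2 - u p.1) ^ 2 + 1 / (4 * s) * (v p.2 - v p.1) ^ 2 := by
    have : s * (u p.2 - u p.1) ^ 2 + 1 / (4 * s) * (v p.2 - v p.1) ^ 2
      - (u p.2 - u p.1) * (v p.2 - v p.1)
      = 1 / (4 * s) * (2 * s * (u p.2 - u p.1) - (v p.2 - v p.1)) ^ 2 := by
      field_simp; ring
    have h2 : 0 ≤ 1 / (4 * s) * (2 * s * (u p.2 - u p.1) - (v p.2 - v p.1)) ^ 2 := by positivity
    linarith
  nlinarith [mul_le_mul_of_nonneg_right h (hk.nonneg p.1 p.2)]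

lemma energy_add_right {w : X → ℝ} (hw : MemLp w 2 ν) :
    energy ν k u (v + w) = energy ν k u v + energy ν k u w := by
  unfold energy
  rw [← integral_add (hk.integrable_energy hu hv) (hk.integrable_energy hu hw)]
  refine integral_congr_ae (ae_of_all _ fun p => ?_)
  simp only [Pi.add_apply]; ring

end

/-- From (a - b)² ≤ 2a² + 2b² and the symmetry of the kernel. With A of order δ⁻² this is the only
passage from L² bounds to the energy, and it is the source of the negative powers of δ in front of
h². -/
lemma energy_self_le (hk : IsEnergyKernel ν k A) {u : X → ℝ} (hu : MemLp u 2 ν) :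
    energy ν k u u ≤ 4 * A * ∫ x, u x ^ 2 ∂ν := by
  have h1 := hk.integrable_sq_fst hu
  have h2 := hk.integrable_sq_snd hu
  have : energy ν k u u ≤ ∫ p, (2 * (u p.1 ^ 2 * k p.1 p.2) + 2 * (u p.2 ^ 2 * k p.1 p.2))
      ∂(ν.prod ν) := by
    refine integral_mono (hk.integrable_energy hu hu) ((h1.const_mul 2).add (h2.const_mul 2))
      fun p => ?_
    simp only
    nlinarith [mul_nonneg (sq_nonneg (u p.2 + u p.1)) (hk.nonneg p.1 p.2)]
  rw [integral_add (h1.const_mul 2) (h2.const_mul 2), integral_const_mul, integral_const_mul,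
    hk.integral_sq_snd u] at this
  linarith [hk.integral_sq_fst_le hu]

lemma energy_self_nonneg (hk : IsEnergyKernel ν k A) (u : X → ℝ) : 0 ≤ energy ν k u u :=
  integral_nonneg fun _ => mul_nonneg (mul_self_nonneg _) (hk.nonneg _ _)

end IsEnergyKernel

lemma energy_congr_ae {u u' v v' : X → ℝ} (h : u =ᵐ[ν] u') (h' : v =ᵐ[ν] v') :
    energy ν k u v = energy ν k u' v' := by
  refine integral_congr_ae ?_
  filter_upwards [Measure.quasiMeasurePreserving_fst.ae_eq_comp h,
    Measure.quasiMeasurePreserving_snd.ae_eq_comp h,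
    Measure.quasiMeasurePreserving_fst.ae_eq_comp h',
    Measure.quasiMeasurePreserving_snd.ae_eq_comp h'] with p h1 h2 h3 h4
  simp only [Function.comp] at h1 h2 h3 h4
  rw [h1, h2, h3, h4]

end EnergyForm

/-! ### Radial kernels -/

/-- The profile, set to zero outside `(0,1)`. -/
def cutProfile (γ : ℝ → ℝ) : ℝ → ℝ := (Ioo (0 : ℝ) 1).indicator γ

/-- The radial kernel as a function of the difference `z = y - x`, with value `0` at `z = 0`. -/
def radialKernel (γ : ℝ → ℝ) (δ : ℝ) (z : Plane) : ℝ := cutProfile γ (‖z‖ / δ) / δ ^ 4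

/-- Dilation by δ contributes δ², polar coordinates contribute 2π s ds. -/
lemma integral_radial (F : ℝ → ℝ) {δ : ℝ} (hδ : 0 < δ) :
    ∫ z : Plane, F (‖z‖ / δ) = δ ^ 2 * (2 * Real.pi * ∫ s in Ioi (0 : ℝ), s * F s) := by
  have h1 : ∫ z : Plane, F (‖z‖ / δ) = ∫ z : Plane, (fun w : Plane => F ‖w‖) (δ⁻¹ • z) := by
    refine integral_congr_ae (ae_of_all _ fun z => ?_)
    simp only [norm_smul, norm_inv, Real.norm_eq_abs, abs_of_pos hδ]
    rw [div_eq_inv_mul]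
  rw [h1, Measure.integral_comp_inv_smul volume (fun w : Plane => F ‖w‖) δ,
    integral_fun_norm_addHaar]
  have : (volume : Measure Plane).real (Metric.ball 0 1) = Real.pi := by
    rw [Measure.real, EuclideanSpace.volume_ball_fin_two]
    simp [Real.pi_nonneg]
  rw [this]
  simp [abs_of_pos hδ]
  left; ring

lemma integrable_radial {F : ℝ → ℝ} {δ : ℝ} (hδ : 0 < δ)
    (hF : IntegrableOn (fun s => s * F s) (Ioi 0)) :
    Integrable (fun z : Plane => F (‖z‖ / δ)) := by
  have h : Integrable (fun z : Plane => F ‖z‖) := by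
    rw [integrable_fun_norm_addHaar volume (f := F)]
    simpa using hF
  have h1 := h.comp_smul (inv_ne_zero hδ.ne')
  refine h1.congr (ae_of_all _ fun z => ?_)
  simp only [norm_smul, norm_inv, Real.norm_eq_abs, abs_of_pos hδ]
  rw [div_eq_inv_mul]

section Profile

variable {γ : ℝ → ℝ}

lemma IsKernelProfile.cutProfile_nonneg (hγ : IsKernelProfile γ) (s : ℝ) : 0 ≤ cutProfile γ s :=
  indicator_nonneg (fun t ht => (hγ.pos t ht).le) s

lemma IsKernelProfile.measurable_cutProfile (hγ : IsKernelProfile γ) :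
    Measurable (cutProfile γ) :=
  hγ.measurable.indicator measurableSet_Ioo

lemma IsKernelProfile.integrable_cutProfile (hγ : IsKernelProfile γ) :
    Integrable (cutProfile γ) :=
  (integrable_indicator_iff measurableSet_Ioo).2 hγ.integrable

lemma IsKernelProfile.integrable_mul_cutProfile (hγ : IsKernelProfile γ) {p : ℝ → ℝ}
    (hp : Measurable p) (hp1 : ∀ s ∈ Ioo (0 : ℝ) 1, |p s| ≤ 1) :
    Integrable (fun s => p s * cutProfile γ s) := by
  refine hγ.integrable_cutProfile.mono' (hp.mul hγ.measurable_cutProfile).aestronglyMeasurable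
    (ae_of_all _ fun s => ?_)
  rw [Real.norm_eq_abs, abs_mul, abs_of_nonneg (hγ.cutProfile_nonneg s)]
  by_cases hs : s ∈ Ioo (0 : ℝ) 1
  · exact mul_le_of_le_one_left (hγ.cutProfile_nonneg s) (hp1 s hs)
  · simp [cutProfile, hs]

lemma IsKernelProfile.radialKernel_nonneg (hγ : IsKernelProfile γ) (δ : ℝ) (z : Plane) :
    0 ≤ radialKernel γ δ z :=
  div_nonneg (hγ.cutProfile_nonneg _) (by positivity)

lemma IsKernelProfile.measurable_radialKernel (hγ : IsKernelProfile γ) (δ : ℝ) :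
    Measurable (radialKernel γ δ) :=
  (hγ.measurable_cutProfile.comp (measurable_norm.div_const _)).div_const _

lemma radialKernel_eq_zero {δ : ℝ} (hδ : 0 < δ) {z : Plane} (hz : δ ≤ ‖z‖) :
    radialKernel γ δ z = 0 := by
  have : ‖z‖ / δ ∉ Ioo (0 : ℝ) 1 := fun h => by
    have := (div_lt_one hδ).1 h.2
    linarith
  simp [radialKernel, cutProfile, this]

/-- Weighted integrals of the radial kernel. -/
lemma IsKernelProfile.integral_weight_radialKernel (hγ : IsKernelProfile γ) {p : ℝ → ℝ}
    (hp : Measurable p) (hp1 : ∀ s ∈ Ioo (0 : ℝ) 1, |p s| ≤ 1) {δ : ℝ} (hδ : 0 < δ) :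
    Integrable (fun z : Plane => p (‖z‖ / δ) * radialKernel γ δ z) ∧
    ∫ z : Plane, p (‖z‖ / δ) * radialKernel γ δ z
      = (2 * Real.pi * ∫ s in Ioo (0 : ℝ) 1, s * (p s * γ s)) / δ ^ 2 := by
  have e : (fun z : Plane => p (‖z‖ / δ) * radialKernel γ δ z)
      = fun z => (fun s => p s * cutProfile γ s) (‖z‖ / δ) / δ ^ 4 := by
    funext z; simp only [radialKernel]; ring
  constructor
  · rw [e]
    refine (integrable_radial (F := fun s => p s * cutProfile γ s) hδ ?_).div_const _
    have := hγ.integrable_mul_cutProfile (p := fun s => s * p s) (measurable_id.mul hp) (by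
      intro s hs
      rw [abs_mul, abs_of_pos hs.1]
      exact mul_le_one₀ hs.2.le (abs_nonneg _) (hp1 s hs))
    refine (this.congr (ae_of_all _ fun s => ?_)).integrableOn
    simp only; ring
  · rw [e, integral_div, integral_radial (fun s => p s * cutProfile γ s) hδ]
    have h2 : ∫ s in Ioi (0 : ℝ), s * (p s * cutProfile γ s)
        = ∫ s in Ioo (0 : ℝ) 1, s * (p s * γ s) := by
      have : (fun s => s * (p s * cutProfile γ s))
          = (Ioo (0 : ℝ) 1).indicator (fun s => s * (p s * γ s)) := by
        funext s
        by_cases hs : s ∈ Ioo (0 : ℝ) 1 <;> simp [cutProfile, hs]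
      rw [this, setIntegral_indicator measurableSet_Ioo]
      congr 2
      ext s; simp only [mem_inter_iff, mem_Ioi, mem_Ioo]; tauto
    rw [h2]
    field_simp

lemma IsKernelProfile.integrable_radialKernel (hγ : IsKernelProfile γ) {δ : ℝ} (hδ : 0 < δ) :
    Integrable (radialKernel γ δ) := by
  simpa using (hγ.integral_weight_radialKernel (p := fun _ => 1) measurable_const
    (by simp) hδ).1

lemma IsKernelProfile.integral_radialKernel (hγ : IsKernelProfile γ) {δ : ℝ} (hδ : 0 < δ) :
    ∫ z, radialKernel γ δ z = (2 * Real.pi * ∫ s in Ioo (0 : ℝ) 1, s * γ s) / δ ^ 2 := by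
  simpa using (hγ.integral_weight_radialKernel (p := fun _ => 1) measurable_const
    (by simp) hδ).2

lemma IsKernelProfile.integrable_sq_mul_radialKernel (hγ : IsKernelProfile γ) {δ : ℝ}
    (hδ : 0 < δ) : Integrable (fun z => ‖z‖ ^ 2 * radialKernel γ δ z) := by
  have := (hγ.integral_weight_radialKernel (p := fun s => s ^ 2) (by fun_prop)
    (fun s hs => by
      rw [abs_of_nonneg (sq_nonneg s)]
      exact pow_le_one₀ hs.1.le hs.2.le) hδ).1
  refine (this.const_mul (δ ^ 2)).congr (ae_of_all _ fun z => ?_)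
  simp only; field_simp

/-- The factor δ⁻⁴ makes the planar second moment independent of δ. The value 2 is what makes the
limit operator exactly the Laplacian. -/
lemma IsKernelProfile.integral_sq_mul_radialKernel (hγ : IsKernelProfile γ) {δ : ℝ}
    (hδ : 0 < δ) : ∫ z, ‖z‖ ^ 2 * radialKernel γ δ z = 2 := by
  have := (hγ.integral_weight_radialKernel (p := fun s => s ^ 2) (by fun_prop)
    (fun s hs => by
      rw [abs_of_nonneg (sq_nonneg s)]
      exact pow_le_one₀ hs.1.le hs.2.le) hδ).2
  have e : ∀ z : Plane, ‖z‖ ^ 2 * radialKernel γ δ z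
      = δ ^ 2 * ((‖z‖ / δ) ^ 2 * radialKernel γ δ z) := by
    intro z; field_simp
  have h2 := hγ.normalized
  rw [intervalIntegral.integral_of_le zero_le_one, integral_Ioc_eq_integral_Ioo] at h2
  have e2 : ∀ s : ℝ, s * (s ^ 2 * γ s) = s ^ 3 * γ s := fun s => by ring
  simp only [e, integral_const_mul, this, e2]
  rw [h2]; field_simp

/-- The second moment over the half disc. -/
def halfMoment (γ : ℝ → ℝ) : ℝ := 2 * Real.pi * ∫ s in Ioo (0 : ℝ) (1 / 2), s ^ 3 * γ s

lemma IsKernelProfile.halfMoment_pos (hγ : IsKernelProfile γ) : 0 < halfMoment γ := by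
  refine mul_pos (by positivity) ?_
  have hint : IntegrableOn (fun s => s ^ 3 * γ s) (Ioo (0 : ℝ) (1 / 2)) := by
    have := hγ.integrable_mul_cutProfile (p := fun s => s ^ 3) (by fun_prop) (fun s hs => by
      rw [abs_of_nonneg (pow_nonneg hs.1.le 3)]
      exact pow_le_one₀ hs.1.le hs.2.le)
    refine this.integrableOn.congr_fun (fun s hs => ?_) measurableSet_Ioo
    have : s ∈ Ioo (0 : ℝ) 1 := ⟨hs.1, hs.2.trans (by norm_num)⟩
    simp [cutProfile, this]
  have hpos : ∀ s ∈ Ioo (0 : ℝ) (1 / 2), 0 < s ^ 3 * γ s := fun s hs =>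
    mul_pos (pow_pos hs.1 3) (hγ.pos s ⟨hs.1, hs.2.trans (by norm_num)⟩)
  rw [setIntegral_pos_iff_support_of_nonneg_ae ?_ hint]
  · have : Ioo (0 : ℝ) (1 / 2) ⊆ Function.support (fun s => s ^ 3 * γ s) ∩ Ioo (0 : ℝ) (1 / 2) :=
      fun s hs => ⟨(hpos s hs).ne', hs⟩
    refine lt_of_lt_of_le ?_ (measure_mono this)
    simp
  · exact (ae_restrict_iff' measurableSet_Ioo).2 (ae_of_all _ fun s hs => (hpos s hs).le)

/-- Scale invariance of the second moment again, now on the half disc. It is the reason why the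
Poincaré constant does not depend on δ. -/
lemma IsKernelProfile.lintegral_halfMoment (hγ : IsKernelProfile γ) {δ : ℝ} (hδ : 0 < δ) :
    ∫⁻ z in Metric.ball (0 : Plane) (δ / 2), ENNReal.ofReal (‖z‖ ^ 2 * radialKernel γ δ z)
      = ENNReal.ofReal (halfMoment γ) := by
  have hint := (hγ.integrable_sq_mul_radialKernel hδ)
  rw [← ofReal_integral_eq_lintegral_ofReal hint.integrableOn
    (ae_of_all _ fun z => mul_nonneg (sq_nonneg _) (hγ.radialKernel_nonneg δ z))]
  congr 1
  have := (hγ.integral_weight_radialKernel (p := (Iio (1 / 2 : ℝ)).indicator fun s => s ^ 2)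
    ((by fun_prop : Measurable fun s : ℝ => s ^ 2).indicator measurableSet_Iio)
    (fun s hs => by
      by_cases h : s ∈ Iio (1 / 2 : ℝ)
      · rw [indicator_of_mem h, abs_of_nonneg (sq_nonneg s)]
        exact pow_le_one₀ hs.1.le hs.2.le
      · rw [indicator_of_notMem h]; simp) hδ).2
  have e : ∀ z : Plane, (Metric.ball (0 : Plane) (δ / 2)).indicator
      (fun z => ‖z‖ ^ 2 * radialKernel γ δ z) z
      = δ ^ 2 * (((Iio (1 / 2 : ℝ)).indicator (fun s => s ^ 2) (‖z‖ / δ)) * radialKernel γ δ z) := by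
    intro z
    have hiff : z ∈ Metric.ball (0 : Plane) (δ / 2) ↔ ‖z‖ / δ ∈ Iio (1 / 2 : ℝ) := by
      rw [mem_ball_zero_iff, mem_Iio, div_lt_iff₀ hδ]
      constructor <;> intro h <;> linarith
    by_cases h : z ∈ Metric.ball (0 : Plane) (δ / 2)
    · rw [indicator_of_mem h, indicator_of_mem (hiff.1 h)]
      field_simp
    · rw [indicator_of_notMem h, indicator_of_notMem (fun h' => h (hiff.2 h'))]
      simp
  have e2 : (fun s : ℝ => s * ((Iio (1 / 2 : ℝ)).indicator (fun s => s ^ 2) s * γ s))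
      = (Iio (1 / 2 : ℝ)).indicator (fun s => s ^ 3 * γ s) := by
    funext s
    by_cases h : s ∈ Iio (1 / 2 : ℝ)
    · rw [indicator_of_mem h, indicator_of_mem h]; ring
    · rw [indicator_of_notMem h, indicator_of_notMem h]; ring
  rw [← integral_indicator Metric.isOpen_ball.measurableSet]
  simp only [e, integral_const_mul, this]
  rw [e2, setIntegral_indicator measurableSet_Iio]
  have e3 : Ioo (0 : ℝ) 1 ∩ Iio (1 / 2) = Ioo (0 : ℝ) (1 / 2) := by
    ext s; simp only [mem_inter_iff, mem_Ioo, mem_Iio]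
    constructor
    · rintro ⟨⟨a, b⟩, c⟩; exact ⟨a, c⟩
    · rintro ⟨a, b⟩; exact ⟨⟨a, by linarith⟩, b⟩
  rw [e3, halfMoment]
  field_simp

/-- The first absolute moment outside the disc of radius `t δ` is controlled by `Φ(1) - Φ(t)`. -/
lemma IsKernelProfile.ring_moment (hγ : IsKernelProfile γ) {δ t : ℝ} (hδ : 0 < δ)
    (ht : 1 / 2 ≤ t) (ht1 : t ≤ 1) :
    Integrable (fun z : Plane => {z : Plane | t * δ ≤ ‖z‖}.indicator
      (fun z => ‖z‖ * radialKernel γ δ z) z) ∧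
    ∫ z : Plane, {z : Plane | t * δ ≤ ‖z‖}.indicator (fun z => ‖z‖ * radialKernel γ δ z) z
      ≤ 4 / δ * (Phi γ 1 - Phi γ t) := by
  obtain ⟨hi, hI⟩ := hγ.integral_weight_radialKernel (p := (Ici t).indicator fun s => s)
    (measurable_id.indicator measurableSet_Ici)
    (fun s hs => by
      by_cases h : s ∈ Ici t
      · rw [indicator_of_mem h, abs_of_pos hs.1]; exact hs.2.le
      · rw [indicator_of_notMem h]; simp) hδ
  have e : (fun z : Plane => {z : Plane | t * δ ≤ ‖z‖}.indicator
      (fun z => ‖z‖ * radialKernel γ δ z) z)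
      = fun z => δ * (((Ici t).indicator (fun s => s) (‖z‖ / δ)) * radialKernel γ δ z) := by
    funext z
    have hiff : z ∈ {z : Plane | t * δ ≤ ‖z‖} ↔ ‖z‖ / δ ∈ Ici t := by
      rw [mem_ofPred_eq, mem_Ici, le_div_iff₀ hδ]
    by_cases h : z ∈ {z : Plane | t * δ ≤ ‖z‖}
    · rw [indicator_of_mem h, indicator_of_mem (hiff.1 h)]
      field_simp
    · rw [indicator_of_notMem h, indicator_of_notMem (fun h' => h (hiff.2 h'))]
      simp
  rw [e]
  refine ⟨hi.const_mul δ, ?_⟩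
  rw [integral_const_mul, hI]
  have hint3 : Integrable (fun s => s ^ 3 * cutProfile γ s) :=
    hγ.integrable_mul_cutProfile (p := fun s => s ^ 3) (by fun_prop) (fun s hs => by
      rw [abs_of_nonneg (pow_nonneg hs.1.le 3)]
      exact pow_le_one₀ hs.1.le hs.2.le)
  have hIoo : IntegrableOn (fun s => s ^ 3 * γ s) (Ioo (0 : ℝ) 1) := by
    refine hint3.integrableOn.congr_fun (fun s hs => ?_) measurableSet_Ioo
    simp [cutProfile, hs]
  have hIoc : IntegrableOn (fun s => s ^ 3 * γ s) (Ioc (0 : ℝ) 1) :=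
    (integrableOn_Ioc_iff_integrableOn_Ioo (by simp)).2 hIoo
  have hii : ∀ a b : ℝ, 0 ≤ a → a ≤ 1 → 0 ≤ b → b ≤ 1 →
      IntervalIntegrable (fun s => s ^ 3 * γ s) volume a b := by
    intro a b ha ha1 hb hb1
    rw [intervalIntegrable_iff]
    refine hIoc.mono_set (fun s hs => ?_)
    rw [uIoc, mem_Ioc] at hs
    exact ⟨(le_min ha hb).trans_lt hs.1, hs.2.trans (max_le ha1 hb1)⟩
  have ht0 : 0 ≤ t := by linarith
  have hPhi : Phi γ 1 - Phi γ t = Real.pi * ∫ s in Ioo t 1, s ^ 3 * γ s := by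
    rw [Phi, Phi, ← mul_sub, intervalIntegral.integral_interval_sub_left
      (hii 0 1 le_rfl zero_le_one zero_le_one le_rfl) (hii 0 t le_rfl zero_le_one ht0 ht1),
      intervalIntegral.integral_of_le ht1, integral_Ioc_eq_integral_Ioo]
  have e2 : (fun s : ℝ => s * ((Ici t).indicator (fun s => s) s * γ s))
      = (Ici t).indicator (fun s => s ^ 2 * γ s) := by
    funext s
    by_cases h : s ∈ Ici t
    · rw [indicator_of_mem h, indicator_of_mem h]; ring
    · rw [indicator_of_notMem h, indicator_of_notMem h]; ring
  have e3 : Ioo (0 : ℝ) 1 ∩ Ici t = Ico t 1 := by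
    ext s; simp only [mem_inter_iff, mem_Ioo, mem_Ici, mem_Ico]
    constructor
    · rintro ⟨⟨a, b⟩, c⟩; exact ⟨c, b⟩
    · rintro ⟨a, b⟩; exact ⟨⟨by linarith, b⟩, a⟩
  -- On (t, 1) one has s ≥ 1/2, hence s² ≤ 2s³, which turns the first moment into an increment of Φ.
  have hmono : ∫ s in Ioo t 1, s ^ 2 * γ s ≤ ∫ s in Ioo t 1, 2 * (s ^ 3 * γ s) := by
    have hsub : Ioo t 1 ⊆ Ioo (0 : ℝ) 1 := Ioo_subset_Ioo_left ht0
    refine setIntegral_mono_on ?_ ((hIoo.mono_set hsub).const_mul 2) measurableSet_Ioo ?_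
    · have : Integrable (fun s => s ^ 2 * cutProfile γ s) :=
        hγ.integrable_mul_cutProfile (p := fun s => s ^ 2) (by fun_prop) (fun s hs => by
          rw [abs_of_nonneg (pow_nonneg hs.1.le 2)]
          exact pow_le_one₀ hs.1.le hs.2.le)
      refine this.integrableOn.congr_fun (fun s hs => ?_) measurableSet_Ioo
      simp [cutProfile, hsub hs]
    · intro s hs
      have h1 : 0 ≤ s ^ 2 * γ s := mul_nonneg (sq_nonneg _) (hγ.pos s (hsub hs)).le
      have h2 : 1 / 2 ≤ s := ht.trans hs.1.le
      nlinarith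
  rw [integral_const_mul] at hmono
  rw [e2, setIntegral_indicator measurableSet_Ici, e3, integral_Ico_eq_integral_Ioo, hPhi]
  have hpi := Real.pi_pos
  calc δ * ((2 * Real.pi * ∫ s in Ioo t 1, s ^ 2 * γ s) / δ ^ 2)
      = 2 * Real.pi / δ * ∫ s in Ioo t 1, s ^ 2 * γ s := by field_simp
    _ ≤ 2 * Real.pi / δ * (2 * ∫ s in Ioo t 1, s ^ 3 * γ s) :=
        mul_le_mul_of_nonneg_left hmono (by positivity)
    _ = 4 / δ * (Real.pi * ∫ s in Ioo t 1, s ^ 3 * γ s) := by ring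

/-- Near `1`, the increment of `Φ` is of the order given by the rate exponent. -/
lemma IsRateExponent.exists_bound {lam : ℕ} (h : IsRateExponent γ lam) :
    ∃ C : ℝ, 0 ≤ C ∧ ∀ᶠ t in 𝓝[≤] (1 : ℝ), Phi γ 1 - Phi γ t ≤ C * (1 - t) ^ (lam / 2) := by
  rcases h with ⟨rfl, a, -, ha⟩ | ⟨rfl, Φ', hΦ', h1, b, -, hb⟩
  -- λ = 2: differentiability at 1 gives a bound linear in 1 - t, and λ/2 = 1.
  · obtain ⟨C, hC, hb⟩ := ha.differentiableWithinAt.isBigO_sub.exists_nonneg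
    refine ⟨C, hC, ?_⟩
    filter_upwards [hb.bound, self_mem_nhdsWithin] with t ht ht1
    rw [Real.norm_eq_abs, Real.norm_eq_abs, abs_of_nonpos (a := t - 1) (sub_nonpos.2 ht1)] at ht
    have := neg_abs_le (Phi γ t - Phi γ 1)
    norm_num
    linarith
  -- λ = 4: since Φ'(1) = 0 and Φ' is differentiable at 1, |Φ'(s)| ≤ C(1 - s) near 1. The mean value
  -- inequality on [t, 1] then produces (1 - t)².
  · obtain ⟨C, hC, hb⟩ := hb.differentiableWithinAt.isBigO_sub.exists_nonneg
    refine ⟨C, hC, ?_⟩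
    have hev := hΦ'.and hb.bound
    obtain ⟨l, hl, hsub⟩ := (mem_nhdsLE_iff_exists_Ioc_subset).1 hev
    filter_upwards [Ioc_mem_nhdsLE hl] with t ht
    have key := Convex.norm_image_sub_le_of_norm_hasDerivWithin_le (f := Phi γ) (f' := Φ')
      (s := Icc t 1) (C := C * (1 - t)) (x := t) (y := 1) (fun s hs =>
        (hsub ⟨ht.1.trans_le hs.1, hs.2⟩).1.mono Icc_subset_Iic_self) (fun s hs => by
        have := (hsub ⟨ht.1.trans_le hs.1, hs.2⟩).2
        rw [h1, sub_zero] at this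
        refine this.trans (mul_le_mul_of_nonneg_left ?_ hC)
        rw [Real.norm_eq_abs, abs_of_nonpos (sub_nonpos.2 hs.2)]
        linarith [hs.1]) (convex_Icc _ _) (left_mem_Icc.2 ht.2) (right_mem_Icc.2 ht.2)
    rw [Real.norm_eq_abs, Real.norm_eq_abs, abs_of_nonneg (sub_nonneg.2 ht.2)] at key
    calc Phi γ 1 - Phi γ t ≤ _ := le_abs_self _
      _ ≤ _ := key
      _ = C * (1 - t) ^ (4 / 2) := by norm_num; ring

end Profile

/-! ### Inscribed polygons contain large discs -/

/-- The linear functional `z ↦ a z₀ + b z₁`. -/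
def coordFun (a b : ℝ) : Plane →L[ℝ] ℝ :=
  a • EuclideanSpace.proj (0 : Fin 2) + b • EuclideanSpace.proj (1 : Fin 2)

lemma coordFun_apply (a b : ℝ) (z : Plane) : coordFun a b z = a * z 0 + b * z 1 := by
  simp [coordFun]

lemma coordFun_circle (ψ θ δ : ℝ) :
    coordFun (Real.cos ψ) (Real.sin ψ) (δ • !₂[Real.cos θ, Real.sin θ])
      = δ * Real.cos (θ - ψ) := by
  rw [coordFun_apply, Real.cos_sub]
  simp
  ring

lemma coordFun_le_norm (ψ : ℝ) (z : Plane) :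
    coordFun (Real.cos ψ) (Real.sin ψ) z ≤ ‖z‖ := by
  rw [coordFun_apply, EuclideanSpace.norm_eq, Fin.sum_univ_two]
  refine Real.le_sqrt_of_sq_le ?_
  simp only [Real.norm_eq_abs, sq_abs]
  nlinarith [sq_nonneg (Real.cos ψ * z 1 - Real.sin ψ * z 0), Real.sin_sq_add_cos_sq ψ]

/-- Polar form of the coefficient vector, read as a complex number: R is its modulus and ψ its
argument. -/
lemma exists_coordFun (f : Plane →L[ℝ] ℝ) :
    ∃ R ψ : ℝ, 0 ≤ R ∧ ∀ z, f z = R * coordFun (Real.cos ψ) (Real.sin ψ) z := by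
  set a := f (EuclideanSpace.single 0 1)
  set b := f (EuclideanSpace.single 1 1)
  have hf : ∀ z : Plane, f z = a * z 0 + b * z 1 := by
    intro z
    have hz : z = z 0 • EuclideanSpace.single (0 : Fin 2) (1 : ℝ)
        + z 1 • EuclideanSpace.single (1 : Fin 2) (1 : ℝ) := by
      ext i; fin_cases i <;> simp
    conv_lhs => rw [hz]
    rw [map_add, map_smul, map_smul]
    simp only [smul_eq_mul]; ring
  refine ⟨‖(⟨a, b⟩ : ℂ)‖, Complex.arg ⟨a, b⟩, norm_nonneg _, fun z => ?_⟩
  have h1 := Complex.norm_mul_cos_arg (⟨a, b⟩ : ℂ)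
  have h2 := Complex.norm_mul_sin_arg (⟨a, b⟩ : ℂ)
  simp only at h1 h2
  rw [hf, coordFun_apply]
  linear_combination (-z 0) * h1 - z 1 * h2

/-- Chord length in terms of the half angle. -/
lemma dist_circle (x : Plane) {δ : ℝ} (hδ : 0 ≤ δ) (a b : ℝ) :
    dist (x + δ • !₂[Real.cos a, Real.sin a]) (x + δ • !₂[Real.cos b, Real.sin b])
      = 2 * δ * |Real.sin ((b - a) / 2)| := by
  rw [dist_add_left, dist_eq_norm, ← smul_sub, norm_smul, Real.norm_eq_abs, abs_of_nonneg hδ,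
    EuclideanSpace.norm_eq, Fin.sum_univ_two]
  have : ‖(!₂[Real.cos a, Real.sin a] - !₂[Real.cos b, Real.sin b] : Plane) 0‖ ^ 2
      + ‖(!₂[Real.cos a, Real.sin a] - !₂[Real.cos b, Real.sin b] : Plane) 1‖ ^ 2
      = (2 * Real.sin ((b - a) / 2)) ^ 2 := by
    simp only [Real.norm_eq_abs, sq_abs]
    simp
    have h1 := Real.cos_sq' ((b - a) / 2)
    have h2 := Real.cos_sq ((b - a) / 2)
    rw [show 2 * ((b - a) / 2) = b - a by ring, Real.cos_sub] at h2
    nlinarith [Real.sin_sq_add_cos_sq a, Real.sin_sq_add_cos_sq b]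
  rw [this, Real.sqrt_sq_eq_abs, abs_mul]
  norm_num; ring

namespace InscribedPolygon

/-- Every direction has a consecutive pair of vertices around it. -/
lemma exists_gap (P : InscribedPolygon) (φ : ℝ) :
    ∃ (k : Fin P.n) (φ' next : ℝ), (∃ m : ℤ, φ' = φ + m * (2 * Real.pi)) ∧
      P.angle k ≤ φ' ∧ φ' < next ∧ next ≤ P.angle k + 2 * Real.pi ∧
      (∃ m : ℤ, next = P.angle (finRotate P.n k) + m * (2 * Real.pi)) ∧
      ∀ j, (next - 2 * Real.pi ≤ P.angle j ∧ P.angle j ≤ P.angle k) ∨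
        (next ≤ P.angle j ∧ P.angle j ≤ P.angle k + 2 * Real.pi) := by
  obtain ⟨n, h3, θ, hmono, hlt⟩ := P
  obtain ⟨m, rfl⟩ : ∃ m, n = m + 1 := ⟨n - 1, by omega⟩
  simp only
  have hpi := Real.two_pi_pos
  -- The direction is first moved into the full turn that starts at the first vertex.
  obtain ⟨φ', hφ', hm⟩ : ∃ φ', φ' ∈ Ico (θ 0) (θ 0 + 2 * Real.pi) ∧
      ∃ m : ℤ, φ' = φ + m * (2 * Real.pi) := by
    refine ⟨toIcoMod hpi (θ 0) φ, toIcoMod_mem_Ico hpi _ _, -toIcoDiv hpi (θ 0) φ, ?_⟩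
    rw [toIcoMod, zsmul_eq_mul]; push_cast; ring
  obtain ⟨k, hk, hkmax⟩ := Finset.exists_max_image (Finset.univ.filter fun k => θ k ≤ φ') id
    ⟨0, by simpa using hφ'.1⟩
  simp only [Finset.mem_filter, Finset.mem_univ, true_and, id] at hk hkmax
  -- If the last vertex before φ' is the last one of all, the next vertex is the first, one turn
  -- later.
  by_cases hlast : k = Fin.last m
  · refine ⟨k, φ', θ 0 + 2 * Real.pi, hm, hk, hφ'.2, ?_, ⟨1, ?_⟩, fun j => Or.inl ⟨?_, ?_⟩⟩
    · linarith [hmono.monotone (Fin.zero_le k)]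
    · rw [hlast, finRotate_last]; simp
    · linarith [hmono.monotone (Fin.zero_le j)]
    · rw [hlast]; exact hmono.monotone (Fin.le_last j)
  · have hkm : (k : ℕ) < m := lt_of_le_of_ne (Nat.lt_succ_iff.1 k.2)
      (fun h => hlast (Fin.ext h))
    have hj : finRotate (m + 1) k = ⟨k + 1, Nat.succ_lt_succ hkm⟩ :=
      finRotate_of_lt hkm
    set k' : Fin (m + 1) := ⟨k + 1, Nat.succ_lt_succ hkm⟩
    have hkk' : k < k' := by simp [k', Fin.lt_def]
    refine ⟨k, φ', θ k', hm, hk, ?_, by linarith [hlt k' k], ⟨0, by rw [hj]; simp⟩, fun j => ?_⟩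
    · by_contra hcon
      exact absurd (hkmax k' (not_lt.1 hcon)) (not_le.2 hkk')
    · rcases le_or_gt j k with h | h
      · exact Or.inl ⟨by linarith [hlt k' j], hmono.monotone h⟩
      · exact Or.inr ⟨hmono.monotone (by simp only [k', Fin.le_def, Fin.lt_def] at *; omega),
          by linarith [hlt j k]⟩

/-- An inscribed polygon with short sides that contains its centre contains a large disc. -/
lemma ball_subset_region (P : InscribedPolygon) {x : Plane} {δ s : ℝ} (hδ : 0 < δ)
    (hs : P.longestSide x δ ≤ 2 * δ * s) (hx : x ∈ P.region x δ) :
    Metric.ball x (δ * (1 - s ^ 2)) ⊆ P.region x δ := by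
  intro y hy
  by_contra hyr
  have hcl : IsClosed (P.region x δ) := (finite_range _).isClosed_convexHull ℝ
  -- A line strictly separates `y` from the polygon. In the normal direction φ all vertices then lie
  -- strictly below height δ(1 - s²), measured from the centre.
  obtain ⟨f, c, hfc, hcy⟩ := geometric_hahn_banach_closed_point (convex_convexHull ℝ _) hcl hyr
  obtain ⟨R, φ, hR, hf⟩ := exists_coordFun f
  have hv : ∀ k, Real.cos (P.angle k - φ) < 1 - s ^ 2 := by
    intro k
    have h1 : f (P.vertex x δ k) < f y := (hfc _ (subset_convexHull ℝ _ (mem_range_self k))).trans hcy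
    have h2 : R * (δ * Real.cos (P.angle k - φ)) < R * (δ * (1 - s ^ 2)) := by
      rw [← coordFun_circle φ (P.angle k) δ, ← hf]
      rw [vertex, map_add] at h1
      have h3 : f (y - x) ≤ R * (δ * (1 - s ^ 2)) := by
        rw [hf]
        refine mul_le_mul_of_nonneg_left ((coordFun_le_norm _ _).trans ?_) hR
        rw [← dist_eq_norm]; exact (Metric.mem_ball.1 hy).le
      rw [map_sub] at h3
      linarith
    exact lt_of_mul_lt_mul_left (lt_of_mul_lt_mul_left h2 hR) hδ.le
  obtain ⟨k, φ', next, ⟨m, hm⟩, hk1, hk2, hk3, ⟨m', hm'⟩, hgap⟩ := P.exists_gap φ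
  set g := next - P.angle k with hg
  have hg0 : 0 < g := by linarith
  have hg1 : g ≤ 2 * Real.pi := by linarith
  have hperiod : ∀ (a : ℝ) (m : ℤ), Real.cos (a + m * (2 * Real.pi)) = Real.cos a :=
    fun a m => Real.cos_add_int_mul_two_pi a m
  -- the polygon lies in a half plane
  have hcos0 : 0 ≤ Real.cos (g / 2) := by
    set ψ := P.angle k + g / 2
    have hsub : P.region x δ ⊆ {z | coordFun (Real.cos ψ) (Real.sin ψ) z
        ≤ coordFun (Real.cos ψ) (Real.sin ψ) x + δ * Real.cos (g / 2)} := by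
      refine convexHull_min ?_
        (convex_halfSpace_le (coordFun (Real.cos ψ) (Real.sin ψ)).isLinear _)
      rintro _ ⟨j, rfl⟩
      rw [mem_ofPred_eq, vertex, map_add, coordFun_circle]
      have : Real.cos (P.angle j - ψ) ≤ Real.cos (g / 2) := by
        rcases hgap j with ⟨h1, h2⟩ | ⟨h1, h2⟩
        · rw [← Real.cos_neg (P.angle j - ψ)]
          rcases le_or_gt (-(P.angle j - ψ)) Real.pi with h | h
          · exact Real.cos_le_cos_of_nonneg_of_le_pi (by linarith) h (by simp only [ψ]; linarith)
          · rw [← Real.cos_two_pi_sub]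
            exact Real.cos_le_cos_of_nonneg_of_le_pi (by linarith) (by linarith)
              (by simp only [ψ]; linarith)
        · rcases le_or_gt (P.angle j - ψ) Real.pi with h | h
          · exact Real.cos_le_cos_of_nonneg_of_le_pi (by linarith) h (by simp only [ψ]; linarith)
          · rw [← Real.cos_two_pi_sub]
            exact Real.cos_le_cos_of_nonneg_of_le_pi (by linarith) (by linarith)
              (by simp only [ψ]; linarith)
      have := mul_le_mul_of_nonneg_left this hδ.le
      linarith
    have := hsub hx
    rw [mem_ofPred_eq] at this
    exact nonneg_of_mul_nonneg_right (by linarith) hδ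
  have hsin : Real.sin (g / 2) ≤ s := by
    have h1 : dist (P.vertex x δ k) (P.vertex x δ (finRotate P.n k)) ≤ P.longestSide x δ :=
      le_ciSup (f := fun k => dist (P.vertex x δ k) (P.vertex x δ (finRotate P.n k)))
        (finite_range _).bddAbove k
    have hvert : P.vertex x δ (finRotate P.n k)
        = x + δ • !₂[Real.cos next, Real.sin next] := by
      rw [hm', Real.cos_add_int_mul_two_pi, Real.sin_add_int_mul_two_pi, vertex]
    rw [hvert, vertex, dist_circle x hδ.le] at h1
    have h2 := le_abs_self (Real.sin (g / 2))
    have h3 : 2 * δ * Real.sin (g / 2) ≤ 2 * δ * s := by nlinarith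
    exact le_of_mul_le_mul_left h3 (by positivity)
  have hsin0 : 0 ≤ Real.sin (g / 2) := Real.sin_nonneg_of_nonneg_of_le_pi (by linarith)
    (by linarith)
  -- As the cosine lies in [0, 1], it is at least its square 1 - sin²(g/2) ≥ 1 - s². Its sign comes
  -- from the centre lying in the polygon; without this, a gap wider than a half turn could also
  -- have a short chord.
  have hcos : 1 - s ^ 2 ≤ Real.cos (g / 2) := by
    nlinarith [Real.sin_sq_add_cos_sq (g / 2), Real.cos_le_one (g / 2)]
  -- One of the two ends of the gap is within angle g/2 of φ', so its height is at least δ cos(g/2),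
  -- contradicting `hv`.
  rcases le_total (φ' - P.angle k) (g / 2) with h | h
  · have h1 := Real.cos_le_cos_of_nonneg_of_le_pi (by linarith) (by linarith) h
    have h2 : Real.cos (φ' - P.angle k) = Real.cos (P.angle k - φ) := by
      rw [← Real.cos_neg, ← hperiod (P.angle k - φ) (-m), hm]
      congr 1; push_cast; ring
    linarith [hv k]
  · have h1 := Real.cos_le_cos_of_nonneg_of_le_pi (x := next - φ') (y := g / 2)
      (by linarith) (by linarith) (by linarith)
    have h2 : Real.cos (next - φ') = Real.cos (P.angle (finRotate P.n k) - φ) := by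
      rw [← hperiod (P.angle (finRotate P.n k) - φ) (m' - m), hm, hm']
      congr 1; push_cast; ring
    linarith [hv (finRotate P.n k)]

lemma mem_region_of_inradius_pos (P : InscribedPolygon) {x : Plane} {δ : ℝ}
    (h : 0 < P.inradius x δ) : x ∈ P.region x δ := by
  have hne : {r : ℝ | Metric.ball x r ⊆ P.region x δ}.Nonempty :=
    ⟨0, by simp⟩
  obtain ⟨r, hr, hr0⟩ := exists_lt_of_lt_csSup hne h
  exact hr (Metric.mem_ball_self hr0)

end InscribedPolygon

/-- Weakly quasi-uniform polygons contain discs of radius `δ (1 - c / n_δ²)`. -/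
lemma IsWeaklyQuasiUniform.exists_ball_subset {ι : Type*} {Ω : Set Plane} {δ : ι → ℝ}
    {P : ι → Plane → InscribedPolygon} (hδ : ∀ i, 0 < δ i) (hP : IsWeaklyQuasiUniform Ω δ P) :
    ∃ c : ℝ, 0 ≤ c ∧ ∀ i, ∀ x ∈ hatDomain Ω (δ i),
      Metric.ball x (δ i * (1 - c / (maxSides (hatDomain Ω (δ i)) (P i) : ℝ) ^ 2))
        ⊆ (P i x).region x (δ i) := by
  obtain ⟨C₁, C₂, C₃, h1, h2, h3, h⟩ := hP
  -- Sides of length at most 2δs with s = C₁πC₃ / n_δ give discs of radius δ(1 - s²): indeed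
  -- sin(π/n) ≤ π/n and n ≥ n_δ / C₃ for every polygon of the family.
  refine ⟨(C₁ * Real.pi * C₃) ^ 2, sq_nonneg _, fun i x hx => ?_⟩
  obtain ⟨ha, hb, hc, hd⟩ := h i
  set N := maxSides (hatDomain Ω (δ i)) (P i)
  have hmin : minSides (hatDomain Ω (δ i)) (P i) ≤ (P i x).n :=
    Nat.sInf_le (mem_image_of_mem _ hx)
  have hmax : (P i x).n ≤ N := le_csSup hc (mem_image_of_mem _ hx)
  have hn3 := (P i x).three_le
  have hn0 : (0 : ℝ) < (P i x).n := by exact_mod_cast (by omega : 0 < (P i x).n)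
  have hN0 : (0 : ℝ) < N := by exact_mod_cast (by omega : 0 < N)
  have hNn : (N : ℝ) ≤ C₃ * (P i x).n :=
    hd.trans (mul_le_mul_of_nonneg_left (by exact_mod_cast hmin) h3.le)
  rw [← div_pow]
  refine (P i x).ball_subset_region (hδ i) ?_
    ((P i x).mem_region_of_inradius_pos (lt_of_lt_of_le (mul_pos h2 (hδ i)) (hb x hx)))
  have hpi : 0 < Real.pi / (P i x).n := div_pos Real.pi_pos hn0
  have hpi2 : Real.pi / (P i x).n < Real.pi :=
    div_lt_self Real.pi_pos (by exact_mod_cast (by omega : 1 < (P i x).n))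
  have hsin := Real.sin_pos_of_pos_of_lt_pi hpi hpi2
  have h4 := (div_le_iff₀ (mul_pos two_pos hsin)).1 (ha x hx)
  have h5 : Real.pi / (P i x).n ≤ Real.pi * C₃ / N := by
    rw [div_le_div_iff₀ hn0 hN0]
    nlinarith [Real.pi_pos]
  have h6 := (Real.sin_lt hpi).le.trans h5
  calc (P i x).longestSide x (δ i) ≤ C₁ * δ i * (2 * Real.sin (Real.pi / (P i x).n)) := h4
    _ ≤ C₁ * δ i * (2 * (Real.pi * C₃ / N)) :=
      mul_le_mul_of_nonneg_left (by linarith) (mul_pos h1 (hδ i)).le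
    _ = 2 * δ i * (C₁ * Real.pi * C₃ / N) := by ring

/-! ### Taylor expansions and the consistency of the nonlocal operator -/

/-- Taylor's formula with integral remainder along the segment; the factor 1/n! is crudely bounded
by 1. -/
lemma abs_sub_taylor_le {n : ℕ} {D : Set Plane} (hD : IsOpen D) {u : Plane → ℝ}
    (hu : ContDiffOn ℝ (n + 1) u D) {M : ℝ} (hM : ∀ x ∈ D, ‖iteratedFDeriv ℝ (n + 1) u x‖ ≤ M)
    {x z : Plane} (hxz : ∀ t ∈ Icc (0 : ℝ) 1, x + t • z ∈ D) :
    |u (x + z) - ∑ k ∈ Finset.range (n + 1), (k.factorial : ℝ)⁻¹ *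
      iteratedFDeriv ℝ k u x (fun _ => z)| ≤ M * ‖z‖ ^ (n + 1) := by
  have h := map_add_eq_sum_add_integral_iteratedFDeriv (f := u) (x := x) (y := z) (n := n)
    (fun t ht => hu.contDiffAt (hD.mem_nhds (hxz t ht)))
  simp only [smul_eq_mul] at h
  rw [h, add_sub_cancel_left, abs_mul]
  have h1 : |(n.factorial : ℝ)⁻¹| ≤ 1 := by
    rw [abs_of_nonneg (by positivity)]
    exact inv_le_one_of_one_le₀ (by exact_mod_cast n.factorial_pos)
  have h2 : |∫ t in (0 : ℝ)..1, (1 - t) ^ n * iteratedFDeriv ℝ (n + 1) u (x + t • z)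
      (fun _ => z)| ≤ M * ‖z‖ ^ (n + 1) := by
    have := intervalIntegral.norm_integral_le_of_norm_le_const (a := 0) (b := 1)
      (C := M * ‖z‖ ^ (n + 1))
      (f := fun t : ℝ => (1 - t) ^ n * iteratedFDeriv ℝ (n + 1) u (x + t • z) (fun _ => z))
      (fun t ht => by
        rw [uIoc_of_le zero_le_one] at ht
        have ht' : t ∈ Icc (0 : ℝ) 1 := ⟨ht.1.le, ht.2⟩
        rw [norm_mul]
        have a1 : ‖(1 - t) ^ n‖ ≤ 1 := by
          rw [norm_pow]
          refine pow_le_one₀ (norm_nonneg _) ?_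
          rw [Real.norm_eq_abs, abs_le]; constructor <;> linarith [ht.1, ht.2]
        have a2 : ‖iteratedFDeriv ℝ (n + 1) u (x + t • z) (fun _ => z)‖ ≤ M * ‖z‖ ^ (n + 1) := by
          refine (ContinuousMultilinearMap.le_opNorm _ _).trans ?_
          simp only [Finset.prod_const, Finset.card_univ, Fintype.card_fin]
          exact mul_le_mul_of_nonneg_right (hM _ (hxz t ht')) (by positivity)
        calc _ ≤ 1 * (M * ‖z‖ ^ (n + 1)) := mul_le_mul a1 a2 (norm_nonneg _) zero_le_one
          _ = _ := one_mul _)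
    simpa using this
  calc _ ≤ 1 * (M * ‖z‖ ^ (n + 1)) := mul_le_mul h1 h2 (abs_nonneg _) zero_le_one
    _ = _ := one_mul _

/-- `u` is `C⁴` on the open set `D` with derivatives of order at most `4` bounded by `M`. -/
structure HasDerivBound (D : Set Plane) (u : Plane → ℝ) (M : ℝ) : Prop where
  isOpen : IsOpen D
  contDiffOn : ContDiffOn ℝ 4 u D
  bound_nonneg : 0 ≤ M
  bound : ∀ j ≤ 4, ∀ x ∈ D, ‖iteratedFDeriv ℝ j u x‖ ≤ M

lemma IsCb.hasDerivBound {D : Set Plane} {u : Plane → ℝ} (h : IsCb 4 D u) (hD : IsOpen D) :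
    ∃ M, HasDerivBound D u M := by
  choose! M hM using h.2
  refine ⟨∑ j ∈ Finset.range 5, |M j|, hD, h.1, Finset.sum_nonneg fun _ _ => abs_nonneg _, ?_⟩
  intro j hj x hx
  rw [← iteratedFDerivWithin_of_isOpen j hD hx]
  exact (hM j hj x hx).trans ((le_abs_self _).trans (Finset.single_le_sum (f := fun j => |M j|)
    (fun _ _ => abs_nonneg _) (Finset.mem_range.2 (by omega))))

lemma HasDerivBound.congr {D : Set Plane} {u v : Plane → ℝ} {M : ℝ} (h : HasDerivBound D u M)
    (huv : EqOn v u D) : HasDerivBound D v M := by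
  refine ⟨h.isOpen, h.contDiffOn.congr huv, h.bound_nonneg, fun j hj x hx => ?_⟩
  rw [← iteratedFDerivWithin_of_isOpen j h.isOpen hx, iteratedFDerivWithin_congr huv hx,
    iteratedFDerivWithin_of_isOpen j h.isOpen hx]
  exact h.bound j hj x hx

section

variable {D : Set Plane} {u : Plane → ℝ} {M : ℝ} (h : HasDerivBound D u M) {x z : Plane}
include h

lemma HasDerivBound.abs_le (hx : x ∈ D) : |u x| ≤ M := by
  have := h.bound 0 (by norm_num) x hx
  rwa [norm_iteratedFDeriv_zero] at this

lemma HasDerivBound.abs_sub_le (hxz : ∀ t ∈ Icc (0 : ℝ) 1, x + t • z ∈ D) :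
    |u (x + z) - u x| ≤ M * ‖z‖ := by
  have := abs_sub_taylor_le (n := 0) h.isOpen (h.contDiffOn.of_le (by norm_num))
    (h.bound 1 (by norm_num)) hxz
  simpa using this

lemma HasDerivBound.abs_sub_fderiv_le (hxz : ∀ t ∈ Icc (0 : ℝ) 1, x + t • z ∈ D) :
    |u (x + z) - u x - fderiv ℝ u x z| ≤ M * ‖z‖ ^ 2 := by
  have := abs_sub_taylor_le (n := 1) h.isOpen
    (h.contDiffOn.of_le (by norm_num)) (h.bound 2 (by norm_num)) hxz
  simp only [Finset.sum_range_succ, Finset.sum_range_zero] at this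
  simpa [sub_sub] using this

/-- The terms of order 1 and 3 cancel between z and -z, leaving two fourth-order remainders. -/
lemma HasDerivBound.abs_second_difference_le (hxz : ∀ t ∈ Icc (-1 : ℝ) 1, x + t • z ∈ D) :
    |u (x + z) + u (x - z) - 2 * u x - iteratedFDeriv ℝ 2 u x ![z, z]| ≤ 2 * M * ‖z‖ ^ 4 := by
  have hc : ContDiffOn ℝ ((3 : ℕ) + 1) u D := h.contDiffOn.of_le (by norm_num)
  have h1 := abs_sub_taylor_le (n := 3) h.isOpen hc (h.bound 4 le_rfl)
    (z := z) (fun t ht => hxz t ⟨by linarith [ht.1], ht.2⟩)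
  have h2 := abs_sub_taylor_le (n := 3) h.isOpen hc (h.bound 4 le_rfl)
    (z := -z) (fun t ht => by
      have := hxz (-t) ⟨by linarith [ht.2], by linarith [ht.1]⟩
      rwa [neg_smul, ← smul_neg] at this)
  have hneg : ∀ k, iteratedFDeriv ℝ k u x (fun _ => -z)
      = (-1) ^ k * iteratedFDeriv ℝ k u x (fun _ => z) := by
    intro k
    have := (iteratedFDeriv ℝ k u x).map_smul_univ (fun _ => (-1 : ℝ)) (fun _ => z)
    simpa using this
  have h2z : (![z, z] : Fin 2 → Plane) = fun _ => z := by
    funext i; fin_cases i <;> rfl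
  rw [h2z]
  simp only [Finset.sum_range_succ, Finset.sum_range_zero, hneg, norm_neg, ← sub_eq_add_neg] at h1 h2
  norm_num [Nat.factorial] at h1 h2
  rw [_root_.abs_le] at h1 h2 ⊢
  constructor <;> linarith [h1.1, h1.2, h2.1, h2.2]

end

/-- The rotation by a quarter turn. -/
def quarterTurn : Plane ≃ₗᵢ[ℝ] Plane where
  toFun z := !₂[-z 1, z 0]
  invFun z := !₂[z 1, -z 0]
  map_add' z w := by ext i; fin_cases i <;> simp; ring
  map_smul' c z := by ext i; fin_cases i <;> simp
  left_inv z := by ext i; fin_cases i <;> simp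
  right_inv z := by ext i; fin_cases i <;> simp
  norm_map' z := by
    rw [EuclideanSpace.norm_eq, EuclideanSpace.norm_eq, Fin.sum_univ_two, Fin.sum_univ_two]
    congr 1
    simp [add_comm]

lemma quarterTurn_apply (z : Plane) : quarterTurn z = !₂[-z 1, z 0] := rfl

/-- z and its quarter turn are orthogonal of equal length, so the sum is ‖z‖² times the trace of the
Hessian. -/
lemma laplacian_mul_norm_sq (u : Plane → ℝ) (x z : Plane) :
    iteratedFDeriv ℝ 2 u x ![z, z]
      + iteratedFDeriv ℝ 2 u x ![quarterTurn z, quarterTurn z]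
      = ‖z‖ ^ 2 * Laplacian.laplacian u x := by
  have hL : Laplacian.laplacian u x = ∑ i : Fin 2, iteratedFDeriv ℝ 2 u x
      ![EuclideanSpace.single i 1, EuclideanSpace.single i 1] := by
    have := congrFun (InnerProductSpace.laplacian_eq_iteratedFDeriv_orthonormalBasis u
      (EuclideanSpace.basisFun (Fin 2) ℝ)) x
    simpa using this
  set B := bilinearIteratedFDerivTwo ℝ u x
  have hB : ∀ a b, iteratedFDeriv ℝ 2 u x ![a, b] = B a b := fun a b =>
    (bilinearIteratedFDerivTwo_eq_iteratedFDeriv u x a b).symm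
  have hz : ∀ w : Plane, w = w 0 • EuclideanSpace.single (0 : Fin 2) (1 : ℝ)
        + w 1 • EuclideanSpace.single (1 : Fin 2) (1 : ℝ) := by
    intro w
    ext i; fin_cases i <;> simp
  have hn : ‖z‖ ^ 2 = z 0 ^ 2 + z 1 ^ 2 := by
    rw [EuclideanSpace.norm_sq_eq, Fin.sum_univ_two]; simp
  rw [hL, Fin.sum_univ_two]
  simp only [hB]
  have hq : quarterTurn z = (-z 1) • EuclideanSpace.single (0 : Fin 2) (1 : ℝ)
        + z 0 • EuclideanSpace.single (1 : Fin 2) (1 : ℝ) := by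
    rw [hz (quarterTurn z), quarterTurn_apply]
    simp
  have key : ∀ (a b : ℝ) (e f : Plane), B (a • e + b • f) (a • e + b • f)
      + B (-b • e + a • f) (-b • e + a • f) = (a ^ 2 + b ^ 2) * (B e e + B f f) := by
    intro a b e f
    simp only [map_add, map_smul, LinearMap.add_apply, LinearMap.smul_apply, smul_eq_mul]
    ring
  rw [hn, ← key (z 0) (z 1), ← hz z, ← hq]

section Consistency

variable {γ : ℝ → ℝ} {D : Set Plane} {u : Plane → ℝ} {M δ : ℝ} {x : Plane}

lemma HasDerivBound.integrable_diff_mul (h : HasDerivBound D u M) (hum : Measurable u)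
    (hγ : IsKernelProfile γ) (hδ : 0 < δ) (hx : Metric.ball x δ ⊆ D) {q : Plane → ℝ}
    (hq : Measurable q) (hq0 : ∀ z, 0 ≤ q z) (hqJ : ∀ z, q z ≤ radialKernel γ δ z) :
    Integrable (fun z => (u (x + z) - u x) * q z) := by
  refine ((hγ.integrable_radialKernel hδ).const_mul (M * δ)).mono'
    (((hum.comp (measurable_const_add x)).sub_const _).mul hq).aestronglyMeasurable
    (ae_of_all _ fun z => ?_)
  rw [norm_mul, Real.norm_eq_abs, Real.norm_eq_abs, abs_of_nonneg (hq0 z)]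
  rcases lt_or_ge ‖z‖ δ with hz | hz
  · have : |u (x + z) - u x| ≤ M * ‖z‖ := h.abs_sub_le fun t ht => hx (by
      rw [mem_ball_iff_norm, add_sub_cancel_left, norm_smul, Real.norm_eq_abs, abs_of_nonneg ht.1]
      exact lt_of_le_of_lt (mul_le_of_le_one_left (norm_nonneg _) ht.2) hz)
    exact mul_le_mul (this.trans (mul_le_mul_of_nonneg_left hz.le h.bound_nonneg)) (hqJ z)
      (hq0 z) (mul_nonneg h.bound_nonneg hδ.le)
  · have h0 := radialKernel_eq_zero (γ := γ) hδ hz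
    have : q z = 0 := le_antisymm ((hqJ z).trans h0.le) (hq0 z)
    simp [this, h0]

/-- The radial kernel is invariant under the four rotations by multiples of a quarter turn, so the
integral may be replaced by its average over them. In the average odd-order terms cancel and the
Hessian terms add up to ‖z‖² Δu pointwise; the second moment 2 of the kernel then gives Δu, with a
fourth-order remainder. -/
lemma HasDerivBound.radial_consistency (h : HasDerivBound D u M) (hum : Measurable u)
    (hγ : IsKernelProfile γ) (hδ : 0 < δ) (hx : Metric.ball x δ ⊆ D) :
    |2 * (∫ z, (u (x + z) - u x) * radialKernel γ δ z) - Laplacian.laplacian u x|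
      ≤ 4 * M * δ ^ 2 := by
  set J := radialKernel γ δ
  set F : Plane → ℝ := fun z => (u (x + z) - u x) * J z
  have hF : Integrable F := h.integrable_diff_mul hum hγ hδ hx (hγ.measurable_radialKernel δ)
    (hγ.radialKernel_nonneg δ) (fun _ => le_rfl)
  set R := quarterTurn
  have hR : MeasurePreserving R volume volume := R.measurePreserving
  have hRe : MeasurableEmbedding R := R.toHomeomorph.measurableEmbedding
  have hFn : Integrable fun z => F (-z) := hF.comp_neg
  have hFR : Integrable fun z => F (R z) := (hR.integrable_comp_emb hRe).2 hF
  have hFRn : Integrable fun z => F (-R z) := (hR.integrable_comp_emb hRe).2 hFn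
  have hLap := (hγ.integrable_sq_mul_radialKernel hδ).mul_const (Laplacian.laplacian u x)
  have hE := (hγ.integrable_sq_mul_radialKernel hδ).const_mul (4 * M * δ ^ 2)
  have e1 : ∫ z, F (-z) = ∫ z, F z := integral_neg_eq_self F volume
  have e2 : ∫ z, F (R z) = ∫ z, F z := hR.integral_comp hRe F
  have e3 : ∫ z, F (-R z) = ∫ z, F z := (hR.integral_comp hRe fun z => F (-z)).trans e1
  have hsum : ∫ z, (F z + F (-z) + (F (R z) + F (-R z))
      - ‖z‖ ^ 2 * J z * Laplacian.laplacian u x)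
      = 4 * (∫ z, F z) - 2 * Laplacian.laplacian u x := by
    have i1 : Integrable fun z => F z + F (-z) := hF.add hFn
    have i2 : Integrable fun z => F (R z) + F (-R z) := hFR.add hFRn
    have i3 : Integrable fun z => F z + F (-z) + (F (R z) + F (-R z)) := i1.add i2
    rw [integral_sub i3 hLap, integral_add i1 i2, integral_add hF hFn, integral_add hFR hFRn,
      e1, e2, e3, integral_mul_const, hγ.integral_sq_mul_radialKernel hδ]
    ring
  have hJn : ∀ z, J (-z) = J z := fun z => by simp [J, radialKernel]
  have hJR : ∀ z, J (R z) = J z := fun z => by simp [J, radialKernel]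
  have hbound : |∫ z, (F z + F (-z) + (F (R z) + F (-R z))
      - ‖z‖ ^ 2 * J z * Laplacian.laplacian u x)| ≤ 4 * M * δ ^ 2 * 2 := by
    rw [← hγ.integral_sq_mul_radialKernel hδ, ← integral_const_mul, ← Real.norm_eq_abs]
    refine norm_integral_le_of_norm_le hE (ae_of_all _ fun z => ?_)
    have hJ0 : 0 ≤ J z := hγ.radialKernel_nonneg δ z
    rcases lt_or_ge ‖z‖ δ with hz | hz
    · have hseg : ∀ w : Plane, ‖w‖ = ‖z‖ → ∀ t ∈ Icc (-1 : ℝ) 1, x + t • w ∈ D := by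
        intro w hw t ht
        refine hx ?_
        rw [mem_ball_iff_norm, add_sub_cancel_left, norm_smul, Real.norm_eq_abs, hw]
        exact lt_of_le_of_lt (mul_le_of_le_one_left (norm_nonneg _) (_root_.abs_le.2 ht)) hz
      have b1 := h.abs_second_difference_le (hseg z rfl)
      have b2 := h.abs_second_difference_le (hseg (R z) (R.norm_map z))
      rw [R.norm_map] at b2
      have key : |u (x + z) + u (x - z) + u (x + R z) + u (x - R z) - 4 * u x
          - ‖z‖ ^ 2 * Laplacian.laplacian u x| ≤ 4 * M * ‖z‖ ^ 4 := by
        rw [← laplacian_mul_norm_sq u x z]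
        rw [_root_.abs_le] at b1 b2 ⊢
        constructor <;> linarith [b1.1, b1.2, b2.1, b2.2]
      have e : F z + F (-z) + (F (R z) + F (-R z)) - ‖z‖ ^ 2 * J z * Laplacian.laplacian u x
          = (u (x + z) + u (x - z) + u (x + R z) + u (x - R z) - 4 * u x
          - ‖z‖ ^ 2 * Laplacian.laplacian u x) * J z := by
        simp only [F, hJn, hJR, ← sub_eq_add_neg]; ring
      rw [e, norm_mul, Real.norm_eq_abs, Real.norm_eq_abs, abs_of_nonneg hJ0, ← mul_assoc]
      refine mul_le_mul_of_nonneg_right (key.trans ?_) hJ0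
      have : ‖z‖ ^ 2 ≤ δ ^ 2 := pow_le_pow_left₀ (norm_nonneg _) hz.le 2
      have hM := h.bound_nonneg
      calc 4 * M * ‖z‖ ^ 4 = 4 * M * ‖z‖ ^ 2 * ‖z‖ ^ 2 := by ring
        _ ≤ 4 * M * δ ^ 2 * ‖z‖ ^ 2 := by gcongr
    · have h0 : J z = 0 := radialKernel_eq_zero hδ hz
      have h0' : radialKernel γ δ z = 0 := h0
      simp [F, hJn, hJR, h0, h0']
  rw [hsum] at hbound
  rw [_root_.abs_le] at hbound ⊢
  constructor <;> linarith [hbound.1, hbound.2]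

/-- Consistency for kernels that agree with the radial kernel in the disc of radius `t δ`. -/
lemma HasDerivBound.consistency (h : HasDerivBound D u M) (hum : Measurable u)
    (hγ : IsKernelProfile γ) (hδ : 0 < δ) (hx : Metric.ball x δ ⊆ D) {q : Plane → ℝ}
    (hq : Measurable q) (hq0 : ∀ z, 0 ≤ q z) (hqJ : ∀ z, q z ≤ radialKernel γ δ z)
    {t : ℝ} (ht : 1 / 2 ≤ t) (ht1 : t ≤ 1)
    (hqt : ∀ z, ‖z‖ < t * δ → q z = radialKernel γ δ z) :
    |2 * (∫ z, (u (x + z) - u x) * q z) - Laplacian.laplacian u x|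
      ≤ 4 * M * δ ^ 2 + 8 * M * ((Phi γ 1 - Phi γ t) / δ) := by
  have h1 := h.radial_consistency hum hγ hδ hx
  have i1 := h.integrable_diff_mul hum hγ hδ hx hq hq0 hqJ
  have i2 := h.integrable_diff_mul hum hγ hδ hx (hγ.measurable_radialKernel δ)
    (hγ.radialKernel_nonneg δ) (fun _ => le_rfl)
  obtain ⟨i3, h3⟩ := hγ.ring_moment hδ ht ht1
  -- The two kernels differ only for tδ ≤ ‖z‖ < δ, where |u(x + z) - u(x)| ≤ M‖z‖; what remains is
  -- the first moment of the ring.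
  have h2 : |∫ z, ((u (x + z) - u x) * q z - (u (x + z) - u x) * radialKernel γ δ z)|
      ≤ M * (4 / δ * (Phi γ 1 - Phi γ t)) := by
    refine le_trans ?_ (mul_le_mul_of_nonneg_left h3 h.bound_nonneg)
    rw [← integral_const_mul, ← Real.norm_eq_abs]
    refine norm_integral_le_of_norm_le (i3.const_mul M) (ae_of_all _ fun z => ?_)
    rw [← mul_sub, norm_mul, Real.norm_eq_abs, Real.norm_eq_abs, abs_sub_comm (q z),
      abs_of_nonneg (sub_nonneg.2 (hqJ z))]
    rcases lt_or_ge ‖z‖ (t * δ) with hz | hz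
    · rw [hqt z hz, sub_self, mul_zero, indicator_of_notMem (by simpa using hz), mul_zero]
    · rw [indicator_of_mem (by simpa using hz)]
      rcases lt_or_ge ‖z‖ δ with hz2 | hz2
      · have : |u (x + z) - u x| ≤ M * ‖z‖ := h.abs_sub_le fun t ht => hx (by
          rw [mem_ball_iff_norm, add_sub_cancel_left, norm_smul, Real.norm_eq_abs,
            abs_of_nonneg ht.1]
          exact lt_of_le_of_lt (mul_le_of_le_one_left (norm_nonneg _) ht.2) hz2)
        rw [← mul_assoc]
        exact mul_le_mul this (sub_le_self _ (hq0 z)) (sub_nonneg.2 (hqJ z))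
          (mul_nonneg h.bound_nonneg (norm_nonneg _))
      · have h0 := radialKernel_eq_zero (γ := γ) hδ hz2
        have : q z = 0 := le_antisymm ((hqJ z).trans h0.le) (hq0 z)
        simp [this, h0]
  rw [integral_sub i1 i2] at h2
  have e : M * (4 / δ * (Phi γ 1 - Phi γ t)) = 4 * M * ((Phi γ 1 - Phi γ t) / δ) := by ring
  rw [e] at h2
  rw [_root_.abs_le] at h1 h2 ⊢
  constructor <;> linarith [h1.1, h1.2, h2.1, h2.2]

end Consistency

/-! ### Geometry of the domain and its collar -/

lemma isCompact_meshDomain {T : Set (Finset Plane)} (hT : T.Finite) : IsCompact (meshDomain T) :=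
  hT.isCompact_biUnion fun t _ => t.finite_toSet.isCompact_convexHull ℝ

lemma convexHull_subset_meshDomain {T : Set (Finset Plane)} {t : Finset Plane} (ht : t ∈ T) :
    convexHull ℝ (t : Set Plane) ⊆ meshDomain T :=
  subset_biUnion_of_mem (u := fun t : Finset Plane => convexHull ℝ (t : Set Plane)) ht

lemma IsTriangle.affineSpan_eq_top {t : Finset Plane} (ht : IsTriangle t) :
    affineSpan ℝ (range fun p : t => (p : Plane)) = ⊤ := by
  rw [ht.2.affineSpan_eq_top_iff_card_eq_finrank_add_one]
  simp [ht.1]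

lemma IsTriangle.interior_nonempty {t : Finset Plane} (ht : IsTriangle t) :
    (interior (convexHull ℝ (t : Set Plane))).Nonempty := by
  rw [interior_convexHull_nonempty_iff_affineSpan_eq_top, ← ht.affineSpan_eq_top]
  congr 1
  simp

namespace IsPolygonalDomain

variable {Ω : Set Plane} (hΩ : IsPolygonalDomain Ω)
include hΩ

lemma isOpen : IsOpen Ω := by
  obtain ⟨-, T, -, -, rfl⟩ := hΩ
  exact isOpen_interior

lemma isBounded : Bornology.IsBounded Ω := by
  obtain ⟨-, T, hT, -, rfl⟩ := hΩ
  exact (isCompact_meshDomain hT).isBounded.subset interior_subset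

/-- Needed because `Metric.infDist` to the empty set is 0 by convention, so the collar would
otherwise not describe points near the boundary. -/
lemma frontier_nonempty : (frontier Ω).Nonempty := by
  rw [nonempty_frontier_iff]
  refine ⟨hΩ.1, fun h => ?_⟩
  have := hΩ.isBounded
  rw [h] at this
  exact NormedSpace.unbounded_univ ℝ Plane this

lemma isOpen_hatDomain {δ : ℝ} : IsOpen (hatDomain Ω δ) := by
  have : hatDomain Ω δ = Ω ∪ {y | Metric.infDist y (frontier Ω) < δ} := by
    ext y
    simp only [hatDomain, collar, mem_union, mem_ofPred_eq]
    tauto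
  rw [this]
  exact hΩ.isOpen.union (isOpen_lt (Metric.continuous_infDist_pt _) continuous_const)

lemma measurableSet_collar {δ : ℝ} : MeasurableSet (collar Ω δ) :=
  hΩ.isOpen.measurableSet.compl.inter
    (isOpen_lt (Metric.continuous_infDist_pt _) continuous_const).measurableSet

lemma exists_frontier_dist_lt {δ : ℝ} {y : Plane} (hy : y ∈ collar Ω δ) :
    ∃ x ∈ frontier Ω, dist y x < δ :=
  (Metric.infDist_lt_iff hΩ.frontier_nonempty).1 hy.2

omit hΩ in
lemma mem_hatDomain_of_dist_lt {δ : ℝ} {x y : Plane} (hx : x ∈ frontier Ω) (hy : dist y x < δ) :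
    y ∈ hatDomain Ω δ := by
  by_cases h : y ∈ Ω
  · exact Or.inl h
  · exact Or.inr ⟨h, (Metric.infDist_le_dist_of_mem hx).trans_lt hy⟩

/-- A segment from a point of Ω to a point outside meets ∂Ω by connectedness, and the crossing point
is no farther from the outer end than the inner end is. -/
lemma ball_subset_hatDomain {δ : ℝ} {x : Plane} (hx : x ∈ Ω) :
    Metric.ball x δ ⊆ hatDomain Ω δ := by
  intro y hy
  by_cases h : y ∈ Ω
  · exact Or.inl h
  have hmeet : (segment ℝ x y ∩ frontier Ω).Nonempty := by
    by_contra hemp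
    rw [not_nonempty_iff_eq_empty] at hemp
    obtain ⟨z, hz, hz1, hz2⟩ := (convex_segment x y).isPreconnected Ω (closure Ω)ᶜ hΩ.isOpen
      isClosed_closure.isOpen_compl (fun z hz => by
        by_contra hcon
        simp only [mem_union, mem_compl_iff, not_or, not_not] at hcon
        have : z ∈ segment ℝ x y ∩ frontier Ω := ⟨hz, hcon.2, by
          rw [hΩ.isOpen.interior_eq]; exact hcon.1⟩
        rw [hemp] at this
        exact this) ⟨x, left_mem_segment ℝ x y, hx⟩ ⟨y, right_mem_segment ℝ x y, fun hcl => by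
          have : y ∈ segment ℝ x y ∩ frontier Ω := ⟨right_mem_segment ℝ x y, hcl, by
            rw [hΩ.isOpen.interior_eq]; exact h⟩
          rw [hemp] at this
          exact this⟩
    exact hz2 (subset_closure hz1)
  obtain ⟨z, hz, hzf⟩ := hmeet
  refine mem_hatDomain_of_dist_lt hzf ?_
  have h1 : dist y z + dist z x = dist y x := by
    rw [dist_comm y z, dist_comm z x, dist_comm y x, add_comm]
    exact dist_add_dist_of_mem_segment hz
  rw [Metric.mem_ball] at hy
  linarith [dist_nonneg (x := z) (y := x)]

omit hΩ in
lemma hatDomain_mono {δ δ' : ℝ} (h : δ ≤ δ') : hatDomain Ω δ ⊆ hatDomain Ω δ' :=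
  union_subset_union_right _ fun _ hy => ⟨hy.1, hy.2.trans_le h⟩

lemma closure_subset_hatDomain {δ : ℝ} (hδ : 0 < δ) : closure Ω ⊆ hatDomain Ω δ := by
  intro y hy
  by_cases h : y ∈ Ω
  · exact Or.inl h
  · refine mem_hatDomain_of_dist_lt (x := y) ⟨hy, ?_⟩ (by simpa using hδ)
    rwa [hΩ.isOpen.interior_eq]

lemma isBounded_hatDomain {δ : ℝ} : Bornology.IsBounded (hatDomain Ω δ) := by
  refine hΩ.isBounded.union ?_
  have hb : Bornology.IsBounded (Metric.thickening δ (frontier Ω)) :=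
    (hΩ.isBounded.closure.subset frontier_subset_closure).thickening
  refine hb.subset fun y hy => ?_
  obtain ⟨x, hx, hxy⟩ := hΩ.exists_frontier_dist_lt hy
  exact Metric.mem_thickening_iff.2 ⟨x, hx, hxy⟩

end IsPolygonalDomain

/-- The `δ`-neighbourhood of the boundary of a convex body has measure `O(δ)`. -/
lemma volume_thickening_frontier_le {K : Set Plane} (hK : Convex ℝ K) (hKc : IsCompact K)
    {c : Plane} {r δ : ℝ} (hr : 0 < r) (hc : Metric.ball c r ⊆ K) (hδ : 0 < δ) (hδr : δ ≤ r) :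
    volume (Metric.thickening δ (frontier K)) ≤ ENNReal.ofReal (4 * volume.real K / r * δ) := by
  -- K is compared with its dilations about `c` by the factors 1 + t and 1 - t. The boundary layer
  -- lies in the larger one and misses the smaller one, so its area is at most ((1 + t)² - (1 -
  -- t)²)|K| = 4t|K|.
  set t := δ / r with ht
  have ht0 : 0 < t := div_pos hδ hr
  have ht1 : t ≤ 1 := (div_le_one hr).2 hδr
  have htr : t * r = δ := by rw [ht]; field_simp
  have hball : ∀ e : Plane, ‖e‖ < δ → c + t⁻¹ • e ∈ K := by
    intro e he
    refine hc ?_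
    rw [mem_ball_iff_norm, add_sub_cancel_left, norm_smul, norm_inv, Real.norm_eq_abs,
      abs_of_pos ht0, inv_mul_lt_iff₀ ht0, htr]
    exact he
  have hcK : c ∈ K := hc (Metric.mem_ball_self hr)
  set A := AffineMap.homothety c (1 + t) '' K
  set B := AffineMap.homothety c (1 - t) '' K
  have hBc : IsCompact B := hKc.image (AffineMap.homothety_continuous c (1 - t))
  have hmemA : ∀ k ∈ K, ∀ y, y = c + (1 + t) • (k - c) → y ∈ A := by
    rintro k hk y rfl
    refine ⟨k, hk, ?_⟩
    rw [AffineMap.homothety_apply, vsub_eq_sub, vadd_eq_add, add_comm]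
  -- For x ∈ K and y = x + e with ‖e‖ < δ, the preimage of y under the dilation is (x + t(c + t⁻¹e))
  -- / (1 + t), a convex combination of points of K.
  have hSA : Metric.thickening δ (frontier K) ⊆ A := by
    intro y hy
    obtain ⟨x, hx, hxy⟩ := Metric.mem_thickening_iff.1 hy
    have hxK : x ∈ K := hKc.isClosed.frontier_subset hx
    have h2 := hball (y - x) (by rwa [← dist_eq_norm])
    have h3 := hK hxK h2 (a := 1 / (1 + t)) (b := t / (1 + t)) (by positivity) (by positivity)
      (by field_simp)
    refine hmemA _ h3 y ?_
    have h4 : (1 + t) ≠ 0 := by positivity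
    have h5 := ht0.ne'
    ext i
    simp
    field_simp
    ring
  have hBA : B ⊆ A := by
    rintro _ ⟨k, hk, rfl⟩
    have h3 := hK hk hcK (a := (1 - t) / (1 + t)) (b := 2 * t / (1 + t))
      (div_nonneg (by linarith) (by positivity)) (by positivity) (by field_simp; ring)
    refine hmemA _ h3 _ ?_
    have h4 : (1 + t) ≠ 0 := by positivity
    ext i
    simp [AffineMap.homothety_apply]
    field_simp
    ring
  -- The δ-ball about a point of the smaller copy lies in K: its points are (1 - t)k + t(c + t⁻¹e)
  -- with ‖e‖ < δ.
  have hdisj : Disjoint (Metric.thickening δ (frontier K)) B := by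
    rw [Set.disjoint_left]
    rintro y hy ⟨k, hk, rfl⟩
    obtain ⟨x, hx, hxy⟩ := Metric.mem_thickening_iff.1 hy
    set y := AffineMap.homothety c (1 - t) k with hydef
    have hsub : Metric.ball y δ ⊆ K := by
      intro w hw
      have h2 := hball (w - y) (by rwa [mem_ball_iff_norm] at hw)
      have h3 := hK hk h2 (a := 1 - t) (b := t) (by linarith) ht0.le (by ring)
      convert h3 using 1
      have h5 := ht0.ne'
      ext i
      simp [hydef, AffineMap.homothety_apply]
      field_simp
      ring
    have : x ∈ interior K :=
      interior_maximal hsub Metric.isOpen_ball (by rwa [Metric.mem_ball, dist_comm])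
    exact hx.2 this
  have hsum : volume (Metric.thickening δ (frontier K)) + volume B ≤ volume A := by
    rw [← measure_union hdisj hBc.measurableSet]
    exact measure_mono (union_subset hSA hBA)
  have hfr : Module.finrank ℝ Plane = 2 := by simp
  rw [Measure.addHaar_image_homothety, Measure.addHaar_image_homothety, hfr] at hsum
  have hV : volume K = ENNReal.ofReal (volume.real K) :=
    (ENNReal.ofReal_toReal hKc.measure_lt_top.ne).symm
  have hV0 : 0 ≤ volume.real K := measureReal_nonneg
  rw [hV, abs_of_nonneg (sq_nonneg _), abs_of_nonneg (sq_nonneg _),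
    ← ENNReal.ofReal_mul (sq_nonneg _), ← ENNReal.ofReal_mul (sq_nonneg _)] at hsum
  have hle := ENNReal.le_sub_of_add_le_right ENNReal.ofReal_ne_top hsum
  rw [← ENNReal.ofReal_sub _ (by positivity)] at hle
  refine hle.trans_eq ?_
  congr 1
  rw [ht]; field_simp; ring

/-- A boundary point of Ω lies on the boundary of each triangle that contains it, as an interior
point of a triangle is interior to the union. So the collar is covered by the boundary layers of
finitely many convex bodies; η is the smallest radius of the discs chosen inside them. -/
lemma IsPolygonalDomain.exists_volume_collar_le {Ω : Set Plane} (hΩ : IsPolygonalDomain Ω) :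
    ∃ C η : ℝ, 0 ≤ C ∧ 0 < η ∧ ∀ δ, 0 < δ → δ ≤ η →
      volume (collar Ω δ) ≤ ENNReal.ofReal (C * δ) := by
  have hΩ' := hΩ
  obtain ⟨-, T, hT, htri, hdef⟩ := hΩ'
  have hr : ∀ t ∈ T, ∃ c : Plane, ∃ r : ℝ, 0 < r ∧
      Metric.ball c r ⊆ convexHull ℝ (t : Set Plane) := by
    intro t ht
    obtain ⟨c, hc⟩ := (htri t ht).interior_nonempty
    obtain ⟨r, hr, hsub⟩ := Metric.isOpen_iff.1 isOpen_interior c hc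
    exact ⟨c, r, hr, hsub.trans interior_subset⟩
  choose! c r hr hball using hr
  set S := hT.toFinset
  obtain ⟨η, hη, hηr⟩ : ∃ η : ℝ, 0 < η ∧ ∀ t ∈ S, η ≤ r t := by
    rcases S.eq_empty_or_nonempty with h | h
    · exact ⟨1, one_pos, by simp [h]⟩
    · obtain ⟨t, ht, hmin⟩ := S.exists_min_image r h
      exact ⟨r t, hr t (hT.mem_toFinset.1 ht), hmin⟩
  set a : Finset Plane → ℝ := fun t =>
    4 * volume.real (convexHull ℝ (t : Set Plane)) / r t
  have ha : ∀ t ∈ S, 0 ≤ a t := fun t ht =>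
    div_nonneg (by positivity) (hr t (hT.mem_toFinset.1 ht)).le
  refine ⟨∑ t ∈ S, a t, η, Finset.sum_nonneg ha, hη, fun δ hδ hδη => ?_⟩
  have hsub : collar Ω δ ⊆ ⋃ t ∈ S, Metric.thickening δ (frontier (convexHull ℝ (t : Set Plane))) := by
    intro y hy
    obtain ⟨x, hx, hxy⟩ := hΩ.exists_frontier_dist_lt hy
    rw [hdef] at hx
    have hx' := frontier_interior_subset hx
    have hcl := (isCompact_meshDomain hT).isClosed
    obtain ⟨t, ht, hxt⟩ := mem_iUnion₂.1 (hcl.frontier_subset hx')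
    refine mem_iUnion₂.2 ⟨t, hT.mem_toFinset.2 ht, Metric.mem_thickening_iff.2 ⟨x, ?_, hxy⟩⟩
    refine ⟨subset_closure hxt, fun hint => hx'.2 ?_⟩
    exact interior_mono (convexHull_subset_meshDomain ht) hint
  calc volume (collar Ω δ)
      ≤ ∑ t ∈ S, volume (Metric.thickening δ (frontier (convexHull ℝ (t : Set Plane)))) :=
        (measure_mono hsub).trans (measure_biUnion_finset_le _ _)
    _ ≤ ∑ t ∈ S, ENNReal.ofReal (a t * δ) := Finset.sum_le_sum fun t ht =>
        volume_thickening_frontier_le (convex_convexHull ℝ _)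
          (t.finite_toSet.isCompact_convexHull ℝ) (hr t (hT.mem_toFinset.1 ht))
          (hball t (hT.mem_toFinset.1 ht)) hδ (hδη.trans (hηr t ht))
    _ = ENNReal.ofReal ((∑ t ∈ S, a t) * δ) := by
        rw [Finset.sum_mul, ENNReal.ofReal_sum_of_nonneg fun t ht => mul_nonneg (ha t ht) hδ.le]

/-! ### Piecewise linear functions -/

lemma IsTriangle.exists_affine {t : Finset Plane} (ht : IsTriangle t) (u : Plane → ℝ) :
    ∃ A : Plane →ᵃ[ℝ] ℝ, ∀ p ∈ t, A p = u p := by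
  classical
  let b : AffineBasis t ℝ Plane := ⟨fun p => (p : Plane), ht.2, ht.affineSpan_eq_top⟩
  refine ⟨∑ p : t, u p • b.coord p, fun q hq => ?_⟩
  have hq' : q = b ⟨q, hq⟩ := rfl
  have : (∑ p : t, u p • b.coord p) q = ∑ p : t, u p * b.coord p q := by
    let ev : (Plane →ᵃ[ℝ] ℝ) →+ ℝ :=
      { toFun := fun A => A q, map_zero' := rfl, map_add' := fun _ _ => rfl }
    exact map_sum ev (fun p : t => u p • b.coord p) Finset.univ
  rw [this, hq']
  simp only [b.coord_apply]
  simp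
  rfl

/-- The piecewise linear interpolant on a conforming triangulation. -/
lemma IsTriangulation.exists_interpolant {T : Set (Finset Plane)} (hT : IsTriangulation T)
    (u : Plane → ℝ) :
    ∃ v, IsP1 T v ∧ ∀ t ∈ T, ∃ A : Plane →ᵃ[ℝ] ℝ, EqOn v A (convexHull ℝ (t : Set Plane)) ∧
      ∀ p ∈ t, A p = u p := by
  classical
  have hA : ∀ t ∈ T, ∃ A : Plane →ᵃ[ℝ] ℝ, ∀ p ∈ t, A p = u p := fun t ht =>
    (hT.triangle t ht).exists_affine u
  choose! A hA using hA
  let v : Plane → ℝ := fun x =>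
    if hx : ∃ t ∈ T, x ∈ convexHull ℝ (t : Set Plane) then A hx.choose x else 0
  have hv : ∀ t ∈ T, EqOn v (A t) (convexHull ℝ (t : Set Plane)) := by
    intro t ht x hx
    have hex : ∃ t ∈ T, x ∈ convexHull ℝ (t : Set Plane) := ⟨t, ht, hx⟩
    have hs := hex.choose_spec
    have hvx : v x = A hex.choose x := dif_pos hex
    rw [hvx]
    set s := hex.choose
    -- Conformity places `x` in the hull of the common vertices, where the two affine functions
    -- agree; so the choice of triangle in `v` is immaterial.
    have hmem := hT.conforming s hs.1 t ht ⟨hs.2, hx⟩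
    have heq : EqOn (A s) (A t) ((s : Set Plane) ∩ t) := fun p hp => by
      rw [hA s hs.1 p hp.1, hA t ht p hp.2]
    have hconv : Convex ℝ {x | (A s - A t) x = 0} := by
      have := (convex_singleton (𝕜 := ℝ) (0 : ℝ)).affine_preimage (A s - A t)
      exact this
    have := convexHull_min (s := (s : Set Plane) ∩ t) (fun p hp => by
      rw [mem_ofPred_eq, AffineMap.coe_sub, Pi.sub_apply, heq hp, sub_self]) hconv hmem
    rw [mem_ofPred_eq, AffineMap.coe_sub, Pi.sub_apply] at this
    linarith
  exact ⟨v, fun t ht => ⟨A t, hv t ht⟩, fun t ht => ⟨A t, hv t ht, hA t ht⟩⟩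

/-- The interpolation error on a triangle. -/
lemma HasDerivBound.abs_interpolant_sub_le {D : Set Plane} {u : Plane → ℝ} {M h : ℝ}
    (hu : HasDerivBound D u M) {t : Finset Plane} (ht : convexHull ℝ (t : Set Plane) ⊆ D)
    (hdiam : Metric.diam (convexHull ℝ (t : Set Plane)) ≤ h) {A : Plane →ᵃ[ℝ] ℝ}
    (hA : ∀ p ∈ t, A p = u p) {x : Plane} (hx : x ∈ convexHull ℝ (t : Set Plane)) :
    |u x - A x| ≤ M * h ^ 2 := by
  -- E is the interpolant minus the Taylor polynomial of degree one at `x`. By Taylor it is at most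
  -- M h² at the vertices, hence on the whole triangle since it is affine; at `x` it equals the
  -- negative of the interpolation error.
  let E : Plane →ᵃ[ℝ] ℝ := A - ((fderiv ℝ u x : Plane →ₗ[ℝ] ℝ).toAffineMap
    + AffineMap.const ℝ Plane (u x - fderiv ℝ u x x))
  have hE : ∀ y, E y = A y - u x - fderiv ℝ u x (y - x) := by
    intro y
    simp [E]; ring
  have hconv : Convex ℝ (E ⁻¹' Icc (-(M * h ^ 2)) (M * h ^ 2)) :=
    (convex_Icc _ _).affine_preimage E
  have hsub : (t : Set Plane) ⊆ E ⁻¹' Icc (-(M * h ^ 2)) (M * h ^ 2) := by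
    intro p hp
    rw [mem_preimage, mem_Icc, ← _root_.abs_le, hE, hA p hp]
    have hpK : p ∈ convexHull ℝ (t : Set Plane) := subset_convexHull ℝ _ hp
    have h1 := hu.abs_sub_fderiv_le (x := x) (z := p - x) (fun s hs => ht
      ((convex_convexHull ℝ _).add_smul_sub_mem hx hpK hs))
    rw [add_sub_cancel] at h1
    refine h1.trans (mul_le_mul_of_nonneg_left ?_ hu.bound_nonneg)
    refine pow_le_pow_left₀ (norm_nonneg _) ?_ 2
    rw [← dist_eq_norm]
    exact (Metric.dist_le_diam_of_mem (t.finite_toSet.isCompact_convexHull ℝ).isBounded hpK hx).trans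
      hdiam
  have := convexHull_min hsub hconv hx
  rw [mem_preimage, mem_Icc, ← _root_.abs_le, hE] at this
  rw [abs_sub_comm]
  simpa using this

lemma IsP1.continuousOn {T : Set (Finset Plane)} (hT : T.Finite) {v : Plane → ℝ} (hv : IsP1 T v) :
    ContinuousOn v (meshDomain T) := by
  have : meshDomain T = ⋃ t : T, convexHull ℝ ((t : Finset Plane) : Set Plane) := by
    rw [meshDomain, biUnion_eq_iUnion]
  rw [this]
  have := hT.to_subtype
  refine (locallyFinite_of_finite _).continuousOn_iUnion
    (fun t => ((t : Finset Plane).finite_toSet.isCompact_convexHull ℝ).isClosed) fun t => ?_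
  obtain ⟨A, hA⟩ := hv t t.2
  exact A.continuous_of_finiteDimensional.continuousOn.congr hA

/-- Discrete functions are measurable and bounded. -/
lemma measurable_and_bounded_of_mem_cdgSpace {D : Set Plane} (hD : MeasurableSet D)
    {T : Set (Finset Plane)} (hT : T.Finite) (hDT : D ⊆ meshDomain T) {w : Plane → ℝ}
    (hw : w ∈ cdgSpace D T) : Measurable w ∧ ∃ B, ∀ x, |w x| ≤ B := by
  classical
  obtain ⟨v, hv, rfl⟩ := hw
  have hc := hv.continuousOn hT
  have hK := isCompact_meshDomain hT
  have hm : Measurable ((meshDomain T).indicator v) := by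
    rw [← piecewise_eq_indicator]
    exact hc.measurable_piecewise continuousOn_const hK.measurableSet
  have he : D.indicator v = D.indicator ((meshDomain T).indicator v) := by
    rw [indicator_indicator, inter_eq_left.2 hDT]
  refine ⟨he ▸ hm.indicator hD, ?_⟩
  obtain ⟨B, hB⟩ := hK.exists_bound_of_continuousOn hc
  refine ⟨|B|, fun x => ?_⟩
  by_cases hx : x ∈ D
  · rw [indicator_of_mem hx]
    exact (hB x (hDT hx)).trans (le_abs_self B)
  · rw [indicator_of_notMem hx, abs_zero]
    exact abs_nonneg B

/-! ### The polygonal kernel -/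

section Kernel

variable {γ : ℝ → ℝ} {δ : ℝ} {P : Plane → InscribedPolygon}

lemma ballKernel_cutProfile (hδ : 0 < δ) (x y : Plane) :
    ballKernel (cutProfile γ) δ x y = radialKernel γ δ (y - x) := by
  unfold ballKernel
  split_ifs with h
  · rw [radialKernel, dist_eq_norm]
  · rw [radialKernel_eq_zero hδ (by rw [← dist_eq_norm]; exact not_lt.1 h)]

/-- Off the diagonal the profile is only evaluated in `(0,1)`. -/
lemma polyKernel_cutProfile {x y : Plane} (hδ : 0 < δ) (hxy : y ≠ x) :
    polyKernel (cutProfile γ) δ P x y = polyKernel γ δ P x y := by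
  have : ballKernel (cutProfile γ) δ x y = ballKernel γ δ x y := by
    unfold ballKernel
    split_ifs with h
    · have : dist y x / δ ∈ Ioo (0 : ℝ) 1 :=
        ⟨div_pos (dist_pos.2 hxy) hδ, (div_lt_one hδ).2 h⟩
      rw [cutProfile, indicator_of_mem this]
    · rfl
  rw [polyKernel, polyKernel, this]

/-- Nothing is assumed about γ at 0, so the original kernel may be negative on the diagonal. There
the difference factor vanishes, and the nonnegative cut kernel can be used in its place. -/
lemma diff_mul_polyKernel_cutProfile (hδ : 0 < δ) (u : Plane → ℝ) (x y : Plane) :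
    (u y - u x) * polyKernel (cutProfile γ) δ P x y = (u y - u x) * polyKernel γ δ P x y := by
  by_cases h : y = x
  · rw [h, sub_self, zero_mul, zero_mul]
  · rw [polyKernel_cutProfile hδ h]

lemma energyInner_cutProfile (hδ : 0 < δ) (D : Set Plane) (u v : Plane → ℝ) :
    energyInner D (polyKernel (cutProfile γ) δ P) u v
      = energyInner D (polyKernel γ δ P) u v := by
  have : ∀ x y, (u y - u x) * (v y - v x) * polyKernel (cutProfile γ) δ P x y
      = (u y - u x) * (v y - v x) * polyKernel γ δ P x y := fun x y => by
    rw [mul_assoc, diff_mul_polyKernel_cutProfile hδ, ← mul_assoc]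
  simp only [energyInner, this]

lemma nonlocalOp_cutProfile (hδ : 0 < δ) (u : Plane → ℝ) :
    nonlocalOp (polyKernel (cutProfile γ) δ P) u = nonlocalOp (polyKernel γ δ P) u := by
  funext x
  simp only [nonlocalOp, diff_mul_polyKernel_cutProfile hδ]

lemma mem_dualRegion_iff {x y : Plane} (hxy : dist y x < δ) :
    y ∈ dualRegion δ P x ↔ x ∈ (P y).region y δ :=
  ⟨fun h => h.2, fun h => ⟨hxy, h⟩⟩

lemma IsKernelProfile.polyKernel_nonneg (hγ : IsKernelProfile γ) (hδ : 0 < δ) (x y : Plane) :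
    0 ≤ polyKernel (cutProfile γ) δ P x y := by
  rw [polyKernel, ballKernel_cutProfile hδ]
  refine mul_nonneg (mul_nonneg (by norm_num) (hγ.radialKernel_nonneg δ _)) (add_nonneg ?_ ?_) <;>
  exact indicator_nonneg (fun _ _ => zero_le_one) _

lemma IsKernelProfile.polyKernel_le (hγ : IsKernelProfile γ) (hδ : 0 < δ) (x y : Plane) :
    polyKernel (cutProfile γ) δ P x y ≤ radialKernel γ δ (y - x) := by
  rw [polyKernel, ballKernel_cutProfile hδ]
  have h0 := hγ.radialKernel_nonneg δ (y - x)
  have h1 : ∀ S : Set Plane, S.indicator (1 : Plane → ℝ) y ≤ 1 := fun S =>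
    indicator_le_self' (fun _ _ => zero_le_one) _
  have := add_le_add (h1 ((P x).region x δ)) (h1 (dualRegion δ P x))
  nlinarith

/-- For points closer than δ, swapping them exchanges the two indicators; for others the radial
factor vanishes. -/
lemma polyKernel_symm (x y : Plane) :
    polyKernel (cutProfile γ) δ P x y = polyKernel (cutProfile γ) δ P y x := by
  have hJ : ballKernel (cutProfile γ) δ x y = ballKernel (cutProfile γ) δ y x := by
    rw [ballKernel, ballKernel, dist_comm]
  by_cases h : dist y x < δ
  · have h' : dist x y < δ := by rwa [dist_comm]
    rw [polyKernel, polyKernel, hJ, add_comm]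
    congr 2
    · by_cases hm : x ∈ (P y).region y δ
      · rw [indicator_of_mem ((mem_dualRegion_iff h).2 hm), indicator_of_mem hm]; rfl
      · rw [indicator_of_notMem (mt (mem_dualRegion_iff h).1 hm), indicator_of_notMem hm]
    · by_cases hm : y ∈ (P x).region x δ
      · rw [indicator_of_mem ((mem_dualRegion_iff h').2 hm), indicator_of_mem hm]; rfl
      · rw [indicator_of_notMem (mt (mem_dualRegion_iff h').1 hm), indicator_of_notMem hm]
  · have h0 : ballKernel (cutProfile γ) δ x y = 0 := by rw [ballKernel, if_neg h]
    rw [polyKernel, polyKernel, ← hJ, h0]; simp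

lemma polyKernel_eq_zero (hγ : IsKernelProfile γ) (hδ : 0 < δ) {x y : Plane} (h : δ ≤ dist y x) :
    polyKernel (cutProfile γ) δ P x y = 0 := by
  refine le_antisymm ((hγ.polyKernel_le hδ x y).trans_eq ?_) (hγ.polyKernel_nonneg hδ x y)
  exact radialKernel_eq_zero hδ (by rwa [← dist_eq_norm])

/-- When each point lies in the polygon of the other, both indicators are 1 and compensate the
factor ½. -/
lemma polyKernel_eq_radialKernel (hδ : 0 < δ) {x y : Plane} (hx : y ∈ (P x).region x δ)
    (hy : x ∈ (P y).region y δ) :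
    polyKernel (cutProfile γ) δ P x y = radialKernel γ δ (y - x) := by
  rw [polyKernel, ballKernel_cutProfile hδ]
  by_cases h : dist y x < δ
  · rw [indicator_of_mem hx, indicator_of_mem ((mem_dualRegion_iff h).2 hy)]
    simp only [Pi.one_apply]; ring
  · rw [radialKernel_eq_zero hδ (by rw [← dist_eq_norm]; exact not_lt.1 h)]
    ring

lemma IsKernelProfile.measurable_polyKernel (hγ : IsKernelProfile γ) (hδ : 0 < δ)
    (hP : MeasurableSet {p : Plane × Plane | p.2 ∈ (P p.1).region p.1 δ}) :
    Measurable (fun p : Plane × Plane => polyKernel (cutProfile γ) δ P p.1 p.2) := by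
  have hdual : MeasurableSet {p : Plane × Plane | p.2 ∈ dualRegion δ P p.1} := by
    have h1 : MeasurableSet {p : Plane × Plane | dist p.2 p.1 < δ} :=
      measurableSet_lt (measurable_snd.dist measurable_fst) measurable_const
    exact h1.inter (measurable_swap hP)
  simp only [polyKernel, ballKernel_cutProfile hδ]
  refine ((measurable_const.mul ((hγ.measurable_radialKernel δ).comp
    (measurable_snd.sub measurable_fst))).mul (Measurable.add ?_ ?_))
  · exact (measurable_const.indicator hP : Measurable
      ({p : Plane × Plane | p.2 ∈ (P p.1).region p.1 δ}.indicator (1 : Plane × Plane → ℝ)))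
  · exact (measurable_const.indicator hdual : Measurable
      ({p : Plane × Plane | p.2 ∈ dualRegion δ P p.1}.indicator (1 : Plane × Plane → ℝ)))

/-- The mass of the radial kernel for `δ = 1`. -/
def kernelMass (γ : ℝ → ℝ) : ℝ := 2 * Real.pi * ∫ s in Ioo (0 : ℝ) 1, s * γ s

/-- The mass is dominated by that of the radial kernel, which is finite because γ is integrable and
scales like δ⁻². -/
lemma IsKernelProfile.isEnergyKernel (hγ : IsKernelProfile γ) (hδ : 0 < δ)
    (hP : MeasurableSet {p : Plane × Plane | p.2 ∈ (P p.1).region p.1 δ}) (D : Set Plane) :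
    IsEnergyKernel (volume.restrict D) (polyKernel (cutProfile γ) δ P)
      (kernelMass γ / δ ^ 2) where
  measurable := hγ.measurable_polyKernel hδ hP
  nonneg := hγ.polyKernel_nonneg hδ
  symm := polyKernel_symm
  bound_nonneg := by
    rw [kernelMass, ← hγ.integral_radialKernel hδ]
    exact integral_nonneg (hγ.radialKernel_nonneg δ)
  mass_le x := by
    rw [kernelMass, ← hγ.integral_radialKernel hδ,
      ofReal_integral_eq_lintegral_ofReal (hγ.integrable_radialKernel hδ)
        (ae_of_all _ (hγ.radialKernel_nonneg δ)),
      ← lintegral_sub_right_eq_self (fun z => ENNReal.ofReal (radialKernel γ δ z)) x]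
    exact (setLIntegral_le_lintegral _ _).trans (lintegral_mono fun y =>
      ENNReal.ofReal_le_ofReal (hγ.polyKernel_le hδ x y))

end Kernel

/-! ### The nonlocal Poincaré inequality -/

section Poincare

variable {Ω : Set Plane} {v : Plane → ℝ} {R : ℝ}

/-- The `L²` norm of a function supported in `Ω` is controlled by that of its differences. -/
lemma norm_sq_mul_lintegral_sq_le (hR : 0 < R) (hΩ : ∀ x ∈ Ω, ∀ y ∈ Ω, dist x y < R)
    (hv : Measurable v) (hv0 : ∀ x ∉ Ω, v x = 0) {z : Plane} (hz : ‖z‖ ≤ R) :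
    ENNReal.ofReal (‖z‖ ^ 2) * ∫⁻ x, ENNReal.ofReal (v x ^ 2)
      ≤ ENNReal.ofReal (4 * R ^ 2) * ∫⁻ x, ENNReal.ofReal ((v (x + z) - v x) ^ 2) := by
  rcases eq_or_ne z 0 with rfl | hz0
  · simp
  have hzpos : 0 < ‖z‖ := norm_pos_iff.2 hz0
  -- After m steps of size z a point of Ω has left Ω, so v telescopes to 0 along the chain.
  -- Cauchy–Schwarz over the m differences and translation invariance give the factor m², and m‖z‖ ≤
  -- 2R.
  set m := ⌈R / ‖z‖⌉₊
  have hm1 : R ≤ m * ‖z‖ := (div_le_iff₀ hzpos).1 (Nat.le_ceil _)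
  have hm2 : m * ‖z‖ ≤ 2 * R := by
    have := (Nat.ceil_lt_add_one (div_nonneg hR.le hzpos.le)).le
    calc (m : ℝ) * ‖z‖ ≤ (R / ‖z‖ + 1) * ‖z‖ := mul_le_mul_of_nonneg_right this hzpos.le
      _ = R + ‖z‖ := by field_simp
      _ ≤ 2 * R := by linarith
  have hpt : ∀ x, v x ^ 2 ≤ m * ∑ j ∈ Finset.range m,
      (v (x + (j : ℝ) • z + z) - v (x + (j : ℝ) • z)) ^ 2 := by
    intro x
    by_cases hx : x ∈ Ω
    · have h0 : v (x + (m : ℝ) • z) = 0 := by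
        refine hv0 _ fun hmem => ?_
        have := hΩ _ hmem x hx
        rw [dist_eq_norm, add_sub_cancel_left, norm_smul, Real.norm_natCast] at this
        linarith
      have hsum : ∑ j ∈ Finset.range m, (v (x + (j : ℝ) • z + z) - v (x + (j : ℝ) • z))
          = -v x := by
        have := Finset.sum_range_sub (fun j : ℕ => v (x + (j : ℝ) • z)) m
        simp only [Nat.cast_zero, zero_smul, add_zero, h0, zero_sub] at this
        rw [← this]
        refine Finset.sum_congr rfl fun j _ => ?_
        push_cast
        rw [add_smul, one_smul, add_assoc]
      have := sq_sum_le_card_mul_sum_sq (s := Finset.range m)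
        (f := fun j : ℕ => v (x + (j : ℝ) • z + z) - v (x + (j : ℝ) • z))
      rw [hsum, Finset.card_range] at this
      simpa using this
    · rw [hv0 x hx]
      have : 0 ≤ ∑ j ∈ Finset.range m,
        (v (x + (j : ℝ) • z + z) - v (x + (j : ℝ) • z)) ^ 2 :=
        Finset.sum_nonneg fun _ _ => sq_nonneg _
      rw [zero_pow two_ne_zero]
      exact mul_nonneg (Nat.cast_nonneg m) this
  have hmeas : Measurable fun x => ENNReal.ofReal ((v (x + z) - v x) ^ 2) :=
    (((hv.comp (measurable_add_const z)).sub hv).pow_const 2).ennreal_ofReal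
  have hN : ∫⁻ x, ENNReal.ofReal (v x ^ 2)
      ≤ ENNReal.ofReal ((m : ℝ) ^ 2) * ∫⁻ x, ENNReal.ofReal ((v (x + z) - v x) ^ 2) := by
    calc ∫⁻ x, ENNReal.ofReal (v x ^ 2)
        ≤ ∫⁻ x, ENNReal.ofReal m * ∑ j ∈ Finset.range m,
          ENNReal.ofReal ((v (x + (j : ℝ) • z + z) - v (x + (j : ℝ) • z)) ^ 2) := by
          refine lintegral_mono fun x => ?_
          rw [← ENNReal.ofReal_sum_of_nonneg fun _ _ => sq_nonneg _,
            ← ENNReal.ofReal_mul (Nat.cast_nonneg m)]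
          exact ENNReal.ofReal_le_ofReal (hpt x)
      _ = ENNReal.ofReal m * ∑ j ∈ Finset.range m, ∫⁻ x,
          ENNReal.ofReal ((v (x + (j : ℝ) • z + z) - v (x + (j : ℝ) • z)) ^ 2) := by
          rw [lintegral_const_mul' _ _ ENNReal.ofReal_ne_top, lintegral_finsetSum]
          exact fun j _ => hmeas.comp (measurable_add_const _)
      _ = ENNReal.ofReal m * ∑ j ∈ Finset.range m, ∫⁻ x,
          ENNReal.ofReal ((v (x + z) - v x) ^ 2) := by
          congr 1
          refine Finset.sum_congr rfl fun j _ => ?_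
          exact lintegral_add_right_eq_self
            (fun x => ENNReal.ofReal ((v (x + z) - v x) ^ 2)) ((j : ℝ) • z)
      _ = _ := by
          rw [Finset.sum_const, Finset.card_range, nsmul_eq_mul, ← mul_assoc, sq,
            ENNReal.ofReal_mul (Nat.cast_nonneg m), ENNReal.ofReal_natCast]
  calc _ ≤ ENNReal.ofReal (‖z‖ ^ 2) * (ENNReal.ofReal ((m : ℝ) ^ 2) *
        ∫⁻ x, ENNReal.ofReal ((v (x + z) - v x) ^ 2)) := by gcongr
    _ = ENNReal.ofReal ((m * ‖z‖) ^ 2) * ∫⁻ x, ENNReal.ofReal ((v (x + z) - v x) ^ 2) := by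
        rw [← mul_assoc, ← ENNReal.ofReal_mul (sq_nonneg _)]; congr 2; ring
    _ ≤ _ := by
        gcongr
        calc (m * ‖z‖) ^ 2 ≤ (2 * R) ^ 2 := pow_le_pow_left₀ (by positivity) hm2 2
          _ = 4 * R ^ 2 := by ring

variable {γ : ℝ → ℝ} {δ A : ℝ} {k : Plane → Plane → ℝ}

/-- The translation estimate for each z is multiplied by the radial kernel and integrated over ‖z‖ <
δ/2, where the kernel `k` is exactly radial. Working in [0, ∞] lets Tonelli exchange the integrals
without integrability conditions. -/
lemma poincare_of_measurable (hΩp : IsPolygonalDomain Ω) (hR : 0 < R)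
    (hΩ : ∀ x ∈ Ω, ∀ y ∈ Ω, dist x y < R) (hγ : IsKernelProfile γ) (hδ : 0 < δ) (hδR : δ ≤ R)
    (hk : IsEnergyKernel (volume.restrict (hatDomain Ω δ)) k A)
    (hkJ : ∀ x ∈ hatDomain Ω δ, ∀ y ∈ hatDomain Ω δ, dist y x < δ / 2 →
      k x y = radialKernel γ δ (y - x))
    (hv : Measurable v) (hv2 : MemLp v 2 (volume.restrict (hatDomain Ω δ)))
    (hv0 : ∀ x ∉ Ω, v x = 0) :
    halfMoment γ * ∫ x in hatDomain Ω δ, v x ^ 2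
      ≤ 4 * R ^ 2 * energy (volume.restrict (hatDomain Ω δ)) k v v := by
  set H := hatDomain Ω δ
  have hH : MeasurableSet H := hΩp.isOpen_hatDomain.measurableSet
  set J := radialKernel γ δ
  have hJm : Measurable J := hγ.measurable_radialKernel δ
  have hJ0 : ∀ z, 0 ≤ J z := hγ.radialKernel_nonneg δ
  set N := ∫⁻ x, ENNReal.ofReal (v x ^ 2) with hNdef
  have hN : N = ENNReal.ofReal (∫ x in H, v x ^ 2) := by
    rw [ofReal_integral_eq_lintegral_ofReal hv2.integrable_sq (ae_of_all _ fun _ => sq_nonneg _),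
      ← lintegral_indicator hH]
    refine lintegral_congr fun x => ?_
    by_cases hx : x ∈ H
    · rw [indicator_of_mem hx]
    · rw [indicator_of_notMem hx, hv0 x fun h => hx (Or.inl h)]; simp
  have hE : ENNReal.ofReal (energy (volume.restrict H) k v v)
      = ∫⁻ x in H, ∫⁻ y in H, ENNReal.ofReal ((v y - v x) * (v y - v x) * k x y) := by
    rw [energy, ofReal_integral_eq_lintegral_ofReal (hk.integrable_energy hv2 hv2)
      (ae_of_all _ fun _ => mul_nonneg (mul_self_nonneg _) (hk.nonneg _ _)),
      lintegral_prod _ (hk.integrable_energy hv2 hv2).1.aemeasurable.ennreal_ofReal]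
  set B := Metric.ball (0 : Plane) (δ / 2)
  have hBm : MeasurableSet B := Metric.isOpen_ball.measurableSet
  let F : Plane → Plane → ENNReal := fun x z =>
    B.indicator (fun z => ENNReal.ofReal ((v (x + z) - v x) ^ 2 * J z)) z
  have hFm : Measurable (Function.uncurry F) := by
    have h1 : Measurable fun p : Plane × Plane =>
        ENNReal.ofReal ((v (p.1 + p.2) - v p.1) ^ 2 * J p.2) :=
      ((((hv.comp (measurable_fst.add measurable_snd)).sub (hv.comp measurable_fst)).pow_const
        2).mul (hJm.comp measurable_snd)).ennreal_ofReal
    exact (h1.indicator (measurable_snd hBm) : Measurable ((Prod.snd ⁻¹' B).indicator _))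
  have hFle : ∫⁻ x, ∫⁻ z, F x z ≤ ENNReal.ofReal (energy (volume.restrict H) k v v) := by
    rw [hE, ← lintegral_indicator hH]
    refine lintegral_mono fun x => ?_
    have hshift : ∫⁻ z, F x z = ∫⁻ y, F x (y - x) :=
      (lintegral_sub_right_eq_self (F x) x).symm
    simp only [hshift]
    have hFy : ∀ y, F x (y - x) = (Metric.ball x (δ / 2)).indicator
        (fun y => ENNReal.ofReal ((v y - v x) ^ 2 * J (y - x))) y := by
      intro y
      have : y - x ∈ B ↔ y ∈ Metric.ball x (δ / 2) := by
        rw [mem_ball_zero_iff, mem_ball_iff_norm]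
      by_cases h : y ∈ Metric.ball x (δ / 2)
      · simp only [F]
        rw [indicator_of_mem h, indicator_of_mem (this.2 h), add_sub_cancel]
      · simp only [F]
        rw [indicator_of_notMem h, indicator_of_notMem fun h' => h (this.1 h')]
    simp only [hFy]
    have hball : ∀ a ∈ Ω, ∀ b, dist b a < δ / 2 → b ∈ H := fun a ha b hb =>
      hΩp.ball_subset_hatDomain ha (Metric.mem_ball.2 (by linarith))
    by_cases hx : x ∈ H
    · rw [indicator_of_mem hx, ← lintegral_indicator hH]
      refine lintegral_mono fun y => ?_
      by_cases hy : y ∈ Metric.ball x (δ / 2)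
      · rw [indicator_of_mem hy]
        by_cases hyH : y ∈ H
        · rw [indicator_of_mem hyH, hkJ x hx y hyH hy, sq]
        -- A pair leaving the extended domain contributes nothing: its other point is too close to
        -- lie in Ω, so v vanishes at both.
        · have h1 : v y = 0 := hv0 y fun h => hyH (Or.inl h)
          have h2 : v x = 0 := hv0 x fun h => hyH (hball x h y hy)
          rw [h1, h2]; simp
      · rw [indicator_of_notMem hy]; exact zero_le
    · rw [indicator_of_notMem hx]
      refine le_of_eq (lintegral_eq_zero_of_ae_eq_zero (ae_of_all _ fun y => ?_))
      by_cases hy : y ∈ Metric.ball x (δ / 2)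
      · rw [indicator_of_mem hy]
        have h1 : v x = 0 := hv0 x fun h => hx (Or.inl h)
        have h2 : v y = 0 := hv0 y fun h => hx (hball y h x (by
          rw [dist_comm]; exact hy))
        rw [h1, h2]; simp
      · rw [indicator_of_notMem hy]; rfl
  have hFG : ENNReal.ofReal (halfMoment γ) * N
      ≤ ENNReal.ofReal (4 * R ^ 2) * ∫⁻ x, ∫⁻ z, F x z := by
    have hWm : Measurable fun z : Plane => ENNReal.ofReal (‖z‖ ^ 2 * radialKernel γ δ z) :=
      ((measurable_norm.pow_const 2).mul hJm).ennreal_ofReal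
    rw [lintegral_lintegral_swap hFm.aemeasurable, ← hγ.lintegral_halfMoment hδ,
      ← lintegral_mul_const _ hWm, ← lintegral_const_mul' _ _ ENNReal.ofReal_ne_top,
      ← lintegral_indicator hBm]
    refine lintegral_mono fun z => ?_
    by_cases hz : z ∈ B
    · rw [indicator_of_mem hz]
      have hzR : ‖z‖ ≤ R := by
        rw [mem_ball_zero_iff] at hz; linarith
      have h1 := norm_sq_mul_lintegral_sq_le hR hΩ hv hv0 hzR
      have h2 : ∫⁻ x, F x z = (∫⁻ x, ENNReal.ofReal ((v (x + z) - v x) ^ 2))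
          * ENNReal.ofReal (J z) := by
        rw [← lintegral_mul_const' _ _ ENNReal.ofReal_ne_top]
        refine lintegral_congr fun x => ?_
        simp only [F]
        rw [indicator_of_mem hz, ENNReal.ofReal_mul (sq_nonneg _)]
      rw [h2, ENNReal.ofReal_mul (sq_nonneg _), mul_right_comm, ← mul_assoc]
      exact mul_le_mul_left h1 _
    · rw [indicator_of_notMem hz]; exact zero_le
  have hfin := hFG.trans (mul_le_mul_right hFle _)
  have hE0 := hk.energy_self_nonneg v
  rw [hN, ← ENNReal.ofReal_mul hγ.halfMoment_pos.le, ← ENNReal.ofReal_mul (by positivity)] at hfin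
  exact (ENNReal.ofReal_le_ofReal_iff (by positivity)).1 hfin

/-- The nonlocal Poincaré inequality, with a constant independent of the horizon. -/
lemma poincare (hΩp : IsPolygonalDomain Ω) (hR : 0 < R)
    (hΩ : ∀ x ∈ Ω, ∀ y ∈ Ω, dist x y < R) (hγ : IsKernelProfile γ) (hδ : 0 < δ) (hδR : δ ≤ R)
    (hk : IsEnergyKernel (volume.restrict (hatDomain Ω δ)) k A)
    (hkJ : ∀ x ∈ hatDomain Ω δ, ∀ y ∈ hatDomain Ω δ, dist y x < δ / 2 →
      k x y = radialKernel γ δ (y - x))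
    (hv2 : MemLp v 2 (volume.restrict (hatDomain Ω δ))) (hv0 : ∀ x ∉ Ω, v x = 0) :
    halfMoment γ * ∫ x in hatDomain Ω δ, v x ^ 2
      ≤ 4 * R ^ 2 * energy (volume.restrict (hatDomain Ω δ)) k v v := by
  -- Cutting the measurable representative to Ω makes it vanish everywhere outside Ω, including off
  -- the extended domain.
  have hae : v =ᵐ[volume.restrict (hatDomain Ω δ)] Ω.indicator (hv2.1.mk v) := by
    filter_upwards [hv2.1.ae_eq_mk] with x hx
    by_cases h : x ∈ Ω
    · rw [indicator_of_mem h, hx]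
    · rw [indicator_of_notMem h, hv0 x h]
  have hm : Measurable (Ω.indicator (hv2.1.mk v)) :=
    hv2.1.stronglyMeasurable_mk.measurable.indicator hΩp.isOpen.measurableSet
  have := poincare_of_measurable hΩp hR hΩ hγ hδ hδR hk hkJ hm ((memLp_congr_ae hae).1 hv2)
    (fun x hx => indicator_of_notMem hx _)
  rw [energy_congr_ae hae hae]
  refine le_of_eq_of_le ?_ this
  congr 1
  exact integral_congr_ae (hae.mono fun x hx => by simp only [hx])

end Poincare

/-! ### Energy estimates for a fixed horizon -/

section EnergyAlgebra

variable {X : Type*} [MeasurableSpace X] {ν : Measure X} [SFinite ν] {k : X → X → ℝ} {A : ℝ}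

lemma energy_neg_self (ν : Measure X) (k : X → X → ℝ) (u : X → ℝ) :
    energy ν k (-u) (-u) = energy ν k u u := by
  refine integral_congr_ae (ae_of_all _ fun p => ?_)
  simp only [Pi.neg_apply]; ring

lemma IsEnergyKernel.energy_sub_left (hk : IsEnergyKernel ν k A) {u v w : X → ℝ}
    (hu : MemLp u 2 ν) (hv : MemLp v 2 ν) (hw : MemLp w 2 ν) :
    energy ν k (u - v) w = energy ν k u w - energy ν k v w := by
  unfold energy
  rw [← integral_sub (hk.integrable_energy hu hw) (hk.integrable_energy hv hw)]
  refine integral_congr_ae (ae_of_all _ fun p => ?_)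
  simp only [Pi.sub_apply]; ring

lemma IsEnergyKernel.integrable_section_ae [IsFiniteMeasure ν] (hk : IsEnergyKernel ν k A)
    {u : X → ℝ} (hu : MemLp u 2 ν) :
    ∀ᵐ x ∂ν, Integrable (fun y => (u y - u x) * k x y) ν := by
  have := (hk.integrable_fst_mul_diff hu (memLp_const (1 : ℝ))).prod_right_ae
  simpa using this

end EnergyAlgebra

section

variable {Ω : Set Plane} (hΩ : IsPolygonalDomain Ω) {δ : ℝ} {k : Plane → Plane → ℝ} {A : ℝ}

lemma setIntegral_indicator_sq {S H : Set Plane} (hS : MeasurableSet S) (hSH : S ⊆ H)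
    (e : Plane → ℝ) : ∫ x in H, S.indicator e x ^ 2 = ∫ x in S, e x ^ 2 := by
  have : (fun x => S.indicator e x ^ 2) = S.indicator (fun x => e x ^ 2) := by
    funext x
    by_cases hx : x ∈ S
    · rw [indicator_of_mem hx, indicator_of_mem hx]
    · rw [indicator_of_notMem hx, indicator_of_notMem hx, zero_pow two_ne_zero]
  rw [this, setIntegral_indicator hS, inter_eq_right.2 hSH]

lemma subset_hatDomain (Ω : Set Plane) (δ : ℝ) : Ω ⊆ hatDomain Ω δ := subset_union_left

lemma collar_subset_hatDomain (Ω : Set Plane) (δ : ℝ) : collar Ω δ ⊆ hatDomain Ω δ :=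
  subset_union_right

lemma disjoint_collar (Ω : Set Plane) (δ : ℝ) : Disjoint Ω (collar Ω δ) :=
  Set.disjoint_left.2 fun _ hx hc => hc.1 hx

include hΩ

lemma IsPolygonalDomain.isFiniteMeasure_hatDomain :
    IsFiniteMeasure (volume.restrict (hatDomain Ω δ)) :=
  isFiniteMeasure_restrict.2 hΩ.isBounded_hatDomain.measure_lt_top.ne

/-- For x ∈ Ω the kernel lives in the δ-ball, which stays in the extended domain. -/
lemma nonlocalOp_eq_setIntegral (hsupp : ∀ x y, δ ≤ dist y x → k x y = 0) (e : Plane → ℝ)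
    {x : Plane} (hx : x ∈ Ω) :
    nonlocalOp k e x = 2 * ∫ y in hatDomain Ω δ, (e y - e x) * k x y := by
  rw [nonlocalOp, setIntegral_eq_integral_of_forall_compl_eq_zero]
  intro y hy
  rw [hsupp x y, mul_zero]
  by_contra h
  exact hy (hΩ.ball_subset_hatDomain hx (Metric.mem_ball.2 (not_le.1 h)))

lemma setIntegral_mul_eq (e : Plane → ℝ) {w : Plane → ℝ} (hw0 : ∀ x ∉ Ω, w x = 0) :
    ∫ x in hatDomain Ω δ, w x * ∫ y in hatDomain Ω δ, (e y - e x) * k x y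
      = ∫ x in Ω, w x * ∫ y in hatDomain Ω δ, (e y - e x) * k x y :=
  setIntegral_eq_of_subset_of_forall_sdiff_eq_zero hΩ.isOpen_hatDomain.measurableSet
    (subset_hatDomain Ω δ) fun x hx => by rw [hw0 x hx.2, zero_mul]

variable (hk : IsEnergyKernel (volume.restrict (hatDomain Ω δ)) k A)
  (hsupp : ∀ x y, δ ≤ dist y x → k x y = 0)
include hk

include hsupp in
/-- Nonlocal integration by parts against functions supported in `Ω`. -/
lemma energy_eq_neg_integral {e w : Plane → ℝ}
    (he : MemLp e 2 (volume.restrict (hatDomain Ω δ)))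
    (hw : MemLp w 2 (volume.restrict (hatDomain Ω δ))) (hw0 : ∀ x ∉ Ω, w x = 0) :
    energy (volume.restrict (hatDomain Ω δ)) k e w = -∫ x in Ω, w x * nonlocalOp k e x := by
  rw [hk.energy_eq_neg_two_mul he hw, setIntegral_mul_eq hΩ e hw0]
  have : ∫ x in Ω, w x * nonlocalOp k e x
      = ∫ x in Ω, 2 * (w x * ∫ y in hatDomain Ω δ, (e y - e x) * k x y) := by
    refine setIntegral_congr_fun hΩ.isOpen.measurableSet fun x hx => ?_
    rw [nonlocalOp_eq_setIntegral hΩ hsupp e hx]; ring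
  rw [this, integral_const_mul]; ring

/-- The energy form split into the contributions of `Ω` and of the collar. -/
lemma energy_eq_split {e w : Plane → ℝ}
    (he : MemLp e 2 (volume.restrict (hatDomain Ω δ)))
    (hw : MemLp w 2 (volume.restrict (hatDomain Ω δ))) (hw0 : ∀ x ∉ Ω, w x = 0) :
    energy (volume.restrict (hatDomain Ω δ)) k e w
      = -2 * (∫ x in Ω, w x * ∫ y in Ω, (e y - e x) * k x y)
        - 2 * ∫ x in Ω, w x * ∫ y in collar Ω δ, (e y - e x) * k x y := by
  have hfin := hΩ.isFiniteMeasure_hatDomain (δ := δ)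
  have hsub := subset_hatDomain Ω δ
  have hint : ∀ S ⊆ hatDomain Ω δ,
      IntegrableOn (fun x => w x * ∫ y in S, (e y - e x) * k x y) Ω := by
    intro S hS
    have h1 := (hk.integrable_fst_mul_diff he hw).mono_measure
      (Measure.prod_mono (le_refl (volume.restrict (hatDomain Ω δ)))
        (Measure.restrict_mono hS (le_refl volume)))
    have h2 := h1.integral_prod_left
    have h3 : Integrable (fun x => w x * ∫ y in S, (e y - e x) * k x y)
        (volume.restrict (hatDomain Ω δ)) := by
      refine h2.congr (ae_of_all _ fun x => ?_)
      simp only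
      rw [← integral_const_mul]
      exact integral_congr_ae (ae_of_all _ fun y => by simp only; ring)
    exact h3.mono_measure (Measure.restrict_mono hsub (le_refl volume))
  rw [hk.energy_eq_neg_two_mul he hw, setIntegral_mul_eq hΩ e hw0]
  have hsec : ∀ᵐ x ∂(volume.restrict Ω), IntegrableOn (fun y => (e y - e x) * k x y)
      (hatDomain Ω δ) :=
    ae_mono (Measure.restrict_mono hsub (le_refl volume)) (hk.integrable_section_ae he)
  have : ∫ x in Ω, w x * ∫ y in hatDomain Ω δ, (e y - e x) * k x y
      = ∫ x in Ω, (w x * (∫ y in Ω, (e y - e x) * k x y)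
        + w x * ∫ y in collar Ω δ, (e y - e x) * k x y) := by
    refine integral_congr_ae ?_
    filter_upwards [hsec] with x hx
    rw [← mul_add]
    congr 1
    exact setIntegral_union (disjoint_collar Ω δ) hΩ.measurableSet_collar (hx.mono_set hsub)
      (hx.mono_set (collar_subset_hatDomain Ω δ))
  rw [this, integral_add (hint _ hsub) (hint _ (collar_subset_hatDomain Ω δ))]
  ring

include hsupp in
lemma nonlocalOp_sub_ae {u v : Plane → ℝ}
    (hu : MemLp u 2 (volume.restrict (hatDomain Ω δ)))
    (hv : MemLp v 2 (volume.restrict (hatDomain Ω δ))) :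
    ∀ᵐ x ∂(volume.restrict Ω),
      nonlocalOp k (u - v) x = nonlocalOp k u x - nonlocalOp k v x := by
  have hfin := hΩ.isFiniteMeasure_hatDomain (δ := δ)
  have hmono := Measure.restrict_mono (subset_hatDomain Ω δ) (le_refl volume)
  filter_upwards [ae_mono hmono (hk.integrable_section_ae hu),
    ae_mono hmono (hk.integrable_section_ae hv),
    ae_restrict_mem hΩ.isOpen.measurableSet] with x h1 h2 hx
  rw [nonlocalOp_eq_setIntegral hΩ hsupp _ hx, nonlocalOp_eq_setIntegral hΩ hsupp _ hx,
    nonlocalOp_eq_setIntegral hΩ hsupp _ hx, ← mul_sub, ← integral_sub h1 h2]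
  congr 1
  refine integral_congr_ae (ae_of_all _ fun y => ?_)
  simp only [Pi.sub_apply]; ring

omit hΩ hk in
lemma indicator_add_indicator_ae (hΩ : IsPolygonalDomain Ω) (e : Plane → ℝ) :
    e =ᵐ[volume.restrict (hatDomain Ω δ)] Ω.indicator e + (collar Ω δ).indicator e := by
  refine ae_restrict_of_forall_mem hΩ.isOpen_hatDomain.measurableSet fun x hx => ?_
  rw [Pi.add_apply]
  rcases hx with hx | hx
  · rw [indicator_of_mem hx, indicator_of_notMem fun h => h.1 hx, add_zero]
  · rw [indicator_of_mem hx, indicator_of_notMem hx.1, zero_add]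

/-- The energy of a function living on the collar. -/
lemma energy_collar_le {e : Plane → ℝ} (he : MemLp e 2 (volume.restrict (hatDomain Ω δ)))
    {ε V : ℝ} (hε : ∀ᵐ x ∂(volume.restrict (collar Ω δ)), |e x| ≤ ε)
    (hV : volume.real (collar Ω δ) ≤ V) :
    energy (volume.restrict (hatDomain Ω δ)) k ((collar Ω δ).indicator e)
      ((collar Ω δ).indicator e) ≤ 4 * A * (ε ^ 2 * V) := by
  have hcm := hΩ.measurableSet_collar (δ := δ)
  have hcsub := collar_subset_hatDomain Ω δ
  refine (hk.energy_self_le (he.indicator hcm)).trans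
    (mul_le_mul_of_nonneg_left ?_ (by linarith [hk.bound_nonneg]))
  have h1 : ∫ x in hatDomain Ω δ, (collar Ω δ).indicator e x ^ 2 = ∫ x in collar Ω δ, e x ^ 2 :=
    setIntegral_indicator_sq hcm hcsub e
  have hfin : volume (collar Ω δ) ≠ ⊤ :=
    (hΩ.isBounded_hatDomain.subset hcsub).measure_lt_top.ne
  have h2 : ∫ x in collar Ω δ, e x ^ 2 ≤ ∫ _ in collar Ω δ, ε ^ 2 := by
    refine integral_mono_ae
      (he.integrable_sq.mono_measure (Measure.restrict_mono hcsub (le_refl volume)))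
      (integrableOn_const hfin) ?_
    filter_upwards [hε] with x hx
    rw [← sq_abs (e x)]
    exact pow_le_pow_left₀ (abs_nonneg _) hx 2
  rw [h1]
  refine h2.trans ?_
  rw [setIntegral_const, smul_eq_mul, mul_comm]
  exact mul_le_mul_of_nonneg_left hV (sq_nonneg _)

variable {Cp : ℝ} (hCp : 0 < Cp)
  (hpoinc : ∀ v : Plane → ℝ, MemLp v 2 (volume.restrict (hatDomain Ω δ)) → (∀ x ∉ Ω, v x = 0) →
    ∫ x in hatDomain Ω δ, v x ^ 2 ≤ Cp * energy (volume.restrict (hatDomain Ω δ)) k v v)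
include hCp hpoinc

/-- The `L²(Ω)` norm is controlled by the energy and the values on the collar. -/
lemma integral_sq_le_energy {e : Plane → ℝ} (he : MemLp e 2 (volume.restrict (hatDomain Ω δ))) :
    ∫ x in Ω, e x ^ 2 ≤ Cp * (2 * energy (volume.restrict (hatDomain Ω δ)) k e e
      + 2 * energy (volume.restrict (hatDomain Ω δ)) k ((collar Ω δ).indicator e)
        ((collar Ω δ).indicator e)) := by
  have hΩm := hΩ.isOpen.measurableSet
  have he0 := he.indicator (s := Ω) hΩm
  have hec := he.indicator (s := collar Ω δ) hΩ.measurableSet_collar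
  have h1 : ∫ x in hatDomain Ω δ, Ω.indicator e x ^ 2 = ∫ x in Ω, e x ^ 2 :=
    setIntegral_indicator_sq hΩm (subset_hatDomain Ω δ) e
  rw [← h1]
  refine (hpoinc _ he0 fun x hx => indicator_of_notMem hx _).trans
    (mul_le_mul_of_nonneg_left ?_ hCp.le)
  have h2 : Ω.indicator e =ᵐ[volume.restrict (hatDomain Ω δ)]
      e + -((collar Ω δ).indicator e) := by
    filter_upwards [indicator_add_indicator_ae (δ := δ) hΩ e] with x hx
    rw [Pi.add_apply] at hx
    rw [Pi.add_apply, Pi.neg_apply]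
    linarith
  rw [energy_congr_ae h2 h2, ← energy_neg_self _ k ((collar Ω δ).indicator e)]
  exact hk.energy_add_le he hec.neg

include hsupp

/-- The energy estimate for the nonlocal problem with inhomogeneous volume constraints. -/
lemma energy_le_of_residual {e : Plane → ℝ}
    (he : MemLp e 2 (volume.restrict (hatDomain Ω δ))) {τ : ℝ}
    (hτ : ∀ᵐ x ∂(volume.restrict Ω), |nonlocalOp k e x| ≤ τ) :
    energy (volume.restrict (hatDomain Ω δ)) k e e ≤ 4 * Cp * (τ ^ 2 * volume.real Ω)
      + 3 * energy (volume.restrict (hatDomain Ω δ)) k ((collar Ω δ).indicator e)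
        ((collar Ω δ).indicator e) := by
  have hΩm := hΩ.isOpen.measurableSet
  have he0 := he.indicator (s := Ω) hΩm
  have hec := he.indicator (s := collar Ω δ) hΩ.measurableSet_collar
  set ν := volume.restrict (hatDomain Ω δ)
  set ec := (collar Ω δ).indicator e
  have h1 : energy ν k e e = energy ν k e (Ω.indicator e) + energy ν k e ec := by
    rw [← hk.energy_add_right he he0 hec]
    exact energy_congr_ae (ae_eq_refl e) (indicator_add_indicator_ae hΩ e)
  -- Weight 1/4, so that a quarter of the energy goes to the right; the term in Ω uses up another
  -- quarter.
  have h2 := hk.energy_le_half_add he hec (s := 1 / 4) (by norm_num)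
  have h3 := integral_sq_le_energy hΩ hk hCp hpoinc he
  have h4 : energy ν k e (Ω.indicator e)
      ≤ 1 / (8 * Cp) * (∫ x in Ω, e x ^ 2) + 2 * Cp * (τ ^ 2 * volume.real Ω) := by
    rw [energy_eq_neg_integral hΩ hk hsupp he he0 fun x hx => indicator_of_notMem hx _,
      ← integral_neg]
    have hfin : volume Ω ≠ ⊤ := hΩ.isBounded.measure_lt_top.ne
    have hi1 : IntegrableOn (fun x => e x ^ 2) Ω := he.integrable_sq.mono_measure
      (Measure.restrict_mono (subset_hatDomain Ω δ) (le_refl volume))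
    have hi2 : IntegrableOn (fun _ : Plane => 2 * Cp * τ ^ 2) Ω := integrableOn_const hfin
    have hrhs : 1 / (8 * Cp) * (∫ x in Ω, e x ^ 2) + 2 * Cp * (τ ^ 2 * volume.real Ω)
        = ∫ x in Ω, (1 / (8 * Cp) * e x ^ 2 + 2 * Cp * τ ^ 2) := by
      rw [integral_add (hi1.const_mul _) hi2, integral_const_mul, setIntegral_const, smul_eq_mul]
      ring
    rw [hrhs]
    refine (le_abs_self _).trans ?_
    rw [← Real.norm_eq_abs]
    refine norm_integral_le_of_norm_le ((hi1.const_mul _).add hi2) ?_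
    filter_upwards [hτ, ae_restrict_mem hΩm] with x hx hxΩ
    rw [norm_neg, norm_mul, Real.norm_eq_abs, Real.norm_eq_abs, indicator_of_mem hxΩ,
      ← sq_abs (e x)]
    -- Young's inequality, with the weight 1/(8Cp) matched to the factor 2Cp of the Poincaré bound.
    have h7 : 1 / (8 * Cp) * |e x| ^ 2 + 2 * Cp * τ ^ 2 - |e x| * τ
        = 1 / (8 * Cp) * (|e x| - 4 * Cp * τ) ^ 2 := by
      field_simp; ring
    have h8 : 0 ≤ 1 / (8 * Cp) * (|e x| - 4 * Cp * τ) ^ 2 := by positivity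
    have h9 := mul_le_mul_of_nonneg_left hx (abs_nonneg (e x))
    linarith
  have h5 : 1 / (8 * Cp) * (∫ x in Ω, e x ^ 2)
      ≤ 1 / 4 * energy ν k e e + 1 / 4 * energy ν k ec ec := by
    calc 1 / (8 * Cp) * (∫ x in Ω, e x ^ 2)
        ≤ 1 / (8 * Cp) * (Cp * (2 * energy ν k e e + 2 * energy ν k ec ec)) :=
          mul_le_mul_of_nonneg_left h3 (by positivity)
      _ = _ := by field_simp; ring
  -- Half of the energy is absorbed on the left; doubling leaves 4Cp τ²|Ω| and 5/2 ≤ 3 times the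
  -- collar energy.
  have h6 := hk.energy_self_nonneg ec
  norm_num at h2
  linarith

end

/-! ### The discrete problem -/

lemma cdgSpace_sub {D : Set Plane} {T : Set (Finset Plane)} {v w : Plane → ℝ}
    (hv : v ∈ cdgSpace D T) (hw : w ∈ cdgSpace D T) : v - w ∈ cdgSpace D T := by
  obtain ⟨v', hv', rfl⟩ := hv
  obtain ⟨w', hw', rfl⟩ := hw
  refine ⟨v' - w', fun t ht => ?_, (indicator_sub' D v' w').symm⟩
  obtain ⟨A, hA⟩ := hv' t ht
  obtain ⟨B, hB⟩ := hw' t ht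
  exact ⟨A - B, fun x hx => by simp [hA hx, hB hx]⟩

lemma eq_zero_of_mem_cdgSpace {D : Set Plane} {T : Set (Finset Plane)} {w : Plane → ℝ}
    (hw : w ∈ cdgSpace D T) {x : Plane} (hx : x ∉ D) : w x = 0 := by
  obtain ⟨w', -, rfl⟩ := hw
  exact indicator_of_notMem hx _

lemma memLp_of_mem_cdgSpace {ν : Measure Plane} [IsFiniteMeasure ν] {D : Set Plane}
    (hD : MeasurableSet D) {T : Set (Finset Plane)} (hT : T.Finite) (hDT : D ⊆ meshDomain T)
    {w : Plane → ℝ} (hw : w ∈ cdgSpace D T) : MemLp w 2 ν := by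
  obtain ⟨hm, B, hB⟩ := measurable_and_bounded_of_mem_cdgSpace hD hT hDT hw
  exact MemLp.of_bound hm.aestronglyMeasurable B (ae_of_all _ hB)

section Galerkin

variable {Ω : Set Plane} (hΩ : IsPolygonalDomain Ω) {γ : ℝ → ℝ} (hγ : IsKernelProfile γ)
  {δ h ρ : ℝ} (hδ : 0 < δ) {P : Plane → InscribedPolygon}
  (hPm : MeasurableSet {p : Plane × Plane | p.2 ∈ (P p.1).region p.1 δ})
  {T Tc : Set (Finset Plane)} (hT : IsCdgMesh Ω δ h ρ T Tc)
  {f g u gh uh : Plane → ℝ}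
include hΩ hγ hδ hPm hT

/-- The collar integral of the discrete equation is the collar part of the energy form of uh, so the
method is a Galerkin method for the same form and right-hand side as the nonlocal problem. -/
lemma IsCdgSolution.exists_energy_eq (hgh : gh ∈ cdgSpace (collar Ω δ) Tc)
    (huh : IsCdgSolution Ω δ (polyKernel γ δ P) T f gh uh) :
    MemLp uh 2 (volume.restrict (hatDomain Ω δ)) ∧ ∃ u0h ∈ cdgSpace Ω T, uh = u0h + gh ∧
      ∀ w ∈ cdgSpace Ω T, energy (volume.restrict (hatDomain Ω δ))
        (polyKernel (cutProfile γ) δ P) uh w = ∫ x in Ω, f x * w x := by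
  have hfin := hΩ.isFiniteMeasure_hatDomain (δ := δ)
  have hk := hγ.isEnergyKernel hδ hPm (hatDomain Ω δ)
  have hΩm := hΩ.isOpen.measurableSet
  have hΩT : Ω ⊆ meshDomain T := hT.inner_domain ▸ subset_closure
  obtain ⟨u0h, hu0h, rfl, heq⟩ := huh
  have hmem : MemLp (u0h + gh) 2 (volume.restrict (hatDomain Ω δ)) :=
    (memLp_of_mem_cdgSpace hΩm hT.inner.finite hΩT hu0h).add
      (memLp_of_mem_cdgSpace hΩ.measurableSet_collar hT.outer.finite hT.outer_cover hgh)
  refine ⟨hmem, u0h, hu0h, rfl, fun w hw => ?_⟩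
  have hval : ∀ x ∈ Ω, (u0h + gh) x = u0h x := fun x hx => by
    rw [Pi.add_apply, eq_zero_of_mem_cdgSpace hgh fun h => h.1 hx, add_zero]
  have hvalc : ∀ x ∈ collar Ω δ, (u0h + gh) x = gh x := fun x hx => by
    rw [Pi.add_apply, eq_zero_of_mem_cdgSpace hu0h hx.1, zero_add]
  rw [energy_eq_split hΩ hk hmem (memLp_of_mem_cdgSpace hΩm hT.inner.finite hΩT hw)
    fun x hx => eq_zero_of_mem_cdgSpace hw hx]
  have e1 : ∫ x in Ω, w x * ∫ y in Ω, ((u0h + gh) y - (u0h + gh) x)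
        * polyKernel (cutProfile γ) δ P x y
      = ∫ x in Ω, w x * ∫ y in Ω, (u0h y - u0h x) * polyKernel γ δ P x y := by
    refine setIntegral_congr_fun hΩm fun x hx => ?_
    refine congrArg (w x * ·) (setIntegral_congr_fun hΩm fun y hy => ?_)
    rw [← diff_mul_polyKernel_cutProfile (γ := γ) hδ, ← hval x hx, ← hval y hy]
  have e2 : ∫ x in Ω, w x * ∫ y in collar Ω δ, ((u0h + gh) y - (u0h + gh) x)
        * polyKernel (cutProfile γ) δ P x y
      = ∫ x in Ω, w x * ∫ y in collar Ω δ, (gh y - u0h x) * polyKernel γ δ P x y := by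
    refine setIntegral_congr_fun hΩm fun x hx => ?_
    refine congrArg (w x * ·) (setIntegral_congr_fun hΩ.measurableSet_collar fun y hy => ?_)
    have hyx : y ≠ x := fun h => hy.1 (h ▸ hx)
    rw [← polyKernel_cutProfile (γ := γ) hδ hyx, ← hval x hx, ← hvalc y hy]
  rw [e1, e2, heq w hw]
  ring

omit hT in
lemma IsNonlocalSolution.energy_eq
    (hu : IsNonlocalSolution Ω δ (polyKernel γ δ P) f g u) {w : Plane → ℝ}
    (hw : MemLp w 2 (volume.restrict (hatDomain Ω δ))) (hw0 : ∀ x ∉ Ω, w x = 0) :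
    energy (volume.restrict (hatDomain Ω δ)) (polyKernel (cutProfile γ) δ P) u w
      = ∫ x in Ω, f x * w x := by
  have hk := hγ.isEnergyKernel hδ hPm (hatDomain Ω δ)
  rw [energy_eq_neg_integral hΩ hk (fun x y h => polyKernel_eq_zero hγ hδ h) hu.memLp hw hw0,
    nonlocalOp_cutProfile hδ, ← integral_neg]
  refine integral_congr_ae ?_
  filter_upwards [hu.equation] with x hx
  rw [← hx]; ring

/-- Céa's lemma: the CDG solution is optimal in the energy norm. -/
lemma energy_error_le (hgh : gh ∈ cdgSpace (collar Ω δ) Tc)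
    (hu : IsNonlocalSolution Ω δ (polyKernel γ δ P) f g u)
    (huh : IsCdgSolution Ω δ (polyKernel γ δ P) T f gh uh) {v : Plane → ℝ}
    (hv : v ∈ cdgSpace Ω T) :
    energy (volume.restrict (hatDomain Ω δ)) (polyKernel (cutProfile γ) δ P) (u - uh) (u - uh)
      ≤ energy (volume.restrict (hatDomain Ω δ)) (polyKernel (cutProfile γ) δ P)
        (u - (v + gh)) (u - (v + gh)) := by
  have hfin := hΩ.isFiniteMeasure_hatDomain (δ := δ)
  have hk := hγ.isEnergyKernel hδ hPm (hatDomain Ω δ)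
  have hΩm := hΩ.isOpen.measurableSet
  have hΩT : Ω ⊆ meshDomain T := hT.inner_domain ▸ subset_closure
  obtain ⟨huhm, u0h, hu0h, hdec, hgal⟩ := huh.exists_energy_eq hΩ hγ hδ hPm hT hgh
  have hghm : MemLp gh 2 (volume.restrict (hatDomain Ω δ)) :=
    memLp_of_mem_cdgSpace hΩ.measurableSet_collar hT.outer.finite hT.outer_cover hgh
  have hmem : ∀ w ∈ cdgSpace Ω T, MemLp w 2 (volume.restrict (hatDomain Ω δ)) := fun w hw =>
    memLp_of_mem_cdgSpace hΩm hT.inner.finite hΩT hw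
  have hw := cdgSpace_sub hv hu0h
  have he : MemLp (u - uh) 2 (volume.restrict (hatDomain Ω δ)) := hu.memLp.sub huhm
  have he' : MemLp (u - (v + gh)) 2 (volume.restrict (hatDomain Ω δ)) :=
    hu.memLp.sub ((hmem v hv).add hghm)
  have horth : energy (volume.restrict (hatDomain Ω δ)) (polyKernel (cutProfile γ) δ P)
      (u - uh) (v - u0h) = 0 := by
    rw [hk.energy_sub_left hu.memLp huhm (hmem _ hw), hgal _ hw,
      hu.energy_eq hΩ hγ hδ hPm (hmem _ hw) fun x hx => eq_zero_of_mem_cdgSpace hw hx, sub_self]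
  -- The boundary part `gh` cancels, so the correction is an admissible test function and drops out
  -- by orthogonality.
  have hsplit : u - uh = (u - (v + gh)) + (v - u0h) := by
    rw [hdec]; abel
  have h1 := hk.energy_add_right he he' (hmem _ hw)
  rw [← hsplit, horth, add_zero] at h1
  -- Both weights are then 1/2, so Céa's lemma holds with constant 1.
  have h2 := hk.energy_le_half_add he he' (s := 1 / 2) (by norm_num)
  norm_num at h2
  linarith

end Galerkin

/-- A bound of the energy by the suprema over `Ω` and over the collar. -/
lemma energy_le_of_bounds {Ω : Set Plane} (hΩ : IsPolygonalDomain Ω) {δ : ℝ}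
    {k : Plane → Plane → ℝ} {A : ℝ}
    (hk : IsEnergyKernel (volume.restrict (hatDomain Ω δ)) k A) {e : Plane → ℝ}
    (he : MemLp e 2 (volume.restrict (hatDomain Ω δ))) {α β V : ℝ}
    (hα : ∀ x ∈ Ω, |e x| ≤ α) (hβ : ∀ x ∈ collar Ω δ, |e x| ≤ β)
    (hV : volume.real (collar Ω δ) ≤ V) :
    energy (volume.restrict (hatDomain Ω δ)) k e e
      ≤ 4 * A * (α ^ 2 * volume.real Ω + β ^ 2 * V) := by
  have hΩm := hΩ.isOpen.measurableSet
  have hcm := hΩ.measurableSet_collar (δ := δ)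
  have hsq : IntegrableOn (fun x => e x ^ 2) (hatDomain Ω δ) := he.integrable_sq
  refine (hk.energy_self_le he).trans
    (mul_le_mul_of_nonneg_left ?_ (by linarith [hk.bound_nonneg]))
  have hpart : ∀ S : Set Plane, MeasurableSet S → S ⊆ hatDomain Ω δ → ∀ c : ℝ,
      (∀ x ∈ S, |e x| ≤ c) → ∫ x in S, e x ^ 2 ≤ c ^ 2 * volume.real S := by
    intro S hS hSH c hc
    have hfin : volume S ≠ ⊤ := (hΩ.isBounded_hatDomain.subset hSH).measure_lt_top.ne
    have : ∫ x in S, e x ^ 2 ≤ ∫ _ in S, c ^ 2 := by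
      refine setIntegral_mono_on (hsq.mono_set hSH) (integrableOn_const hfin) hS fun x hx => ?_
      rw [← sq_abs (e x)]
      exact pow_le_pow_left₀ (abs_nonneg _) (hc x hx) 2
    rwa [setIntegral_const, smul_eq_mul, mul_comm] at this
  have hun : ∫ x in hatDomain Ω δ, e x ^ 2
      = (∫ x in Ω, e x ^ 2) + ∫ x in collar Ω δ, e x ^ 2 :=
    setIntegral_union (disjoint_collar Ω δ) hcm (hsq.mono_set (subset_hatDomain Ω δ))
      (hsq.mono_set (collar_subset_hatDomain Ω δ))
  rw [hun]
  refine add_le_add (hpart Ω hΩm (subset_hatDomain Ω δ) α hα)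
    ((hpart _ hcm (collar_subset_hatDomain Ω δ) β hβ).trans ?_)
  exact mul_le_mul_of_nonneg_left hV (sq_nonneg _)

/-! ### Interpolation on the meshes -/

section Interpolation

variable {Ω : Set Plane} (hΩ : IsPolygonalDomain Ω) {δ₀ δ h ρ M : ℝ} {U : Plane → ℝ}
  {T Tc : Set (Finset Plane)}

include hΩ in
lemma exists_inner_interpolant (hδ₀ : 0 < δ₀) (hU : HasDerivBound (hatDomain Ω δ₀) U M)
    (hT : IsCdgMesh Ω δ h ρ T Tc) :
    ∃ v ∈ cdgSpace Ω T, ∀ x ∈ Ω, |U x - v x| ≤ M * h ^ 2 := by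
  obtain ⟨v, hv, hA⟩ := hT.inner.exists_interpolant U
  refine ⟨Ω.indicator v, ⟨v, hv, rfl⟩, fun x hx => ?_⟩
  rw [indicator_of_mem hx]
  have hxT : x ∈ meshDomain T := hT.inner_domain ▸ subset_closure hx
  obtain ⟨t, ht, hxt⟩ := mem_iUnion₂.1 hxT
  obtain ⟨A, hvA, hAp⟩ := hA t ht
  rw [hvA hxt]
  refine hU.abs_interpolant_sub_le ?_ (hT.inner_quasiUniform t ht).1 hAp hxt
  exact (convexHull_subset_meshDomain ht).trans
    (hT.inner_domain.subset.trans (hΩ.closure_subset_hatDomain hδ₀))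

lemma exists_outer_interpolant (hhδ : h < δ) (hδδ₀ : 2 * δ ≤ δ₀)
    (hU : HasDerivBound (hatDomain Ω δ₀) U M) (hT : IsCdgMesh Ω δ h ρ T Tc) :
    ∃ v ∈ cdgSpace (collar Ω δ) Tc, ∀ x ∈ collar Ω δ, |U x - v x| ≤ M * h ^ 2 := by
  obtain ⟨v, hv, hA⟩ := hT.outer.exists_interpolant U
  refine ⟨(collar Ω δ).indicator v, ⟨v, hv, rfl⟩, fun x hx => ?_⟩
  rw [indicator_of_mem hx]
  obtain ⟨t, ht, hxt⟩ := mem_iUnion₂.1 (hT.outer_cover hx)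
  obtain ⟨A, hvA, hAp⟩ := hA t ht
  have hdiam := (hT.outer_quasiUniform t ht).1
  rw [hvA hxt]
  refine hU.abs_interpolant_sub_le (fun y hy => ?_) hdiam hAp hxt
  -- An outer triangle may overhang the collar, but only by its diameter h < δ. It therefore stays
  -- within distance 2δ ≤ δ₀ of ∂Ω, where U is still smooth.
  obtain ⟨q, hq, hqc⟩ := hT.outer_meets t ht
  have hqδ : Metric.infDist q (frontier Ω) ≤ δ :=
    closure_minimal (fun z (hz : z ∈ collar Ω δ) => hz.2.le)
      (isClosed_le (Metric.continuous_infDist_pt _) continuous_const) hqc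
  have hyq : dist y q ≤ h :=
    (Metric.dist_le_diam_of_mem (t.finite_toSet.isCompact_convexHull ℝ).isBounded hy hq).trans hdiam
  have hy2 := Metric.infDist_le_infDist_add_dist (s := frontier Ω) (x := y) (y := q)
  by_cases h : y ∈ Ω
  · exact Or.inl h
  · exact Or.inr ⟨h, by linarith⟩

end Interpolation

/-! ### The quantitative error estimate -/

/-- The sum of the squares of the three terms of the error bound. -/
def squaredRate (μ lam : ℕ) (δ h : ℝ) : ℝ :=
  δ ^ (3 + μ) + (h ^ 2 / δ) ^ 2 + (h ^ lam / δ ^ (lam + 1)) ^ 2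

section Rates

variable {μ lam : ℕ} {δ h : ℝ} (hδ : 0 < δ)
include hδ

omit hδ in
lemma pow_le_squaredRate : δ ^ (3 + μ) ≤ squaredRate μ lam δ h := by
  have h1 : 0 ≤ (h ^ 2 / δ) ^ 2 := sq_nonneg _
  have h2 : 0 ≤ (h ^ lam / δ ^ (lam + 1)) ^ 2 := sq_nonneg _
  unfold squaredRate; linarith

lemma div_sq_le_squaredRate : (h ^ 2 / δ) ^ 2 ≤ squaredRate μ lam δ h := by
  have h1 : 0 < δ ^ (3 + μ) := pow_pos hδ _
  have h2 : 0 ≤ (h ^ lam / δ ^ (lam + 1)) ^ 2 := sq_nonneg _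
  unfold squaredRate; linarith

lemma quotient_sq_le_squaredRate :
    (h ^ lam / δ ^ (lam + 1)) ^ 2 ≤ squaredRate μ lam δ h := by
  have h1 : 0 < δ ^ (3 + μ) := pow_pos hδ _
  have h2 : 0 ≤ (h ^ 2 / δ) ^ 2 := sq_nonneg _
  unfold squaredRate; linarith

lemma squaredRate_nonneg : 0 ≤ squaredRate μ lam δ h :=
  (sq_nonneg _).trans (quotient_sq_le_squaredRate hδ)

variable (hδ1 : δ ≤ 1)
include hδ1

/-- μ ≤ 1 is what makes the squared data error δ⁴ at most δ^{3+μ}. -/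
lemma residual_sq_le (hμ : μ ≤ 1) (p q : ℝ) :
    (p * δ ^ 2 + q * (h ^ lam / δ ^ (lam + 1))) ^ 2
      ≤ (2 * p ^ 2 + 2 * q ^ 2) * squaredRate μ lam δ h := by
  have h1 := quotient_sq_le_squaredRate (μ := μ) (lam := lam) (h := h) hδ
  have h2 : δ ^ 4 ≤ squaredRate μ lam δ h :=
    (pow_le_pow_of_le_one hδ.le hδ1 (by omega)).trans pow_le_squaredRate
  generalize h ^ lam / δ ^ (lam + 1) = b at *
  have h3 := mul_le_mul_of_nonneg_left h1 (sq_nonneg q)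
  have h4 := mul_le_mul_of_nonneg_left h2 (sq_nonneg p)
  nlinarith [sq_nonneg (p * δ ^ 2 - q * b)]

/-- The kernel mass δ⁻² is partly compensated by the collar area δ. The remaining terms δ^{3+2μ} and
h⁴/δ are below δ^{3+μ} and (h²/δ)² because δ ≤ 1. -/
lemma collar_term_le {a c V : ℝ} (ha : 0 ≤ a) (hV : 0 ≤ V) :
    a / δ ^ 2 * ((c * (δ ^ (2 + μ) + h ^ 2)) ^ 2 * (V * δ))
      ≤ 4 * a * (c ^ 2 * V) * squaredRate μ lam δ h := by
  have hS1 : δ ^ (3 + 2 * μ) ≤ squaredRate μ lam δ h :=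
    (pow_le_pow_of_le_one hδ.le hδ1 (by omega)).trans pow_le_squaredRate
  have hS2 := div_sq_le_squaredRate (μ := μ) (lam := lam) (h := h) hδ
  have h1 : a / δ ^ 2 * ((c * (δ ^ (2 + μ) + h ^ 2)) ^ 2 * (V * δ))
      = a * (c ^ 2 * V) * ((δ ^ (2 + μ) + h ^ 2) ^ 2 / δ) := by
    field_simp
  have h2 : (δ ^ (2 + μ) + h ^ 2) ^ 2 / δ ≤ 2 * δ ^ (3 + 2 * μ) + 2 * (h ^ 2 / δ) ^ 2 := by
    rw [div_le_iff₀ hδ]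
    have e1 : (2 * δ ^ (3 + 2 * μ) + 2 * (h ^ 2 / δ) ^ 2) * δ
        = 2 * (δ ^ (2 + μ)) ^ 2 + 2 * ((h ^ 2) ^ 2 / δ) := by
      field_simp
      ring
    have e2 : (h ^ 2) ^ 2 ≤ (h ^ 2) ^ 2 / δ := le_div_self (by positivity) hδ hδ1
    rw [e1]
    nlinarith [sq_nonneg (δ ^ (2 + μ) - h ^ 2)]
  rw [h1]
  calc a * (c ^ 2 * V) * ((δ ^ (2 + μ) + h ^ 2) ^ 2 / δ)
      ≤ a * (c ^ 2 * V) * (4 * squaredRate μ lam δ h) :=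
        mul_le_mul_of_nonneg_left (by linarith) (by positivity)
    _ = 4 * a * (c ^ 2 * V) * squaredRate μ lam δ h := by ring

omit hδ1 in
lemma interior_term_le {a M m : ℝ} (ha : 0 ≤ a) (hm : 0 ≤ m) :
    a / δ ^ 2 * ((M * h ^ 2) ^ 2 * m) ≤ a * (M ^ 2 * m) * squaredRate μ lam δ h := by
  have h1 : a / δ ^ 2 * ((M * h ^ 2) ^ 2 * m) = a * (M ^ 2 * m) * (h ^ 2 / δ) ^ 2 := by
    field_simp
  rw [h1]
  exact mul_le_mul_of_nonneg_left (div_sq_le_squaredRate hδ) (by positivity)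

end Rates

lemma measurable_section_add {k : Plane → Plane → ℝ}
    (hk : Measurable fun p : Plane × Plane => k p.1 p.2) (x : Plane) :
    Measurable fun z => k x (x + z) :=
  hk.comp (measurable_const.prodMk (measurable_const_add x))

section Quantitative

variable {Ω : Set Plane} (hΩ : IsPolygonalDomain Ω) {γ : ℝ → ℝ} (hγ : IsKernelProfile γ)
include hΩ hγ

/-- The consistency error of the polygonal operator. -/
lemma abs_nonlocalOp_sub_laplacian_le {δ₀ M δ t : ℝ} {U : Plane → ℝ} {P : Plane → InscribedPolygon}
    (hU : HasDerivBound (hatDomain Ω δ₀) U M) (hUm : Measurable U) (hδ : 0 < δ) (hδδ₀ : δ ≤ δ₀)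
    (hPm : MeasurableSet {p : Plane × Plane | p.2 ∈ (P p.1).region p.1 δ})
    (ht : 1 / 2 ≤ t) (ht1 : t ≤ 1)
    (hP : ∀ x ∈ hatDomain Ω δ, Metric.ball x (δ * t) ⊆ (P x).region x δ) {x : Plane} (hx : x ∈ Ω) :
    |nonlocalOp (polyKernel (cutProfile γ) δ P) U x - Laplacian.laplacian U x|
      ≤ 4 * M * δ ^ 2 + 8 * M * ((Phi γ 1 - Phi γ t) / δ) := by
  have hball := hΩ.ball_subset_hatDomain (δ := δ) hx
  set q : Plane → ℝ := fun z => polyKernel (cutProfile γ) δ P x (x + z) with hqdef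
  have hq : Measurable q := measurable_section_add (hγ.measurable_polyKernel hδ hPm) x
  have hq0 : ∀ z, 0 ≤ q z := fun z => hγ.polyKernel_nonneg hδ x (x + z)
  have hqJ : ∀ z, q z ≤ radialKernel γ δ z := fun z =>
    (hγ.polyKernel_le hδ x (x + z)).trans_eq (by rw [add_sub_cancel_left])
  -- Both indicators are needed, so the polygon at x + z must contain x as well; x + z may lie in
  -- the collar.
  have hqt : ∀ z, ‖z‖ < t * δ → q z = radialKernel γ δ z := by
    intro z hz
    have hz' : dist (x + z) x < δ * t := by rwa [dist_eq_norm, add_sub_cancel_left, mul_comm]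
    have hzδ : dist (x + z) x < δ := hz'.trans_le (mul_le_of_le_one_right hδ.le ht1)
    have := polyKernel_eq_radialKernel (γ := γ) hδ (hP x (subset_hatDomain Ω δ hx) (Metric.mem_ball.2 hz'))
      (hP _ (hball (Metric.mem_ball.2 hzδ)) (by rwa [Metric.mem_ball, dist_comm]))
    rwa [add_sub_cancel_left] at this
  have h := hU.consistency hUm hγ hδ (hball.trans (IsPolygonalDomain.hatDomain_mono hδδ₀)) hq
    hq0 hqJ ht ht1 hqt
  have e : ∫ z, (U (x + z) - U x) * q z
      = ∫ y, (U y - U x) * polyKernel (cutProfile γ) δ P x y :=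
    integral_add_left_eq_self (fun y => (U y - U x) * polyKernel (cutProfile γ) δ P x y) x
  rw [nonlocalOp, ← e]
  exact h

end Quantitative

/-! ### Modelling error and total error for one pair (δ, h) -/

section ErrorBound

variable {Ω : Set Plane} (hΩ : IsPolygonalDomain Ω) {γ : ℝ → ℝ} (hγ : IsKernelProfile γ)
include hΩ hγ

omit hΩ in
lemma kernelMass_nonneg : 0 ≤ kernelMass γ := by
  have h := hγ.integral_radialKernel (δ := 1) one_pos
  rw [one_pow, div_one] at h
  rw [kernelMass, ← h]
  exact integral_nonneg (hγ.radialKernel_nonneg 1)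

/-- The energy of the difference between the nonlocal solution and a smooth function that
satisfies the local equation, in terms of the residual `τ` and the boundary error `κ`. -/
lemma energy_sub_le {δ₀ M δ t τ κ V Kf Cp : ℝ} {U f₀ f g u : Plane → ℝ}
    {P : Plane → InscribedPolygon}
    (hU : HasDerivBound (hatDomain Ω δ₀) U M) (hUm : Measurable U)
    (hUmem : MemLp U 2 (volume.restrict (hatDomain Ω δ)))
    (hf₀ : ∀ x ∈ Ω, -(Laplacian.laplacian U x) = f₀ x) (hδ : 0 < δ) (hδδ₀ : δ ≤ δ₀)
    (hPm : MeasurableSet {p : Plane × Plane | p.2 ∈ (P p.1).region p.1 δ})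
    (ht : 1 / 2 ≤ t) (ht1 : t ≤ 1)
    (hP : ∀ x ∈ hatDomain Ω δ, Metric.ball x (δ * t) ⊆ (P x).region x δ)
    (hCp : 0 < Cp)
    (hpoinc : ∀ v : Plane → ℝ, MemLp v 2 (volume.restrict (hatDomain Ω δ)) →
      (∀ x ∉ Ω, v x = 0) → ∫ x in hatDomain Ω δ, v x ^ 2
        ≤ Cp * energy (volume.restrict (hatDomain Ω δ)) (polyKernel (cutProfile γ) δ P) v v)
    (hf : ∀ x ∈ Ω, |f x - f₀ x| ≤ Kf * δ ^ 2)
    (hτ : Kf * δ ^ 2 + (4 * M * δ ^ 2 + 8 * M * ((Phi γ 1 - Phi γ t) / δ)) ≤ τ)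
    (hg : ∀ x ∈ collar Ω δ, |g x - U x| ≤ κ) (hV : volume.real (collar Ω δ) ≤ V)
    (hu : IsNonlocalSolution Ω δ (polyKernel γ δ P) f g u) :
    energy (volume.restrict (hatDomain Ω δ)) (polyKernel (cutProfile γ) δ P) (u - U) (u - U)
      ≤ 4 * Cp * (τ ^ 2 * volume.real Ω) + 3 * (4 * (kernelMass γ / δ ^ 2) * (κ ^ 2 * V)) := by
  have hk := hγ.isEnergyKernel hδ hPm (hatDomain Ω δ)
  have hsupp : ∀ x y, δ ≤ dist y x → polyKernel (cutProfile γ) δ P x y = 0 :=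
    fun x y hxy => polyKernel_eq_zero hγ hδ hxy
  have hem := hu.memLp.sub hUmem
  have hres : ∀ᵐ x ∂(volume.restrict Ω),
      |nonlocalOp (polyKernel (cutProfile γ) δ P) (u - U) x| ≤ τ := by
    filter_upwards [nonlocalOp_sub_ae hΩ hk hsupp hu.memLp hUmem, hu.equation,
      ae_restrict_mem hΩ.isOpen.measurableSet] with x h1 h2 hx
    -- The residual of u - U is the data error f₀ - f plus the consistency error ΔU - 𝓛U.
    have h3 := abs_nonlocalOp_sub_laplacian_le hΩ hγ hU hUm hδ hδδ₀ hPm ht ht1 hP hx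
    rw [← nonlocalOp_cutProfile hδ] at h2
    rw [h1]
    have h4 := hf x hx
    rw [← h2, ← hf₀ x hx] at h4
    rw [_root_.abs_le] at h3 h4 ⊢
    constructor <;> linarith [h3.1, h3.2, h4.1, h4.2]
  have hcol : ∀ᵐ x ∂(volume.restrict (collar Ω δ)), |(u - U) x| ≤ κ := by
    filter_upwards [hu.constraint, ae_restrict_mem hΩ.measurableSet_collar] with x h1 hx
    rw [Pi.sub_apply, h1]
    exact hg x hx
  refine (energy_le_of_residual hΩ hk hsupp hCp hpoinc hem hres).trans ?_
  have := energy_collar_le hΩ hk hem hcol hV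
  linarith

/-- The error estimate for one pair `(δ, h)`, with a constant depending only on the data. -/
theorem exists_error_bound {R δ₀ M Kf Kg K V Cφ : ℝ} {μ lam : ℕ} (hR : 0 < R)
    (hΩR : ∀ x ∈ Ω, ∀ y ∈ Ω, dist x y < R) (hμ : μ ≤ 1) (hδ₀ : 0 < δ₀) {U f₀ : Plane → ℝ}
    (hU : HasDerivBound (hatDomain Ω δ₀) U M) (hUm : Measurable U) (hUb : ∀ x, |U x| ≤ M)
    (hf₀ : ∀ x ∈ Ω, -(Laplacian.laplacian U x) = f₀ x)
    (hKg : 0 ≤ Kg) (hV : 0 ≤ V) :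
    ∃ C : ℝ, 0 ≤ C ∧ ∀ (δ h ρ t : ℝ) (P : Plane → InscribedPolygon)
      (f g u gh uh : Plane → ℝ) (T Tc : Set (Finset Plane)),
      0 < h → h < δ → δ ≤ 1 → δ ≤ R → 2 * δ ≤ δ₀ → volume.real (collar Ω δ) ≤ V * δ →
      MeasurableSet {p : Plane × Plane | p.2 ∈ (P p.1).region p.1 δ} →
      1 / 2 ≤ t → t ≤ 1 →
      (∀ x ∈ hatDomain Ω δ, Metric.ball x (δ * t) ⊆ (P x).region x δ) →
      Phi γ 1 - Phi γ t ≤ Cφ * (h / δ) ^ lam →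
      (∀ x ∈ Ω, |f x - f₀ x| ≤ Kf * δ ^ 2) →
      (∀ x ∈ collar Ω δ, |g x - U x| ≤ Kg * δ ^ (2 + μ)) →
      IsNonlocalSolution Ω δ (polyKernel γ δ P) f g u →
      IsCdgMesh Ω δ h ρ T Tc →
      IsBoundaryApprox Ω δ h K Tc g gh →
      IsCdgSolution Ω δ (polyKernel γ δ P) T f gh uh →
      MemLp (u - uh) 2 (volume.restrict (hatDomain Ω δ)) ∧
      energy (volume.restrict (hatDomain Ω δ)) (polyKernel (cutProfile γ) δ P) (u - uh) (u - uh)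
        ≤ C * squaredRate μ lam δ h ∧
      ∫ x in Ω, (u - uh) x ^ 2 ≤ C * squaredRate μ lam δ h := by
  have hM := hU.bound_nonneg
  have hmom := hγ.halfMoment_pos
  have ha := kernelMass_nonneg hγ
  obtain ⟨Cp, hCpdef⟩ : ∃ Cp, Cp = 4 * R ^ 2 / halfMoment γ := ⟨_, rfl⟩
  have hCp : 0 < Cp := by rw [hCpdef]; positivity
  obtain ⟨Cτ, hCτ⟩ : ∃ Cτ, Cτ = 2 * (Kf + 4 * M) ^ 2 + 2 * (8 * M * Cφ) ^ 2 := ⟨_, rfl⟩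
  have hCτ0 : 0 ≤ Cτ := by rw [hCτ]; positivity
  -- L(δ^{2+μ} + h²) will bound g - U, U - gh and g - gh on the collar. The summand 1 accounts for g
  -- - U, the summand |K| for g - gh.
  obtain ⟨L, hL⟩ : ∃ L, L = (1 + |K|) * (Kg + M + 1) := ⟨_, rfl⟩
  have hL0 : 0 ≤ L := by rw [hL]; positivity
  obtain ⟨W, hW⟩ : ∃ W, W = 16 * kernelMass γ * (L ^ 2 * V) := ⟨_, rfl⟩
  have hW0 : 0 ≤ W := by rw [hW]; positivity
  have hm : 0 ≤ volume.real Ω := measureReal_nonneg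
  -- Twice the modelling energy plus twice the approximation energy; W is the cost of one collar
  -- function.
  obtain ⟨C3, hC3⟩ : ∃ C3, C3 = 2 * (4 * Cp * (Cτ * volume.real Ω) + 3 * W)
    + 2 * (4 * (kernelMass γ * (M ^ 2 * volume.real Ω)) + W) := ⟨_, rfl⟩
  have hC30 : 0 ≤ C3 := by rw [hC3]; positivity
  obtain ⟨C4, hC4⟩ : ∃ C4, C4 = Cp * (2 * C3 + 2 * W) := ⟨_, rfl⟩
  have hC40 : 0 ≤ C4 := by rw [hC4]; positivity
  refine ⟨C3 + C4, by positivity, ?_⟩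
  intro δ h ρ t P f g u gh uh T Tc hh hhδ hδ1 hδR hδδ₀ hcol hPm ht ht1 hP hΦ hf hg hu hT hgh huh
  have hδ : 0 < δ := hh.trans hhδ
  have hfin := hΩ.isFiniteMeasure_hatDomain (δ := δ)
  have hk := hγ.isEnergyKernel hδ hPm (hatDomain Ω δ)
  have hpoinc : ∀ v : Plane → ℝ, MemLp v 2 (volume.restrict (hatDomain Ω δ)) →
      (∀ x ∉ Ω, v x = 0) → ∫ x in hatDomain Ω δ, v x ^ 2
        ≤ Cp * energy (volume.restrict (hatDomain Ω δ)) (polyKernel (cutProfile γ) δ P) v v := by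
    intro v hv hv0
    -- Since t ≥ 1/2, points closer than δ/2 lie in each other's polygons and the kernel is radial
    -- there.
    have := poincare hΩ hR hΩR hγ hδ hδR hk (fun x hx y hy hxy => by
      have hlt : dist y x < δ * t := by nlinarith
      exact polyKernel_eq_radialKernel hδ (hP x hx (Metric.mem_ball.2 hlt))
        (hP y hy (by rwa [Metric.mem_ball, dist_comm]))) hv hv0
    rw [hCpdef, div_mul_eq_mul_div, le_div_iff₀ hmom]
    linarith
  obtain ⟨v, hv, hvU⟩ := exists_inner_interpolant hΩ hδ₀ hU hT
  obtain ⟨vc, hvc, hvcU⟩ := exists_outer_interpolant hhδ hδδ₀ hU hT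
  have hghm : MemLp gh 2 (volume.restrict (hatDomain Ω δ)) :=
    memLp_of_mem_cdgSpace hΩ.measurableSet_collar hT.outer.finite hT.outer_cover hgh.1
  have hvm : MemLp v 2 (volume.restrict (hatDomain Ω δ)) :=
    memLp_of_mem_cdgSpace hΩ.isOpen.measurableSet hT.inner.finite
      (hT.inner_domain ▸ subset_closure) hv
  have hUmem : MemLp U 2 (volume.restrict (hatDomain Ω δ)) :=
    MemLp.of_bound hUm.aestronglyMeasurable M (ae_of_all _ hUb)
  obtain ⟨huhm, u0h, hu0h, hdec, -⟩ := huh.exists_energy_eq hΩ hγ hδ hPm hT hgh.1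
  have hem : MemLp (u - uh) 2 (volume.restrict (hatDomain Ω δ)) := hu.memLp.sub huhm
  -- the errors on the collar
  have hpow : 0 ≤ δ ^ (2 + μ) := by positivity
  have hh2 : 0 ≤ h ^ 2 := sq_nonneg h
  obtain ⟨κ, hκ⟩ : ∃ κ, κ = L * (δ ^ (2 + μ) + h ^ 2) := ⟨_, rfl⟩
  have hX : 0 ≤ (Kg + M + 1) * (δ ^ (2 + μ) + h ^ 2) := by positivity
  have hε : Kg * δ ^ (2 + μ) ≤ (Kg + M + 1) * (δ ^ (2 + μ) + h ^ 2) := by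
    have h1 : 0 ≤ Kg * h ^ 2 + (M + 1) * (δ ^ (2 + μ) + h ^ 2) := by positivity
    linarith
  have hκsplit : κ = (Kg + M + 1) * (δ ^ (2 + μ) + h ^ 2)
      + |K| * ((Kg + M + 1) * (δ ^ (2 + μ) + h ^ 2)) := by rw [hκ, hL]; ring
  have hggh : ∀ y ∈ collar Ω δ, |g y - gh y| ≤ |K| * ((Kg + M + 1) * (δ ^ (2 + μ) + h ^ 2)) := by
    intro y hy
    -- The near-best approximation `gh` is compared with the interpolant of U, at distance |g - U| +
    -- |U - vc| from g.
    have h1 := hgh.2 vc hvc (Kg * δ ^ (2 + μ) + M * h ^ 2) (fun x hx => by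
      have h2 := hg x hx
      have h3 := hvcU x hx
      rw [_root_.abs_le] at h2 h3 ⊢
      constructor <;> linarith [h2.1, h2.2, h3.1, h3.2]) y hy
    have h4 : 0 ≤ Kg * δ ^ (2 + μ) + M * h ^ 2 + h ^ 2 := by positivity
    have h5 : Kg * δ ^ (2 + μ) + M * h ^ 2 + h ^ 2
        ≤ (Kg + M + 1) * (δ ^ (2 + μ) + h ^ 2) := by
      have h6 : 0 ≤ Kg * h ^ 2 + (M + 1) * δ ^ (2 + μ) := by positivity
      linarith
    exact h1.trans ((mul_le_mul_of_nonneg_right (le_abs_self K) h4).trans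
      (mul_le_mul_of_nonneg_left h5 (abs_nonneg K)))
  have hKX : 0 ≤ |K| * ((Kg + M + 1) * (δ ^ (2 + μ) + h ^ 2)) := mul_nonneg (abs_nonneg K) hX
  have hS0 := squaredRate_nonneg (μ := μ) (lam := lam) (h := h) hδ
  have hcolS : 4 * (kernelMass γ / δ ^ 2) * (κ ^ 2 * (V * δ)) ≤ W * squaredRate μ lam δ h := by
    have := collar_term_le (μ := μ) (lam := lam) (h := h) (c := L) hδ hδ1 ha hV
    rw [← hκ] at this
    rw [hW]
    linarith
  have hint := interior_term_le (μ := μ) (lam := lam) (h := h) (M := M) hδ ha hm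
  -- the modelling error
  obtain ⟨τ, hτ⟩ : ∃ τ, τ = (Kf + 4 * M) * δ ^ 2 + 8 * M * Cφ * (h ^ lam / δ ^ (lam + 1)) :=
    ⟨_, rfl⟩
  have hτS : τ ^ 2 ≤ Cτ * squaredRate μ lam δ h := by
    rw [hτ, hCτ]
    exact residual_sq_le hδ hδ1 hμ _ _
  have hE1 := energy_sub_le (κ := κ) (τ := τ) hΩ hγ hU hUm hUmem hf₀ hδ (by linarith) hPm ht ht1
    hP hCp hpoinc hf (by
      have h1 : (Phi γ 1 - Phi γ t) / δ ≤ Cφ * (h ^ lam / δ ^ (lam + 1)) := by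
        rw [div_le_iff₀ hδ]
        refine hΦ.trans_eq ?_
        rw [div_pow, pow_succ]
        field_simp
      have h2 := mul_le_mul_of_nonneg_left h1 (by positivity : 0 ≤ 8 * M)
      rw [hτ]
      linarith) (fun x hx => by
      have := hg x hx
      rw [hκsplit]
      linarith) hcol hu
  have hE1' : energy (volume.restrict (hatDomain Ω δ)) (polyKernel (cutProfile γ) δ P)
      (u - U) (u - U) ≤ (4 * Cp * (Cτ * volume.real Ω) + 3 * W) * squaredRate μ lam δ h := by
    have h1 : 4 * Cp * (τ ^ 2 * volume.real Ω)
        ≤ 4 * Cp * (Cτ * squaredRate μ lam δ h * volume.real Ω) := by gcongr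
    linarith
  -- the approximation error
  have hE2 := energy_le_of_bounds hΩ hk (hUmem.sub (hvm.add hghm)) (α := M * h ^ 2) (β := κ)
    (fun x hx => by
      have : gh x = 0 := eq_zero_of_mem_cdgSpace hgh.1 fun h => h.1 hx
      rw [Pi.sub_apply, Pi.add_apply, this, add_zero]
      exact hvU x hx)
    (fun x hx => by
      have h0 : v x = 0 := eq_zero_of_mem_cdgSpace hv hx.1
      rw [Pi.sub_apply, Pi.add_apply, h0, zero_add]
      have h1 := hg x hx
      have h2 := hggh x hx
      rw [hκsplit]
      rw [_root_.abs_le] at h1 h2 ⊢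
      constructor <;> linarith [h1.1, h1.2, h2.1, h2.2]) hcol
  have hE3 : energy (volume.restrict (hatDomain Ω δ)) (polyKernel (cutProfile γ) δ P)
      (u - uh) (u - uh) ≤ C3 * squaredRate μ lam δ h := by
    have h1 := energy_error_le hΩ hγ hδ hPm hT hgh.1 hu huh hv
    have h2 := hk.energy_add_le (hu.memLp.sub hUmem) (hUmem.sub (hvm.add hghm))
    rw [sub_add_sub_cancel] at h2
    rw [hC3]
    linarith
  have hC3S : 0 ≤ C3 * squaredRate μ lam δ h := mul_nonneg hC30 hS0
  have hC4S : 0 ≤ C4 * squaredRate μ lam δ h := mul_nonneg hC40 hS0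
  refine ⟨hem, by linarith, ?_⟩
  have h1 := integral_sq_le_energy hΩ hk hCp hpoinc hem
  -- On the collar u - uh is g - gh almost everywhere, which is already bounded.
  have h2 := energy_collar_le hΩ hk hem (ε := κ) (by
    filter_upwards [hu.constraint, ae_restrict_mem hΩ.measurableSet_collar] with x h3 hx
    have h4 : uh x = gh x := by
      rw [hdec, Pi.add_apply, eq_zero_of_mem_cdgSpace hu0h hx.1, zero_add]
    rw [Pi.sub_apply, h3, h4, hκsplit]
    linarith [hggh x hx]) hcol
  have h3 : Cp * (2 * energy (volume.restrict (hatDomain Ω δ)) (polyKernel (cutProfile γ) δ P)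
        (u - uh) (u - uh) + 2 * energy (volume.restrict (hatDomain Ω δ))
          (polyKernel (cutProfile γ) δ P) ((collar Ω δ).indicator (u - uh))
          ((collar Ω δ).indicator (u - uh)))
      ≤ Cp * (2 * (C3 * squaredRate μ lam δ h) + 2 * (W * squaredRate μ lam δ h)) :=
    mul_le_mul_of_nonneg_left (by linarith) hCp.le
  have h4 : Cp * (2 * (C3 * squaredRate μ lam δ h) + 2 * (W * squaredRate μ lam δ h))
      = C4 * squaredRate μ lam δ h := by rw [hC4]; ring
  linarith

end ErrorBound

/-- The polygons approach the disc at the rate `(h / δ)²`. -/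
lemma eventually_exists_ratio {ι : Type*} {l : Filter ι} {Ω : Set Plane} {δ h : ι → ℝ}
    {P : ι → Plane → InscribedPolygon} {γ : ℝ → ℝ} {lam : ℕ} (hlam : IsRateExponent γ lam)
    (hδ_pos : ∀ i, 0 < δ i) (hh : ∀ i, 0 < h i ∧ h i < δ i) (hP : IsWeaklyQuasiUniform Ω δ P)
    (hn : Tendsto (fun i => maxSides (hatDomain Ω (δ i)) (P i)) l atTop)
    (hnh : Asymptotics.IsTheta l (fun i => (maxSides (hatDomain Ω (δ i)) (P i) : ℝ))
      (fun i => δ i / h i)) :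
    ∃ Cφ : ℝ, ∀ᶠ i in l, ∃ t : ℝ, 1 / 2 ≤ t ∧ t ≤ 1 ∧
      (∀ x ∈ hatDomain Ω (δ i), Metric.ball x (δ i * t) ⊆ (P i x).region x (δ i)) ∧
      Phi γ 1 - Phi γ t ≤ Cφ * (h i / δ i) ^ lam := by
  obtain ⟨c, hc, hball⟩ := hP.exists_ball_subset hδ_pos
  obtain ⟨CΦ, hCΦ, hΦ⟩ := hlam.exists_bound
  obtain ⟨c', hc', hN⟩ := hnh.2.exists_pos
  set N : ι → ℝ := fun i => (maxSides (hatDomain Ω (δ i)) (P i) : ℝ) with hNdef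
  have hNt : Tendsto N l atTop := tendsto_natCast_atTop_atTop.comp hn
  have ht : Tendsto (fun i => 1 - c / N i ^ 2) l (𝓝 1) := by
    have h1 : Tendsto (fun i => c / N i ^ 2) l (𝓝 0) :=
      tendsto_const_nhds.div_atTop ((tendsto_pow_atTop two_ne_zero).comp hNt)
    simpa using tendsto_const_nhds.sub h1
  have hle : ∀ i, 1 - c / N i ^ 2 ≤ 1 := fun i => by
    have : 0 ≤ c / N i ^ 2 := by positivity
    linarith
  have ht' : Tendsto (fun i => 1 - c / N i ^ 2) l (𝓝[≤] 1) :=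
    tendsto_nhdsWithin_iff.2 ⟨ht, Eventually.of_forall hle⟩
  -- The natural-number division in λ/2 is exact, as λ is 2 or 4.
  have heven : 2 * (lam / 2) = lam := by
    rcases hlam with ⟨rfl, -⟩ | ⟨rfl, -⟩ <;> rfl
  refine ⟨CΦ * (c * c' ^ 2) ^ (lam / 2), ?_⟩
  filter_upwards [ht'.eventually hΦ, ht.eventually (eventually_ge_nhds (by norm_num : (1 / 2 : ℝ) < 1)),
    hN.bound, hNt.eventually_gt_atTop 0] with i h1 h2 h3 h4
  refine ⟨1 - c / N i ^ 2, h2, hle i, hball i, h1.trans ?_⟩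
  obtain ⟨hh0, hhδ⟩ := hh i
  have hδ0 := hδ_pos i
  rw [Real.norm_of_nonneg (div_pos hδ0 hh0).le, Real.norm_of_nonneg h4.le,
    div_le_iff₀ hh0] at h3
  -- The bound δ/h ≤ c' n_δ turns 1 - t = c / n_δ² into (h/δ)².
  have h5 : c / N i ^ 2 ≤ c * c' ^ 2 * (h i / δ i) ^ 2 := by
    have h6 : 1 / N i ≤ c' * (h i / δ i) := by
      rw [div_le_iff₀ h4, mul_div_assoc', div_mul_eq_mul_div, le_div_iff₀ hδ0]
      linarith
    calc c / N i ^ 2 = c * (1 / N i) ^ 2 := by rw [div_pow, one_pow]; ring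
      _ ≤ c * (c' * (h i / δ i)) ^ 2 := by gcongr
      _ = c * c' ^ 2 * (h i / δ i) ^ 2 := by ring
  have h0 : 0 ≤ c / N i ^ 2 := by positivity
  calc CΦ * (1 - (1 - c / N i ^ 2)) ^ (lam / 2)
      = CΦ * (c / N i ^ 2) ^ (lam / 2) := by rw [sub_sub_cancel]
    _ ≤ CΦ * (c * c' ^ 2 * (h i / δ i) ^ 2) ^ (lam / 2) := by gcongr
    _ = CΦ * (c * c' ^ 2) ^ (lam / 2) * (h i / δ i) ^ lam := by
        rw [mul_pow, ← pow_mul, heven, mul_assoc]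

/-- A sum of squares of positive terms is at most the square of the sum. The added 1 makes the
constant positive. -/
lemma sqrt_squaredRate_le {μ lam : ℕ} {δ h : ℝ} (hδ : 0 < δ) (hh : 0 < h) {C x : ℝ} (hC : 0 ≤ C)
    (hx : x ≤ C * squaredRate μ lam δ h) :
    Real.sqrt x ≤ (Real.sqrt C + 1) *
      (δ ^ ((3 + (μ : ℝ)) / 2) + h ^ 2 / δ + h ^ lam / δ ^ (lam + 1)) := by
  have hp : (δ ^ ((3 + (μ : ℝ)) / 2)) ^ 2 = δ ^ (3 + μ) := by
    rw [← Real.rpow_natCast, ← Real.rpow_mul hδ.le, ← Real.rpow_natCast]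
    congr 1; push_cast; ring
  have h1 : 0 < δ ^ ((3 + (μ : ℝ)) / 2) := Real.rpow_pos_of_pos hδ _
  have h2 : 0 < h ^ 2 / δ := by positivity
  have h3 : 0 < h ^ lam / δ ^ (lam + 1) := by positivity
  have hS : squaredRate μ lam δ h
      ≤ (δ ^ ((3 + (μ : ℝ)) / 2) + h ^ 2 / δ + h ^ lam / δ ^ (lam + 1)) ^ 2 := by
    rw [squaredRate, ← hp]
    nlinarith [mul_pos h1 h2, mul_pos h1 h3, mul_pos h2 h3]
  have h4 : Real.sqrt x ≤ Real.sqrt C *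
      (δ ^ ((3 + (μ : ℝ)) / 2) + h ^ 2 / δ + h ^ lam / δ ^ (lam + 1)) := by
    rw [Real.sqrt_le_left (by positivity), mul_pow, Real.sq_sqrt hC]
    exact hx.trans (mul_le_mul_of_nonneg_left hS hC)
  refine h4.trans (mul_le_mul_of_nonneg_right ?_ (by positivity))
  linarith

lemma eLpNorm_two_eq_sqrt {ν : Measure Plane} {e : Plane → ℝ} (he : MemLp e 2 ν) :
    eLpNorm e 2 ν = ENNReal.ofReal (Real.sqrt (∫ x, e x ^ 2 ∂ν)) := by
  rw [he.eLpNorm_eq_integral_rpow_norm two_ne_zero ENNReal.ofNat_ne_top, Real.sqrt_eq_rpow]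
  simp

/-- Returns from the cut kernel on the product space to the iterated integral with the given kernel.
-/
lemma energyNorm_eq_sqrt {D : Set Plane} {γ : ℝ → ℝ} {δ A : ℝ} {P : Plane → InscribedPolygon}
    (hδ : 0 < δ) (hk : IsEnergyKernel (volume.restrict D) (polyKernel (cutProfile γ) δ P) A)
    {e : Plane → ℝ} (he : MemLp e 2 (volume.restrict D)) :
    energyNorm D (polyKernel γ δ P) e
      = Real.sqrt (energy (volume.restrict D) (polyKernel (cutProfile γ) δ P) e e) := by
  rw [energyNorm, ← energyInner_cutProfile hδ, hk.energy_eq_iterated he he, energyInner]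

/-- A measurable globally bounded replacement of the extension. -/
lemma HasDerivBound.indicator {D : Set Plane} {u : Plane → ℝ} {M : ℝ} (h : HasDerivBound D u M) :
    HasDerivBound D (D.indicator u) M ∧ Measurable (D.indicator u) ∧
      ∀ x, |D.indicator u x| ≤ M := by
  classical
  refine ⟨h.congr fun x hx => indicator_of_mem hx u, ?_, fun x => ?_⟩
  · rw [← piecewise_eq_indicator]
    exact h.contDiffOn.continuousOn.measurable_piecewise continuousOn_const h.isOpen.measurableSet
  · by_cases hx : x ∈ D
    · rw [indicator_of_mem hx]; exact h.abs_le hx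
    · rw [indicator_of_notMem hx, abs_zero]; exact h.bound_nonneg

end NonlocalCDG

end

/-! ### Assembly of the estimates along the family -/

theorem mainTheorem7
    -- the polygonal domain, the local problem, and the `C⁴` extension of its solution
    (Ω : Set NonlocalCDG.Plane) (hΩ : NonlocalCDG.IsPolygonalDomain Ω)
    (f₀ g₀ u₀ uext : NonlocalCDG.Plane → ℝ)
    (hu₀ : NonlocalCDG.IsLocalSolution Ω f₀ g₀ u₀)
    (δ₀ : ℝ) (hδ₀ : 0 < δ₀)
    (huext : NonlocalCDG.IsCb 4 (NonlocalCDG.hatDomain Ω δ₀) uext)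
    (huext_eq : ∀ x ∈ Ω, uext x = u₀ x)
    -- the kernel profile and the exponent `λ`
    (γ : ℝ → ℝ) (hγ : NonlocalCDG.IsKernelProfile γ)
    (lam : ℕ) (hlam : NonlocalCDG.IsRateExponent γ lam)
    -- horizons `δ i → 0` along `l` and mesh sizes `h i < δ i`
    {ι : Type*} (l : Filter ι) (δ h : ι → ℝ)
    (hδ_pos : ∀ i, 0 < δ i) (hδ : Filter.Tendsto δ l (nhds 0))
    (hh : ∀ i, 0 < h i ∧ h i < δ i)
    -- right-hand sides and volume constraints
    (f g : ι → NonlocalCDG.Plane → ℝ) (μ : ℕ) (hμ : μ = 0 ∨ μ = 1)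
    (hf : ∃ K : ℝ, ∀ᶠ i in l, ∀ x ∈ Ω, |f i x - f₀ x| ≤ K * δ i ^ 2)
    (hg : ∃ K : ℝ, ∀ᶠ i in l, ∀ x ∈ NonlocalCDG.collar Ω (δ i),
      |g i x - uext x| ≤ K * δ i ^ (2 + μ))
    -- the inscribed polygons, with `n_δ ∼ δ / h` and `n_δ → ∞`
    (P : ι → NonlocalCDG.Plane → NonlocalCDG.InscribedPolygon)
    (hP_meas : ∀ i, MeasurableSet
      {p : NonlocalCDG.Plane × NonlocalCDG.Plane | p.2 ∈ (P i p.1).region p.1 (δ i)})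
    (hP : NonlocalCDG.IsWeaklyQuasiUniform Ω δ P)
    (hn : Filter.Tendsto
      (fun i => NonlocalCDG.maxSides (NonlocalCDG.hatDomain Ω (δ i)) (P i)) l Filter.atTop)
    (hnh : Asymptotics.IsTheta l
      (fun i => (NonlocalCDG.maxSides (NonlocalCDG.hatDomain Ω (δ i)) (P i) : ℝ))
      (fun i => δ i / h i))
    (hσ : ∀ j : Fin 2, ∀ x ∈ Ω, Filter.Tendsto
      (fun i => NonlocalCDG.firstMoment (NonlocalCDG.hatDomain Ω (δ i))
        (NonlocalCDG.polyKernel γ (δ i) (P i)) j x) l (nhds 0))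
    -- the solution of the nonlocal problem
    (u : ι → NonlocalCDG.Plane → ℝ)
    (hu : ∀ i, NonlocalCDG.IsNonlocalSolution Ω (δ i)
      (NonlocalCDG.polyKernel γ (δ i) (P i)) (f i) (g i) (u i))
    -- the meshes, quasi-uniform for each fixed horizon, and the CDG solution
    (T Tc : ι → Set (Finset NonlocalCDG.Plane))
    (ρ : ℝ → ℝ) (hρ : ∀ s, 0 < s → 0 < ρ s)
    (hT : ∀ i, NonlocalCDG.IsCdgMesh Ω (δ i) (h i) (ρ (δ i)) (T i) (Tc i))
    (gh uh : ι → NonlocalCDG.Plane → ℝ)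
    (hgh : ∃ K : ℝ, ∀ i,
      NonlocalCDG.IsBoundaryApprox Ω (δ i) (h i) K (Tc i) (g i) (gh i))
    (huh : ∀ i, NonlocalCDG.IsCdgSolution Ω (δ i)
      (NonlocalCDG.polyKernel γ (δ i) (P i)) (T i) (f i) (gh i) (uh i)) :
    ∃ C : ℝ, 0 < C ∧ ∀ᶠ i in l,
      NonlocalCDG.energyNorm (NonlocalCDG.hatDomain Ω (δ i))
          (NonlocalCDG.polyKernel γ (δ i) (P i)) (u i - uh i) ≤
        C * (δ i ^ ((3 + (μ : ℝ)) / 2) + h i ^ 2 / δ i + h i ^ lam / δ i ^ (lam + 1)) ∧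
      MeasureTheory.eLpNorm (u i - uh i) 2 (MeasureTheory.volume.restrict Ω) ≤
        ENNReal.ofReal
          (C * (δ i ^ ((3 + (μ : ℝ)) / 2) + h i ^ 2 / δ i + h i ^ lam / δ i ^ (lam + 1))) := by
  obtain ⟨M, hM⟩ := huext.hasDerivBound hΩ.isOpen_hatDomain
  obtain ⟨hU, hUm, hUb⟩ := hM.indicator
  -- Extending by zero makes U measurable and bounded on the whole plane without changing it on the
  -- open set where it is C⁴.
  set U := (NonlocalCDG.hatDomain Ω δ₀).indicator uext
  have hUeq : Set.EqOn U uext (NonlocalCDG.hatDomain Ω δ₀) := fun x hx =>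
    Set.indicator_of_mem hx uext
  have hf₀ : ∀ x ∈ Ω, -(Laplacian.laplacian U x) = f₀ x := by
    intro x hx
    rw [← hu₀.equation x hx]
    -- U agrees with u₀ on the open set Ω, hence near `x`, so the Laplacians coincide.
    have h1 : U =ᶠ[nhds x] u₀ := by
      filter_upwards [hΩ.isOpen.mem_nhds hx] with y hy
      rw [hUeq (Or.inl hy), huext_eq y hy]
    rw [(InnerProductSpace.laplacian_congr_nhds h1).eq_of_nhds]
  obtain ⟨R₀, hR₀⟩ := Metric.isBounded_iff.1 hΩ.isBounded
  have hR : 0 < |R₀| + 1 := by positivity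
  have hΩR : ∀ x ∈ Ω, ∀ y ∈ Ω, dist x y < |R₀| + 1 := fun x hx y hy =>
    lt_of_le_of_lt ((hR₀ hx hy).trans (le_abs_self R₀)) (lt_add_one _)
  obtain ⟨Kf, hf⟩ := hf
  obtain ⟨Kg, hg⟩ := hg
  obtain ⟨K, hgh⟩ := hgh
  obtain ⟨V, η, hV, hη, hcol⟩ := hΩ.exists_volume_collar_le
  obtain ⟨Cφ, hφ⟩ := NonlocalCDG.eventually_exists_ratio hlam hδ_pos hh hP hn hnh
  obtain ⟨C, hC, hbound⟩ := NonlocalCDG.exists_error_bound hΩ hγ (Kf := Kf) (Kg := |Kg|) (K := K)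
    (Cφ := Cφ) (μ := μ) (lam := lam) hR hΩR (by rcases hμ with rfl | rfl <;> norm_num) hδ₀ hU hUm
    hUb hf₀ (abs_nonneg Kg) hV
  refine ⟨Real.sqrt C + 1, by positivity, ?_⟩
  have hsmall : ∀ ε : ℝ, 0 < ε → ∀ᶠ i in l, δ i ≤ ε := fun ε hε =>
    (hδ.eventually (gt_mem_nhds hε)).mono fun i hi => hi.le
  -- Smallness of δ is required four times: for comparing powers, for the Poincaré inequality, for
  -- the overhanging outer triangles, and for the area of the collar.
  filter_upwards [hf, hg, hφ, hsmall 1 one_pos, hsmall _ hR, hsmall (δ₀ / 2) (by positivity),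
    hsmall η hη] with i hfi hgi ⟨t, ht, ht1, hball, hΦ⟩ h1 hRi hδi hηi
  have hδi_pos := hδ_pos i
  have hcoli : MeasureTheory.volume.real (NonlocalCDG.collar Ω (δ i)) ≤ V * δ i :=
    ENNReal.toReal_le_of_le_ofReal (by positivity) (hcol _ hδi_pos hηi)
  obtain ⟨hmem, hE, hL⟩ := hbound (δ i) (h i) (ρ (δ i)) t (P i) (f i) (g i) (u i) (gh i) (uh i)
    (T i) (Tc i) (hh i).1 (hh i).2 h1 hRi (by linarith) hcoli (hP_meas i) ht ht1 hball hΦ hfi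
    (fun x hx => by
      rw [hUeq (NonlocalCDG.IsPolygonalDomain.hatDomain_mono (by linarith) (Or.inr hx))]
      exact (hgi x hx).trans (mul_le_mul_of_nonneg_right (le_abs_self Kg) (by positivity)))
    (hu i) (hT i) (hgh i) (huh i)
  refine ⟨?_, ?_⟩
  · rw [NonlocalCDG.energyNorm_eq_sqrt hδi_pos (hγ.isEnergyKernel hδi_pos (hP_meas i) _) hmem]
    exact NonlocalCDG.sqrt_squaredRate_le hδi_pos (hh i).1 hC hE
  · rw [NonlocalCDG.eLpNorm_two_eq_sqrt (hmem.mono_measure (MeasureTheory.Measure.restrict_mono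
      (NonlocalCDG.subset_hatDomain Ω (δ i)) (le_refl MeasureTheory.volume)))]
    exact ENNReal.ofReal_le_ofReal (NonlocalCDG.sqrt_squaredRate_le hδi_pos (hh i).1 hC hL)
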